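/- **Setting.** In the *Rectilinear Steiner Arborescence* problem (RSA) the input is a sequence of requests $p_1=(x_1,y_1),\dots,p_N=(x_N,y_N)$ in the closed positive quadrant with $y_1\le\dots\le y_N$ ($N$ is the number of Steiner points). A solution is a finite collection of horizontal and vertical segments that contains, for each $i$, a path from the origin $(0,0)$ to $p_i$ that is both $x$-monotone and $y$-monotone. Its cost is the sum of the lengths of its segments, and $\mathrm{opt}$ is the minimum cost. A (deterministic) online algorithm must, when $p_i$ arrives, and knowing only $p_1,\dots,p_i$, add segments to its solution that make it a solution for $p_1,\dots,p_i$. It never deletes a segment, and the segments added for $p_i$ lie at heights $\ge y_{i-1}$ (with $y_0=0$). Logarithms are to the base 2. Put $f(N)=\frac{\log N}{\log\log N}$ for $N\ge4$ and $f(N)=f(4)=2$ for $N<4$. **Theorem.** The algorithm onRSA defined below, whatever choices are made where it says "some", is an online algorithm for RSA. It is $O\!\left(\frac{\log N}{\log\log N}\right)$-competitive: there is a constant $K>0$ such that for all $N$, all request sequences of length $N$ and all choices, its cost is at most $K\,f(N)\cdot\mathrm{opt}$. It is optimal: there is a constant $c>0$ such that for every deterministic online algorithm $A$ for RSA and every $N\ge1$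 there is a sequence of $N$ distinct requests with $\mathrm{opt}>0$ on which the cost of $A$ is at least $c\,f(N)\cdot\mathrm{opt}$. **Algorithm onRSA.** *(a) Pseudo online algorithm on the grid.* A pair $(v,t)\in\mathbb N^2$ is called a replica (of the node $v$ at time $t$). The solution $F$ is a set of replicas, initially $\{(0,0)\}$. Grid requests $r_i=(v_i,t_i)$ have nondecreasing times ($t_0=0$). For $r_i$: add $(0,t)$ for $t_{i-1}\le t\le t_i$. Let $\rho_i$ be the minimum of $\max(v_i-u,\,t_i-s)$ over all $(u,s)\in F$ with $u\le v_i$, $s\le t_i$. Among the replicas of $F$ in $[v_i-5\rho_i,v_i]\times[t_i-5\rho_i,t_i]$ let $u_i$ be the leftmost node, and take some replica $(u_i,s_i)$ of $F$ in this square. Add to $F$ the replicas $(u_i,t)$ with $s_i\le t\le t_i$, the *base* replicas $(u,t_i)$ with $u_i\le u\le v_i$, and the *tail* replicas $(u_i,t)$ with $t_i\le t\le t_i+4\rho_i$. *(b) Online algorithm on the grid (for Directed-MCD), with nodes $0,\dots,n-1$.* Let $\delta=\lceil\log n/\log\log n\rceil$. Intervals of level $l$ are the sets of nodes with equal $\lfloor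 v/\delta^l\rfloor$. The level-$l$ neighborhood of $v$ consists of the nodes $u\le v$ in the level-$l$ interval of $v$ or in the interval immediately to its left. Simulate (a). The set $C_t$ of nodes storing a copy for time $t$ is given by $C_0=\{0\}$ and the following storage phase at each time $t$. Start $C_{t+1}$ with $0$ and all $u$ for which $(u,t)$ is a tail replica. Then for $l=0,1,\dots,\lfloor\log_\delta n\rfloor$ and, for each $l$, for $v=0,1,\dots,n-1$: if $v$ has a base or tail replica at one of the times $t-\delta^l+1,\dots,t$ and the level-$l$ neighborhood of $v$ does not meet the current $C_{t+1}$, add to $C_{t+1}$ some node $u$ of that neighborhood such that $u\in C_t$ or $(u,t)$ is a base replica. In the delivery phase, a request $r_i$ is served by the route at time $t_i$ from node $w_i$ to node $v_i$, where $w_i$ is the rightmost node $\le u_i$ that is in $C_{t_i}$ or on the route of an earlier request of the same time $t_i$. *(c) RSA with points in $[0,n]\times[0,\infty)$.* A point $p_i=(x_i,y_i)$ is rounded to the grid request $r_i=(v_i,t_i)$ with $v_i=\min(\lfloor x_i\rfloor,n-1)$, $t_i=\lceil y_i\rceil$ ($t_0=0$). When $p_i$ arrives, run (b) on the rounded requests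 and draw: for each $t=t_{i-1},\dots,t_i-1$ and each $v\in C_{t+1}$ the segment from $(v,t)$ to $(v,t+1)$; the segments from $(w_i,y_i)$ to $(v_i,y_i)$ and from $(v_i,y_i)$ to $p_i$; and the segments from $(u,y_i)$ to $(u,t_i)$ for all nodes $w_i\le u\le v_i$. *(d) Guesses.* The requests are partitioned online into consecutive subsets, each with a guess $M$ for the largest $x$-coordinate, a guess $n$ for the number of requests, and an origin $(0,y^0)$. The request $p_i$ joins the current subset if $x_i\le M$ and $i\le n$. Otherwise (and for $i=1$) it opens a new subset, with $M=2^{\lceil\log\max_{j\le i}x_j\rceil}$ ($M=0$ if $x_1=\dots=x_i=0$), with $n$ the first member of the sequence $4,\,4^4,\,4^{16},\dots$ (each term the 4th power of the previous one) that is at least $i$, and with $y^0=y_{i-1}$ ($y^0=0$ for $i=1$). On each subset with $M>0$ the algorithm runs (c) with its parameter $n$ in the coordinates $(x\cdot\frac nM,(y-y^0)\cdot\frac nM)$ and transforms the segments drawn back. In a subset with $M=0$ it draws, for each $p_i$, the segment from $(0,y_{i-1})$ to $(0,y_i)$. -/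

import Mathlib

namespace RSA

/-! ## The rectilinear Steiner arborescence problem -/

/-- A point `(x, y)` of the plane. -/
abbrev Point := ℝ × ℝ

/-- A rectilinear segment: `horiz y a b` joins `(a, y)` and `(b, y)`,
`vert x a b` joins `(x, a)` and `(x, b)`. -/
inductive Seg
  | horiz (y a b : ℝ)
  | vert (x a b : ℝ)

/-- The length of a segment. -/
def Seg.length : Seg → ℝ
  | .horiz _ a b => |b - a|
  | .vert _ a b => |b - a|

/-- The set of points of a segment. -/
def Seg.carrier : Seg → Set Point
  | .horiz y a b => {p | p.1 ∈ Set.uIcc a b ∧ p.2 = y}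
  | .vert x a b => {p | p.1 = x ∧ p.2 ∈ Set.uIcc a b}

/-- The cost of a finite collection of segments: the sum of their lengths. -/
noncomputable def cost (F : List Seg) : ℝ := (F.map Seg.length).sum

/-- The points covered by a collection of segments. -/
def covered (F : List Seg) : Set Point := {p | ∃ s ∈ F, p ∈ s.carrier}

/-- One straight piece of a path inside `F` that is both `x`-monotone and `y`-monotone: from `a`
one moves to the right or upwards to `b`, and the segment between `a` and `b` (which for such
`a`, `b` is the order interval `Set.Icc a b` of the plane) is covered by `F`. -/
def MonoStep (F : List Seg) (a b : Point) : Prop :=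
  ((a.1 ≤ b.1 ∧ a.2 = b.2) ∨ (a.1 = b.1 ∧ a.2 ≤ b.2)) ∧ Set.Icc a b ⊆ covered F

/-- `F` contains, for each request in `Q`, an `x`- and `y`-monotone rectilinear path from the
origin to the request. -/
def Feasible (F : List Seg) (Q : List Point) : Prop :=
  ∀ p ∈ Q, Relation.ReflTransGen (MonoStep F) (0, 0) p

/-- The minimum cost of a feasible solution. -/
noncomputable def optCost (Q : List Point) : ℝ :=
  sInf {c | ∃ F : List Seg, Feasible F Q ∧ cost F = c}

/-- Request sequences of the online problem: points of the (closed) positive quadrant, in the order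
of nondecreasing `y`-coordinates. -/
def ValidRequests (Q : List Point) : Prop :=
  (∀ p ∈ Q, 0 ≤ p.1 ∧ 0 ≤ p.2) ∧ (Q.map Prod.snd).Pairwise (· ≤ ·)

/-! ## Online algorithms -/

/-- A deterministic online algorithm: `A h p` lists the segments that are added to the solution
when the request `p` arrives after the requests in `h` were handled. Nothing is ever deleted. -/
abbrev Algorithm := List Point → Point → List Seg

/-- The segments added for the requests of the second list, if those of the first one were
handled before. -/
def runFrom (A : Algorithm) : List Point → List Point → List Seg
  | _, [] => []
  | h, p :: Q => A h p ++ runFrom A (h ++ [p]) Q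

/-- The solution of `A` on the request sequence `Q`. -/
def run (A : Algorithm) (Q : List Point) : List Seg := runFrom A [] Q

/-- The `y`-coordinate of the last request (that of the origin if there was none). -/
noncomputable def lastY (h : List Point) : ℝ := (h.getLast?.map Prod.snd).getD 0

/-- `A` solves the online problem: every request is connected when it arrives, and the segments
added then lie at or above the height of the previous request. -/
def IsOnline (A : Algorithm) : Prop :=
  ∀ (h : List Point) (p : Point), ValidRequests (h ++ [p]) →
    (∀ s ∈ A h p, ∀ z ∈ s.carrier, lastY h ≤ z.2) ∧ Feasible (run A (h ++ [p])) (h ++ [p])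

/-- `log N / log log N` (logarithms to the base 2), with the value at `4` for `N < 4`. -/
noncomputable def logRatio (N : ℕ) : ℝ :=
  Real.logb 2 (max N 4 : ℕ) / Real.logb 2 (Real.logb 2 (max N 4 : ℕ))

/-! ## The pseudo online algorithm on the grid

A pair `(v, t) : ℕ × ℕ` is the replica of the network node `v` at time `t`. -/

/-- The choices which the algorithms leave open: an arbitrary element of a nonempty set of times,
and an arbitrary element of a nonempty set of nodes. -/
structure TieBreak where
  time : Finset ℕ → ℕ
  time_mem : ∀ S : Finset ℕ, S.Nonempty → time S ∈ S
  node : Finset ℕ → ℕ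
  node_mem : ∀ S : Finset ℕ, S.Nonempty → node S ∈ S

/-- The replicas of node `v` from time `s` to time `t`. -/
def col (v s t : ℕ) : Finset (ℕ × ℕ) := {v} ×ˢ Finset.Icc s t

/-- The replicas of the nodes from `u` to `v` at time `t`. -/
def row (u v t : ℕ) : Finset (ℕ × ℕ) := Finset.Icc u v ×ˢ {t}

/-- The nodes that have a replica at time `t` in `F`. -/
def nodesAt (F : Finset (ℕ × ℕ)) (t : ℕ) : Finset ℕ := (F.filter (fun q => q.2 = t)).image Prod.fst

/-- The times at which `F` has a replica of the node `u`. -/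
def timesAt (F : Finset (ℕ × ℕ)) (u : ℕ) : Finset ℕ := (F.filter (fun q => q.1 = u)).image Prod.snd

/-- The distance from `F` to `r` in the directed `L_∞` norm (only replicas that are not to the
right of `r` and not later than `r` count). -/
def radius (F : Finset (ℕ × ℕ)) (r : ℕ × ℕ) : ℕ :=
  (((F.filter (fun q => q.1 ≤ r.1 ∧ q.2 ≤ r.2)).image
    (fun q => max (r.1 - q.1) (r.2 - q.2))).min).untopD 0

/-- The replicas of `F` in the square with side length `ρ` and upper right corner `r`. -/
def inSquare (F : Finset (ℕ × ℕ)) (r : ℕ × ℕ) (ρ : ℕ) : Finset (ℕ × ℕ) :=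
  F.filter (fun q => (q.1 ≤ r.1 ∧ r.1 ≤ q.1 + ρ) ∧ (q.2 ≤ r.2 ∧ r.2 ≤ q.2 + ρ))

/-- The state of the pseudo online algorithm: the replicas `sol` in its solution, the base
replicas, the tail replicas, the time of the last request and its serving node. -/
structure SquareState where
  sol : Finset (ℕ × ℕ)
  base : Finset (ℕ × ℕ)
  tail : Finset (ℕ × ℕ)
  time : ℕ
  node : ℕ

/-- Before the first request the solution consists of the origin. -/
def squareInit : SquareState := ⟨{(0, 0)}, ∅, ∅, 0, 0⟩

/-- The pseudo online algorithm handles the request `r`: the column of the origin is extended to the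
time of `r`; `ρ` is the radius of `r`; the serving replica `(u, s)` is one of the leftmost replicas of
the solution in the square with side length `5 * ρ`; the solution is extended by the path from
`(u, s)` via `(u, t)` to `r`, where `t` is the time of `r` (its horizontal part consists of base
replicas), and by the tail, which keeps a copy at `u` until the time `t + 4 * ρ`. -/
def squareStep (τ : TieBreak) (σ : SquareState) (r : ℕ × ℕ) : SquareState :=
  let F := σ.sol ∪ col 0 σ.time r.2
  let ρ := radius F r
  let S := inSquare F r (5 * ρ)
  let u := ((S.image Prod.fst).min).untopD 0
  let s := τ.time (timesAt S u)
  { sol := F ∪ col u s r.2 ∪ row u r.1 r.2 ∪ col u r.2 (r.2 + 4 * ρ)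
    base := σ.base ∪ row u r.1 r.2
    tail := σ.tail ∪ col u r.2 (r.2 + 4 * ρ)
    time := r.2
    node := u }

/-! ## The online algorithm on the grid

The network nodes are `0, …, n - 1`. The intervals of level `l` are the sets of nodes with the same
quotient `v / δ ^ l`. -/

/-- The nodes `u ≤ v` in the interval of level `l` of `v` or in the interval to the left of it. -/
def nbhd (δ l v : ℕ) : Finset ℕ :=
  (Finset.range (v + 1)).filter (fun u => v / δ ^ l ≤ u / δ ^ l + 1)

/-- `v` has a base or tail replica at one of the times `t - δ ^ l + 1, …, t`. -/
def StayActive (δ l : ℕ) (σ : SquareState) (v t : ℕ) : Prop :=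
  ∃ q ∈ σ.base ∪ σ.tail, q.1 = v ∧ q.2 ≤ t ∧ t < q.2 + δ ^ l

instance instDecidableStayActive (δ l : ℕ) (σ : SquareState) (v t : ℕ) : Decidable (StayActive δ l σ v t) := by
  unfold StayActive; infer_instance

/-- The storage phase at time `t`, if `C` is the set of nodes that hold a stored copy at time `t`:
the set of nodes that keep a copy for time `t + 1`. The origin and the nodes with a tail replica at
time `t` do. Then, level by level and from left to right, for each stay-active node without a
selected node in its neighborhood, a node of this neighborhood is selected. -/
def storage (τ : TieBreak) (δ n : ℕ) (σ : SquareState) (t : ℕ) (C : Finset ℕ) : Finset ℕ :=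
  (List.range (Nat.log δ n + 1)).foldl (fun D l =>
    (List.range n).foldl (fun E v =>
      if StayActive δ l σ v t ∧ E ∩ nbhd δ l v = ∅ then
        insert (τ.node (nbhd δ l v ∩ (nodesAt σ.base t ∪ C))) E
      else E) D) ({0} ∪ nodesAt σ.tail t)

/-- The set of nodes that hold a stored copy at a given time. For time `t` it depends only on the
requests of times less than `t`. -/
def kept (τ : TieBreak) (δ n : ℕ) (σ : SquareState) : ℕ → Finset ℕ
  | 0 => {0}
  | t + 1 => storage τ δ n σ t (kept τ δ n σ t)

/-- The state of the online algorithm on the grid: the state of the simulated pseudo online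
algorithm, the replicas on the delivery routes, and the node from which the last request
was served. -/
structure LineState where
  sq : SquareState
  routes : Finset (ℕ × ℕ)
  src : ℕ

/-- The state before the first request. -/
def lineInit : LineState := ⟨squareInit, ∅, 0⟩

/-- The delivery phase for the request `r`: it is served from the rightmost node that has a copy and
is not to the right of the serving node of the pseudo online algorithm. -/
def lineStep (τ : TieBreak) (δ n : ℕ) (s : LineState) (r : ℕ × ℕ) : LineState :=
  let sq := squareStep τ s.sq r
  let avail := kept τ δ n s.sq r.2 ∪ nodesAt s.routes r.2
  let u := ((avail.filter (fun w => w ≤ sq.node)).max).unbotD 0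
  { sq := sq
    routes := s.routes ∪ row u r.1 r.2
    src := u }

/-- The online algorithm on the grid after the requests in `R`. -/
def lineRun (τ : TieBreak) (δ n : ℕ) (R : List (ℕ × ℕ)) : LineState :=
  R.foldl (lineStep τ δ n) lineInit

/-! ## The online algorithm in the plane -/

/-- The parameter `δ = ⌈log n / log log n⌉`. -/
noncomputable def gridDelta (n : ℕ) : ℕ := ⌈Real.logb 2 n / Real.logb 2 (Real.logb 2 n)⌉₊

/-- A point of the strip `[0, n] × [0, ∞)` is moved to the upper left corner of its grid square
(to the column `n - 1` if its `x`-coordinate is `n`). -/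
noncomputable def gridPoint (n : ℕ) (p : Point) : ℕ × ℕ := (min ⌊p.1⌋₊ (n - 1), ⌈p.2⌉₊)

/-- The algorithm for at most `n` points with `x`-coordinates at most `n`: the segments added for
`p` after the points in `h`. The vertical phase draws the copies stored from the time of the
previous grid request up to the time of the new one. The horizontal phase draws the delivery route
at the height of `p`, extends it to `p`, and leaves copies along it up to the time of the grid
request. -/
noncomputable def serveGrid (τ : TieBreak) (n : ℕ) (h : List Point) (p : Point) : List Seg :=
  let δ := gridDelta n
  let s := lineRun τ δ n (h.map (gridPoint n))
  let r := gridPoint n p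
  let u := (lineStep τ δ n s r).src
  ((List.range' s.sq.time (r.2 - s.sq.time)).flatMap (fun t =>
      (kept τ δ n s.sq (t + 1)).toList.map (fun v => Seg.vert v t (t + 1))))
    ++ [Seg.horiz p.2 u r.1, Seg.horiz p.2 r.1 p.1]
    ++ (Finset.Icc u r.1).toList.map (fun k => Seg.vert k p.2 r.2)

/-- The change of coordinates that takes the origin `(0, y₀)` to `(0, 0)` and the bound `M` on the
`x`-coordinates to `n`. -/
noncomputable def toGrid (M : ℝ) (n : ℕ) (y₀ : ℝ) (p : Point) : Point :=
  (p.1 * (n / M), (p.2 - y₀) * (n / M))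

/-- The inverse change of coordinates, for segments. -/
noncomputable def ofGrid (M : ℝ) (n : ℕ) (y₀ : ℝ) : Seg → Seg
  | .horiz y a b => .horiz (y * (M / n) + y₀) (a * (M / n)) (b * (M / n))
  | .vert x a b => .vert (x * (M / n)) (a * (M / n) + y₀) (b * (M / n) + y₀)

/-- The guess for the largest `x`-coordinate, if the largest one so far is `m`. It is `0` as long as
all requests are on the `y`-axis. -/
noncomputable def xGuess (m : ℝ) : ℝ := if m = 0 then 0 else 2 ^ ⌈Real.logb 2 m⌉

/-- The guess for the number of requests, if `i` requests have arrived: the first member of the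
sequence `4, 4 ^ 4, (4 ^ 4) ^ 4, …` that is at least `i`. -/
noncomputable def countGuess (i : ℕ) : ℕ := sInf {n | ∃ l : ℕ, n = 4 ^ 4 ^ l ∧ i ≤ n}

/-- What the algorithm remembers: the number of requests, the `y`-coordinate of the last one, the
largest `x`-coordinate, and, for the current subset of the requests, the two guesses `M` and `n`,
the height `y₀` of its origin `(0, y₀)`, and its points so far. -/
structure Phase where
  count : ℕ
  height : ℝ
  maxX : ℝ
  M : ℝ
  n : ℕ
  y₀ : ℝ
  pts : List Point

/-- Before the first request. With `n = 0` the first request opens the first subset. -/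
noncomputable def phaseInit : Phase := ⟨0, 0, 0, 0, 0, 0, []⟩

/-- A new request joins the current subset if both guesses are still right, and otherwise
opens a new one. -/
noncomputable def phaseStep (s : Phase) (p : Point) : Phase :=
  open Classical in
  if p.1 ≤ s.M ∧ s.count + 1 ≤ s.n then
    { s with
      count := s.count + 1
      height := p.2
      maxX := max s.maxX p.1
      pts := s.pts ++ [p] }
  else
    { count := s.count + 1
      height := p.2
      maxX := max s.maxX p.1
      M := xGuess (max s.maxX p.1)
      n := countGuess (s.count + 1)
      y₀ := s.height
      pts := [p] }

/-- The online algorithm for the rectilinear Steiner arborescence problem. The requests that arrive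
before the first one off the `y`-axis are served along the `y`-axis. -/
noncomputable def onRSA (τ : TieBreak) : Algorithm := fun h p =>
  let s := h.foldl phaseStep phaseInit
  let s' := phaseStep s p
  open Classical in
  if s'.M = 0 then [Seg.vert 0 s.height p.2]
  else
    (serveGrid τ s'.n (s'.pts.dropLast.map (toGrid s'.M s'.n s'.y₀))
      (toGrid s'.M s'.n s'.y₀ p)).map (ofGrid s'.M s'.n s'.y₀)

end RSA

/-!
# A best possible online algorithm for rectilinear Steiner arborescences

**Measuring solutions.** A monotone path to `p` can be parametrized by the sum of its coordinates
(`CurveTo`). The length measure of a collection of segments, of total mass `cost F`, dominates the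
time that such a curve spends in any set. All lower bounds on costs come from applying this to
disjoint sets: `sum_le_cost`.

**The radii.** Let `ρ i` be the radius of request `i` of the pseudo online algorithm. The square
of side `ρ i` with upper right corner at the request contains no earlier replica, and every solution
has length at least `ρ i - 1` in it. Call a request covered if its serving node is at distance at
least `ρ i`. Then its base row closes the top of its square, and no later square meets this square.
For uncovered requests whose squares meet, the radius of the earlier one is at most a quarter of the
radius of the later one (`SquareRun.four_mul_le_of_overlap`). If two disjoint squares meet the
square of a later uncovered request, the time between their requests is at least the
length `4 * ρ i` of the tail of the first of them (`SquareRun.tail_le_of_overlap`). So, if each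
uncovered request is charged to the first later uncovered one whose square meets its own, the radii
decay geometrically along the resulting forest, and they add up to at most twice those of its
roots. The squares of the roots are pairwise disjoint, and so are those of the covered requests.
Hence the radii of `m` requests add up to at most `3 * (cost F + m)` for any solution `F`
(`sum_radii_le`), which bounds the size of the pseudo online solution.

**The grid.** A stay-active node that causes a selection on level `l` of the storage phase is the end of
a path of the pseudo online solution, which has `δ ^ l` replicas in a box whose size is
proportional to `δ ^ l`, and each replica is in few of these boxes. So each of the levels, whose
number is of the order of `log_δ n`, stores at most a constant times as many copies as the pseudo
online solution has replicas (`sum_card_kept_le`). A delivery route exceeds the base row by at most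
`10 * δ * ρ i`, as the serving node is stay-active on the level whose intervals are just
longer than `5 * ρ i` (`GridSeq.nodeAt_le_srcAt`). For `δ` of the order of `log n / log log n` the
number of levels has the same order, which gives `cost_run_serveGrid_guess_le`.

**The guesses.** A solution for all requests, cut off at the heights of a subset of the requests and
completed by a segment at the bottom, solves this subset (`Reach.clip`). So the costs of the
subsets are bounded by the cost of the slabs between their first and last heights, which add up,
plus a multiple of `M * log n / log log n`. The latter grows geometrically from subset to subset
(`mul_logRatio_le`), and at the end it is bounded by the largest `x`-coordinate, which every solution
has to pay.

**The lower bound.** For `n = L ^ L` the adversary presents a staircase of `n` unit steps. To the left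
of a new step there are `L` boxes of height one and of widths `(L - 1) * L ^ l`, `l < L`. If the
algorithm has length at least one in each of them, it pays `L` for the step. Otherwise the adversary
adds a request at the height of the step and the right end of a box with less length; what is
drawn from then on lies above the box. The path to this request cannot rise to the height of the
step within the box, so it is in the slab of the step along the whole width of the box
(`CurveTo.slab_or_box`). The optimum pays only `L ^ l` for this request, by a vertical segment from
the staircase or the `x`-axis. This gives the ratio `L / 16` (`exists_requests_of_le`), and `L` is of
the order of `log N / log log N`.
-/

open MeasureTheory Set

namespace RSA

/-! ### Length measure of a collection of segments, and curves inside it -/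

/-- The one-dimensional Lebesgue measure on a segment, as a measure on the plane. -/
noncomputable def segMeasure : Seg → Measure Point
  | .horiz y a b => (volume.restrict (uIcc a b)).map (fun x => (x, y))
  | .vert x a b => (volume.restrict (uIcc a b)).map (fun y => (x, y))

/-- The sum of the length measures of the segments of `F`, so that overlaps count repeatedly, as
they do in `cost F`. -/
noncomputable def lenMeasure (F : List Seg) : Measure Point := (F.map segMeasure).sum

theorem measurable_horiz (y : ℝ) : Measurable (fun x : ℝ => ((x, y) : Point)) := by fun_prop

theorem measurable_vert (x : ℝ) : Measurable (fun y : ℝ => ((x, y) : Point)) := by fun_prop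

theorem segMeasure_horiz_apply {y a b : ℝ} {A : Set Point} (hA : MeasurableSet A) :
    segMeasure (.horiz y a b) A = volume ({x : ℝ | (x, y) ∈ A} ∩ uIcc a b) := by
  unfold segMeasure
  rw [Measure.map_apply (measurable_horiz y) hA,
    Measure.restrict_apply (measurable_horiz y hA)]
  rfl

theorem segMeasure_vert_apply {x a b : ℝ} {A : Set Point} (hA : MeasurableSet A) :
    segMeasure (.vert x a b) A = volume ({y : ℝ | (x, y) ∈ A} ∩ uIcc a b) := by
  unfold segMeasure
  rw [Measure.map_apply (measurable_vert x) hA,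
    Measure.restrict_apply (measurable_vert x hA)]
  rfl

theorem segMeasure_univ (s : Seg) : segMeasure s univ = ENNReal.ofReal s.length := by
  cases s <;> simp [segMeasure_horiz_apply, segMeasure_vert_apply, Seg.length, Real.volume_interval]

theorem Seg.length_nonneg (s : Seg) : 0 ≤ s.length := by
  cases s <;> simp [Seg.length]

theorem cost_nonneg (F : List Seg) : 0 ≤ cost F := by
  apply List.sum_nonneg
  intro x hx
  obtain ⟨s, -, rfl⟩ := List.mem_map.1 hx
  exact s.length_nonneg

theorem cost_cons (s : Seg) (F : List Seg) : cost (s :: F) = s.length + cost F := by simp [cost]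

theorem cost_append (F F' : List Seg) : cost (F ++ F') = cost F + cost F' := by simp [cost]

theorem lenMeasure_cons (s : Seg) (F : List Seg) (A : Set Point) :
    lenMeasure (s :: F) A = segMeasure s A + lenMeasure F A := by
  simp [lenMeasure]

theorem lenMeasure_append (F F' : List Seg) (A : Set Point) :
    lenMeasure (F ++ F') A = lenMeasure F A + lenMeasure F' A := by
  simp [lenMeasure]

theorem lenMeasure_univ (F : List Seg) : lenMeasure F univ = ENNReal.ofReal (cost F) := by
  induction F with
  | nil => simp [lenMeasure, cost]
  | cons s F ih =>
    rw [lenMeasure_cons, ih, segMeasure_univ, cost_cons,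
      ENNReal.ofReal_add s.length_nonneg (cost_nonneg F)]

/-- Segments that do not meet `A` have no length in `A`. -/
theorem lenMeasure_eq_zero {F : List Seg} {A : Set Point} (hA : MeasurableSet A)
    (h : ∀ s ∈ F, ∀ z ∈ s.carrier, z ∉ A) : lenMeasure F A = 0 := by
  induction F with
  | nil => simp [lenMeasure]
  | cons s F ih =>
    rw [lenMeasure_cons, ih (fun s hs => h s (by simp [hs])), add_zero]
    have h0 := h s (by simp)
    cases s with
    | horiz y a b =>
      rw [segMeasure_horiz_apply hA]
      convert measure_empty (μ := (volume : Measure ℝ))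
      ext x
      simp only [mem_inter_iff, mem_ofPred_eq, mem_empty_iff_false, iff_false, not_and]
      exact fun h1 h2 => h0 (x, y) ⟨h2, rfl⟩ h1
    | vert x a b =>
      rw [segMeasure_vert_apply hA]
      convert measure_empty (μ := (volume : Measure ℝ))
      ext y
      simp only [mem_inter_iff, mem_ofPred_eq, mem_empty_iff_false, iff_false, not_and]
      exact fun h1 h2 => h0 (x, y) ⟨rfl, h2⟩ h1

/-- Vertical segments meet a horizontal line in a null set, so horizontal pieces that `F` covers
have to be paid for by horizontal segments. -/
theorem volume_le_lenMeasure_horiz {y : ℝ} {B : Set Point} (hB : MeasurableSet B)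
    (F : List Seg) : ∀ S : Set ℝ, (∀ x ∈ S, (x, y) ∈ B ∧ (x, y) ∈ covered F) →
    volume S ≤ lenMeasure F B := by
  induction F with
  | nil =>
    intro S hS
    have : S = ∅ := by
      ext x
      simp only [mem_empty_iff_false, iff_false]
      intro hx
      obtain ⟨s, hs, -⟩ := (hS x hx).2
      simp at hs
    simp [this]
  | cons s F ih =>
    intro S hS
    have hsub : S ⊆ {x ∈ S | (x, y) ∈ s.carrier} ∪ {x ∈ S | (x, y) ∈ covered F} := by
      intro x hx
      obtain ⟨s', hs', h⟩ := (hS x hx).2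
      rcases List.mem_cons.1 hs' with rfl | hs'
      · exact Or.inl ⟨hx, h⟩
      · exact Or.inr ⟨hx, s', hs', h⟩
    rw [lenMeasure_cons]
    refine (measure_mono hsub).trans ((measure_union_le _ _).trans (add_le_add ?_ ?_))
    · cases s with
      | horiz y' a b =>
        rw [segMeasure_horiz_apply hB]
        apply measure_mono
        rintro x ⟨hx, h1, h2⟩
        simp only at h1 h2
        subst h2
        exact ⟨(hS x hx).1, h1⟩
      | vert x' a b =>
        have : {x ∈ S | (x, y) ∈ (Seg.vert x' a b).carrier} ⊆ {x'} := by
          rintro x ⟨-, h1, -⟩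
          exact h1
        exact (measure_mono this).trans (by simp)
    · exact ih _ (fun x hx => ⟨(hS x hx.1).1, hx.2⟩)

theorem volume_le_lenMeasure_vert {x : ℝ} {B : Set Point} (hB : MeasurableSet B)
    (F : List Seg) : ∀ S : Set ℝ, (∀ y ∈ S, (x, y) ∈ B ∧ (x, y) ∈ covered F) →
    volume S ≤ lenMeasure F B := by
  induction F with
  | nil =>
    intro S hS
    have : S = ∅ := by
      ext x
      simp only [mem_empty_iff_false, iff_false]
      intro hx
      obtain ⟨s, hs, -⟩ := (hS x hx).2
      simp at hs
    simp [this]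
  | cons s F ih =>
    intro S hS
    have hsub : S ⊆ {y ∈ S | (x, y) ∈ s.carrier} ∪ {y ∈ S | (x, y) ∈ covered F} := by
      intro y hy
      obtain ⟨s', hs', h⟩ := (hS y hy).2
      rcases List.mem_cons.1 hs' with rfl | hs'
      · exact Or.inl ⟨hy, h⟩
      · exact Or.inr ⟨hy, s', hs', h⟩
    rw [lenMeasure_cons]
    refine (measure_mono hsub).trans ((measure_union_le _ _).trans (add_le_add ?_ ?_))
    · cases s with
      | horiz y' a b =>
        have : {y ∈ S | (x, y) ∈ (Seg.horiz y' a b).carrier} ⊆ {y'} := by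
          rintro y ⟨-, -, h1⟩
          exact h1
        exact (measure_mono this).trans (by simp)
      | vert x' a b =>
        rw [segMeasure_vert_apply hB]
        apply measure_mono
        rintro y ⟨hy, h1, h2⟩
        simp only at h1 h2
        subst h1
        exact ⟨(hS y hy).1, h2⟩
    · exact ih _ (fun y hy => ⟨(hS y hy.1).1, hy.2⟩)

/-- A monotone curve that is parametrized by its length in the `ℓ¹` norm (the sum of
the coordinates) from the origin to `p`, and that runs inside `F` in the sense that the length
measure of `F` dominates the time that the curve spends in any set. -/
structure CurveTo (F : List Seg) (p : Point) (γ : ℝ → Point) : Prop where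
  sum_eq : ∀ z ∈ Icc 0 (p.1 + p.2), (γ z).1 + (γ z).2 = z
  mono : MonotoneOn γ (Icc 0 (p.1 + p.2))
  last : γ (p.1 + p.2) = p
  nonneg : 0 ≤ p.1 ∧ 0 ≤ p.2
  time_le : ∀ A : Set Point, MeasurableSet A →
    volume {z | z ∈ Ico 0 (p.1 + p.2) ∧ γ z ∈ A} ≤
      lenMeasure F (A ∩ {q | q.1 + q.2 < p.1 + p.2})

theorem exists_curveTo {F : List Seg} {p : Point}
    (h : Relation.ReflTransGen (MonoStep F) (0, 0) p) : ∃ γ, CurveTo F p γ := by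
  induction h with
  | refl =>
    refine ⟨fun _ => (0, 0), ?_, ?_, rfl, by simp, ?_⟩
    · intro z hz
      simp only [add_zero, Icc_self, mem_singleton_iff] at hz
      simp [hz]
    · intro _ _ _ _ _
      exact le_rfl
    · intro A _
      simp
  | @tail b c _ hbc ih =>
    obtain ⟨γ, hs, hm, hl, hn, ht⟩ := ih
    obtain ⟨hdir, hcov⟩ := hbc
    have hbc1 : b.1 ≤ c.1 := by rcases hdir with h | h <;> simp [h]
    have hbc2 : b.2 ≤ c.2 := by rcases hdir with h | h <;> simp [h]
    -- the last straight piece of the curve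
    obtain ⟨e, he, hem, hle, hlast, htime⟩ : ∃ e : ℝ → Point,
        (∀ z, (e z).1 + (e z).2 = z) ∧ Monotone e ∧ (∀ z, b.1 + b.2 ≤ z → b ≤ e z) ∧
        e (c.1 + c.2) = c ∧ ∀ A : Set Point, MeasurableSet A →
          volume {z | z ∈ Ico (b.1 + b.2) (c.1 + c.2) ∧ e z ∈ A} ≤
            lenMeasure F (A ∩ {q | b.1 + b.2 ≤ q.1 + q.2 ∧ q.1 + q.2 < c.1 + c.2}) := by
      have hmeas : ∀ A : Set Point, MeasurableSet A →
          MeasurableSet (A ∩ {q : Point | b.1 + b.2 ≤ q.1 + q.2 ∧ q.1 + q.2 < c.1 + c.2}) := by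
        intro A hA
        have h1 : MeasurableSet {q : Point | b.1 + b.2 ≤ q.1 + q.2} :=
          measurableSet_le measurable_const (by fun_prop)
        have h2 : MeasurableSet {q : Point | q.1 + q.2 < c.1 + c.2} :=
          measurableSet_lt (by fun_prop) measurable_const
        exact hA.inter (h1.inter h2)
      rcases hdir with ⟨-, h2⟩ | ⟨h1, -⟩
      · refine ⟨fun z => (z - b.2, b.2), fun z => by simp, ?_, ?_, ?_, ?_⟩
        · intro z z' hz
          exact ⟨by simpa using hz, le_rfl⟩
        · intro z hz
          exact ⟨by simpa [le_sub_iff_add_le] using hz, le_rfl⟩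
        · ext <;> simp [h2]
        · intro A hA
          have := volume_le_lenMeasure_horiz (y := b.2) (hmeas A hA) F
            ((fun x => x + b.2) ⁻¹' {z | z ∈ Ico (b.1 + b.2) (c.1 + c.2) ∧ (z - b.2, b.2) ∈ A}) ?_
          · rwa [measure_preimage_add_right] at this
          · rintro x ⟨⟨hx1, hx2⟩, hxA⟩
            simp only [add_sub_cancel_right] at hxA
            refine ⟨⟨hxA, hx1, hx2⟩, hcov ⟨⟨?_, le_rfl⟩, ?_, hbc2⟩⟩
            · simpa using hx1
            · simp only [h2] at hx2 ⊢
              linarith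
      · refine ⟨fun z => (b.1, z - b.1), fun z => by simp, ?_, ?_, ?_, ?_⟩
        · intro z z' hz
          exact ⟨le_rfl, by simpa using hz⟩
        · intro z hz
          exact ⟨le_rfl, by simp only; linarith⟩
        · ext <;> simp [h1]
        · intro A hA
          have := volume_le_lenMeasure_vert (x := b.1) (hmeas A hA) F
            ((fun x => x + b.1) ⁻¹' {z | z ∈ Ico (b.1 + b.2) (c.1 + c.2) ∧ (b.1, z - b.1) ∈ A}) ?_
          · rwa [measure_preimage_add_right] at this
          · rintro y ⟨⟨hy1, hy2⟩, hyA⟩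
            simp only [add_sub_cancel_right] at hyA
            simp only at hy1 hy2
            refine ⟨⟨hyA, by simp only; linarith, by simp only; linarith⟩,
              hcov ⟨⟨le_rfl, ?_⟩, hbc1, ?_⟩⟩
            · simp only; linarith
            · simp only; linarith
    refine ⟨fun z => if z ≤ b.1 + b.2 then γ z else e z, ?_, ?_, ?_, ?_, ?_⟩
    · intro z hz
      by_cases h : z ≤ b.1 + b.2
      · simp only [h, if_true]
        exact hs z ⟨hz.1, h⟩
      · simp only [h, if_false]
        exact he z
    · intro z hz z' hz' hzz
      by_cases h' : z' ≤ b.1 + b.2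
      · have h : z ≤ b.1 + b.2 := hzz.trans h'
        simp only [h, h', if_true]
        exact hm ⟨hz.1, h⟩ ⟨hz'.1, h'⟩ hzz
      · by_cases h : z ≤ b.1 + b.2
        · simp only [h, h', if_true, if_false]
          calc γ z ≤ γ (b.1 + b.2) := hm ⟨hz.1, h⟩ ⟨by linarith [hn.1, hn.2], le_rfl⟩ h
            _ = b := hl
            _ ≤ e z' := hle z' (le_of_lt (not_le.1 h'))
        · simp only [h, h', if_false]
          exact hem hzz
    · by_cases h : c.1 + c.2 ≤ b.1 + b.2
      · simp only [h, if_true]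
        have h1 : b.1 = c.1 := by linarith
        have h2 : b.2 = c.2 := by linarith
        have h3 : b = c := Prod.ext h1 h2
        rw [← h3, hl]
      · simp only [h, if_false]
        exact hlast
    · exact ⟨hn.1.trans hbc1, hn.2.trans hbc2⟩
    · intro A hA
      have hM : MeasurableSet {q : Point | q.1 + q.2 < b.1 + b.2} :=
        measurableSet_lt (by fun_prop) measurable_const
      rw [← measure_inter_add_sdiff (A ∩ {q : Point | q.1 + q.2 < c.1 + c.2}) hM]
      have hsub : {z | z ∈ Ico 0 (c.1 + c.2) ∧ (if z ≤ b.1 + b.2 then γ z else e z) ∈ A} ⊆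
          {z | z ∈ Ico 0 (b.1 + b.2) ∧ γ z ∈ A} ∪
            ({z | z ∈ Ico (b.1 + b.2) (c.1 + c.2) ∧ e z ∈ A} ∪ {b.1 + b.2}) := by
        rintro z ⟨⟨hz0, hz1⟩, hzA⟩
        rcases lt_trichotomy z (b.1 + b.2) with h | h | h
        · exact Or.inl ⟨⟨hz0, h⟩, by simpa [h.le] using hzA⟩
        · exact Or.inr (Or.inr h)
        · exact Or.inr (Or.inl ⟨⟨h.le, hz1⟩, by simpa [not_le.2 h] using hzA⟩)
      refine (measure_mono hsub).trans ((measure_union_le _ _).trans (add_le_add ?_ ?_))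
      · refine (ht A hA).trans (measure_mono ?_)
        rintro q ⟨h1, h2⟩
        simp only [mem_ofPred_eq] at h2
        exact ⟨⟨h1, by simp only [mem_ofPred_eq]; linarith⟩, h2⟩
      · refine (measure_union_le _ _).trans ?_
        simp only [Real.volume_singleton, add_zero]
        refine (htime A hA).trans (measure_mono ?_)
        rintro q ⟨h1, h2, h3⟩
        exact ⟨⟨h1, h3⟩, not_lt.2 h2⟩

namespace CurveTo

variable {F : List Seg} {p : Point} {γ : ℝ → Point}

theorem le_end (h : CurveTo F p γ) {z : ℝ} (hz : z ∈ Icc 0 (p.1 + p.2)) : γ z ≤ p := by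
  have := h.mono hz ⟨hz.1.trans hz.2, le_rfl⟩ hz.2
  rwa [h.last] at this

/-- An interval of parameters during which the curve is in `A` gives length of `F` in `A`. -/
theorem ofReal_le (h : CurveTo F p γ) {A : Set Point} (hA : MeasurableSet A) {a b : ℝ}
    (ha : 0 ≤ a) (hb : b ≤ p.1 + p.2) (hab : ∀ z ∈ Ioo a b, γ z ∈ A) :
    ENNReal.ofReal (b - a) ≤ lenMeasure F A := by
  rw [← Real.volume_Ioo]
  refine (measure_mono ?_).trans ((h.time_le A hA).trans (measure_mono inter_subset_left))
  intro z hz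
  exact ⟨⟨ha.trans hz.1.le, hz.2.trans_le hb⟩, hab z hz⟩

end CurveTo

/-- The cost of a collection of segments is at least the sum of the coordinates of any point that it
connects to the origin. -/
theorem add_le_cost {F : List Seg} {p : Point}
    (h : Relation.ReflTransGen (MonoStep F) (0, 0) p) : p.1 + p.2 ≤ cost F := by
  obtain ⟨γ, hγ⟩ := exists_curveTo h
  have := hγ.ofReal_le (A := univ) MeasurableSet.univ (a := 0) (b := p.1 + p.2) le_rfl le_rfl
    (fun _ _ => trivial)
  rw [lenMeasure_univ, sub_zero] at this
  exact (ENNReal.ofReal_le_ofReal_iff (cost_nonneg F)).1 this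

/-- Disjoint sets receive disjoint parts of the cost. -/
theorem sum_le_cost {ι : Type*} {F : List Seg} (S : Finset ι) (A : ι → Set Point) (c : ι → ℝ)
    (hA : ∀ i ∈ S, MeasurableSet (A i)) (hd : (S : Set ι).PairwiseDisjoint A)
    (hc : ∀ i ∈ S, ENNReal.ofReal (c i) ≤ lenMeasure F (A i)) : ∑ i ∈ S, c i ≤ cost F := by
  have h1 : ∑ i ∈ S, ENNReal.ofReal (c i) ≤ ENNReal.ofReal (cost F) := by
    calc ∑ i ∈ S, ENNReal.ofReal (c i) ≤ ∑ i ∈ S, lenMeasure F (A i) := Finset.sum_le_sum hc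
      _ = lenMeasure F (⋃ i ∈ S, A i) := (measure_biUnion_finset hd hA).symm
      _ ≤ lenMeasure F univ := measure_mono (subset_univ _)
      _ = ENNReal.ofReal (cost F) := lenMeasure_univ F
  have h2 : ENNReal.ofReal (∑ i ∈ S, max (c i) 0) = ∑ i ∈ S, ENNReal.ofReal (c i) := by
    rw [ENNReal.ofReal_sum_of_nonneg (fun i _ => le_max_right _ _)]
    refine Finset.sum_congr rfl fun i _ => ?_
    rcases le_total (c i) 0 with h | h
    · simp [h, ENNReal.ofReal_of_nonpos h]
    · rw [max_eq_left h]
  rw [← h2, ENNReal.ofReal_le_ofReal_iff (cost_nonneg F)] at h1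
  exact (Finset.sum_le_sum fun i _ => le_max_left _ _).trans h1

/-! ### The radii of the pseudo online algorithm -/

/-- What the analysis uses of a run of the pseudo online algorithm on requests `(v i, t i)`, with
radii `ρ i` and serving replicas `(u i, s i)`. The set `G i` is the solution when the request `i` is
handled, with the column of the origin already extended. -/
structure SquareRun (v t ρ u s : ℕ → ℕ) (G : ℕ → Finset (ℕ × ℕ)) : Prop where
  mono : Monotone t
  mem_iff : ∀ j a b, (a, b) ∈ G j ↔ (a = 0 ∧ b ≤ t j) ∨
    ∃ i < j, (a = u i ∧ s i ≤ b ∧ b ≤ t i + 4 * ρ i) ∨ (b = t i ∧ u i ≤ a ∧ a ≤ v i)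
  free : ∀ i a b, (a, b) ∈ G i → a ≤ v i → b ≤ t i → v i < a + ρ i → t i < b + ρ i → False
  near : ∀ i, ∃ a b, (a, b) ∈ G i ∧ a ≤ v i ∧ b ≤ t i ∧ v i ≤ a + ρ i ∧ t i ≤ b + ρ i
  serve : ∀ i, (u i, s i) ∈ G i
  u_le : ∀ i, u i ≤ v i
  le_u : ∀ i, v i ≤ u i + 5 * ρ i
  s_le : ∀ i, s i ≤ t i
  le_s : ∀ i, t i ≤ s i + 5 * ρ i
  left : ∀ i a b, (a, b) ∈ G i → a ≤ v i → v i ≤ a + 5 * ρ i → b ≤ t i → t i ≤ b + 5 * ρ i →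
    u i ≤ a

/-- `(x, y)` lies in the half-open square with side `ρ i` below and to the left of the `i`-th
request. By the choice of the radius no replica of the solution does. -/
def InSq (v t ρ : ℕ → ℕ) (i x y : ℕ) : Prop :=
  (x ≤ v i ∧ v i < x + ρ i) ∧ (y ≤ t i ∧ t i < y + ρ i)

/-- The squares of the requests `i` and `j` have a common grid point. -/
def Overlap (v t ρ : ℕ → ℕ) (i j : ℕ) : Prop :=
  ∃ x y, InSq v t ρ i x y ∧ InSq v t ρ j x y

namespace SquareRun

variable {v t ρ u s : ℕ → ℕ} {G : ℕ → Finset (ℕ × ℕ)}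

theorem col_mem (h : SquareRun v t ρ u s G) {i j b : ℕ} (hij : i < j) (h1 : s i ≤ b)
    (h2 : b ≤ t i + 4 * ρ i) : (u i, b) ∈ G j :=
  (h.mem_iff _ _ _).2 (Or.inr ⟨i, hij, Or.inl ⟨rfl, h1, h2⟩⟩)

theorem row_mem (h : SquareRun v t ρ u s G) {i j a : ℕ} (hij : i < j) (h1 : u i ≤ a)
    (h2 : a ≤ v i) : (a, t i) ∈ G j :=
  (h.mem_iff _ _ _).2 (Or.inr ⟨i, hij, Or.inr ⟨rfl, h1, h2⟩⟩)

theorem zero_mem (h : SquareRun v t ρ u s G) {j b : ℕ} (h1 : b ≤ t j) : (0, b) ∈ G j :=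
  (h.mem_iff _ _ _).2 (Or.inl ⟨rfl, h1⟩)

/-- The base row of a request whose serving node is at distance at least `ρ i` closes the top of its
square, so no later square meets it. -/
theorem not_overlap_of_covered (h : SquareRun v t ρ u s G) {i j : ℕ} (hij : i < j)
    (hc : u i + ρ i ≤ v i) : ¬ Overlap v t ρ i j := by
  rintro ⟨x, y, ⟨⟨h1, h2⟩, h3, h4⟩, ⟨h5, h6⟩, h7, h8⟩
  have := h.mono hij.le
  exact h.free j x (t i) (h.row_mem hij (by omega) h1) h5 this h6 (by omega)

/-- A later square that meets the square of `i` stays to the left of the serving node of `i`. -/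
theorem lt_of_overlap (h : SquareRun v t ρ u s G) {i j : ℕ} (hij : i < j)
    (ho : Overlap v t ρ i j) : v j < u i ∧ v i < v j + ρ i ∧ t j < t i + ρ j := by
  obtain ⟨x, y, ⟨⟨h1, h2⟩, h3, h4⟩, ⟨h5, h6⟩, h7, h8⟩ := ho
  have hm := h.mono hij.le
  refine ⟨?_, by omega, by omega⟩
  by_contra hlt
  rcases le_or_gt (u i) x with hx | hx
  · exact h.free j x (t i) (h.row_mem hij hx h1) h5 hm h6 (by omega)
  · exact h.free j (u i) (t i) (h.row_mem hij le_rfl (h.u_le i)) (by omega) hm (by omega)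
      (by omega)

/-- If `j` is served from within its own radius, then an earlier square that meets its square is
smaller by a factor of four. Otherwise the replica that determines the radius of `j` would stem from a
column to the left of `u i`. This column was not available in the large square of `i`, so it was
extended from far below later on, and then its tail would have come closer to `j`. -/
theorem four_mul_le_of_overlap (h : SquareRun v t ρ u s G) {i j : ℕ} (hij : i < j)
    (hj : v j < u j + ρ j) (ho : Overlap v t ρ i j) : 4 * ρ i ≤ ρ j := by
  obtain ⟨h1, h2, h3⟩ := h.lt_of_overlap hij ho
  have hm := h.mono hij.le
  by_contra hlt
  push Not at hlt
  obtain ⟨a, b, hab, ha1, hb1, ha2, hb2⟩ := h.near j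
  have hua : u j ≤ a := h.left j a b hab ha1 (by omega) hb1 (by omega)
  have hbt : b + ρ j ≤ t j := by
    by_contra hb
    exact h.free j a b hab ha1 hb1 (by omega) (by omega)
  have key : ∀ k, k ≤ j → ∀ b, b < t i → t i ≤ b + 5 * ρ i → (a, b) ∈ G k → False := by
    intro k
    induction k using Nat.strong_induction_on with
    | _ k ih =>
      intro hkj b hb hb' hmem
      rcases (h.mem_iff _ _ _).1 hmem with ⟨h0, -⟩ | ⟨k', hk', ⟨rfl, hs, ht⟩ | ⟨rfl, hr1, hr2⟩⟩
      · subst h0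
        exact h.free j 0 (t j) (h.zero_mem le_rfl) (by omega) le_rfl (by omega) (by omega)
      · have hui := h.u_le i
        rcases lt_trichotomy k' i with hki | rfl | hki
        · have := h.left i (u k') b (h.col_mem hki hs ht) (by omega) (by omega) hb.le hb'
          omega
        · omega
        · have hmk := h.mono hki.le
          by_cases hsk : t i ≤ s k' + 5 * ρ i
          · exact ih k' hk' (by omega) (s k') (by omega) hsk (h.serve k')
          · have := h.le_s k'
            exact h.free j (u k') (t j) (h.col_mem (i := k') (by omega) (by omega) (by omega)) ha1
              le_rfl (by omega) (by omega)
      · have hui := h.u_le i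
        rcases lt_or_ge k' i with hki | hki
        · have := h.left i a (t k') (h.row_mem hki hr1 hr2) (by omega) (by omega) hb.le hb'
          omega
        · have := h.mono hki
          omega
  exact key j le_rfl b (by omega) (by omega) hab

/-- A replica of the solution at time `t i` or later also gives one at time `t i`, if
the solution is the one at the arrival of `i`. -/
theorem mem_of_le (h : SquareRun v t ρ u s G) {i a b : ℕ} (hmem : (a, b) ∈ G i)
    (hb : t i ≤ b) : (a, t i) ∈ G i := by
  rcases (h.mem_iff _ _ _).1 hmem with ⟨rfl, -⟩ | ⟨k, hk, ⟨rfl, hs, ht⟩ | ⟨rfl, hr1, hr2⟩⟩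
  · exact h.zero_mem le_rfl
  · have := h.mono hk.le
    have := h.s_le k
    exact h.col_mem hk (by omega) (by omega)
  · have := h.mono hk.le
    have hh : t k = t i := by omega
    rw [← hh]
    exact h.row_mem hk hr1 hr2

/-- Two disjoint squares that meet the square of a later request `j` cross its right side. They are far
apart: the lower one is followed by the whole tail of its request before the upper one comes.
The reason is that the serving replica of the upper one is on a path of the solution between `v j`
and `u i`, which has come from below the large square of `i` after `i` was served. -/
theorem tail_le_of_overlap (h : SquareRun v t ρ u s G) {i k j : ℕ} (hik : i < k) (hkj : k < j)
    (hi : Overlap v t ρ i j) (hk : Overlap v t ρ k j) (hn : ¬ Overlap v t ρ i k) :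
    t i + 4 * ρ i ≤ t k := by
  have hkc : v k < u k + ρ k := by
    by_contra hc
    exact h.not_overlap_of_covered hkj (not_lt.1 hc) hk
  obtain ⟨i1, i2, i3⟩ := h.lt_of_overlap (hik.trans hkj) hi
  obtain ⟨k1, k2, k3⟩ := h.lt_of_overlap hkj hk
  have hmik := h.mono hik.le
  have hmkj := h.mono hkj.le
  have hui := h.u_le i
  have huk := h.u_le k
  have hsi := h.s_le i
  by_contra hlt
  push Not at hlt
  have hρk : 0 < ρ k := by omega
  rcases le_or_gt (u i) (v k) with hc | hc
  · exact h.free k (u i) (min (t k) (t i + 4 * ρ i))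
      (h.col_mem hik (by omega) (by omega)) hc (by omega) (by omega) (by omega)
  have hsep : t i + ρ k ≤ t k := by
    by_contra hs
    exact hn ⟨v j, t i, ⟨⟨by omega, by omega⟩, by omega, by omega⟩, ⟨by omega, by omega⟩,
      by omega, by omega⟩
  -- the replicas at the arrival of `i` between `v j` and `u i` lie far below
  have low : ∀ a b, (a, b) ∈ G i → v j < a → a ≤ v k → b + 5 * ρ i < t i := by
    intro a b hmem ha1 ha2
    by_contra hb
    rcases le_or_gt (t i) b with hb' | hb'
    · have := h.left i a (t i) (h.mem_of_le hmem hb') (by omega) (by omega) le_rfl (by omega)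
      omega
    · have := h.left i a b hmem (by omega) (by omega) hb'.le (by omega)
      omega
  -- the others stem from a request between `i` and `k` with a serving node in the same range
  have src : ∀ m a b, i < m → m ≤ k → (a, b) ∈ G m → v j < a → a ≤ v k →
      (a, b) ∈ G i ∨ ∃ m', i < m' ∧ m' < m ∧ v j < u m' ∧ u m' ≤ v k := by
    intro m a b him hmk hmem ha1 ha2
    rcases (h.mem_iff _ _ _).1 hmem with ⟨rfl, -⟩ | ⟨m', hm', ⟨rfl, hs, ht⟩ | ⟨rfl, hr1, hr2⟩⟩
    · omega
    · rcases lt_trichotomy m' i with hmi | rfl | hmi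
      · exact Or.inl (h.col_mem hmi hs ht)
      · omega
      · exact Or.inr ⟨m', hmi, hm', ha1, ha2⟩
    · rcases lt_trichotomy m' i with hmi | rfl | hmi
      · exact Or.inl (h.row_mem hmi hr1 hr2)
      · omega
      · refine Or.inr ⟨m', hmi, hm', ?_, by omega⟩
        by_contra hu
        have e1 := h.mono hmi.le
        have e2 := h.mono (show m' ≤ j by omega)
        exact h.free j (v j) (t m') (h.row_mem (i := m') (by omega) (by omega) (by omega)) le_rfl e2
          (by omega) (by omega)
  have key : ∀ m, i < m → m < k → v j < u m → u m ≤ v k → False := by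
    intro m
    induction m using Nat.strong_induction_on with
    | _ m ih =>
      intro him hmk hm1 hm2
      rcases src m (u m) (s m) him hmk.le (h.serve m) hm1 hm2 with hG | ⟨m', e1, e2, e3, e4⟩
      · have e1 := low _ _ hG hm1 hm2
        have e2 := h.le_s m
        have e3 := h.mono him.le
        have e4 := h.mono hmk.le
        have e5 := h.s_le m
        exact h.free k (u m) (min (t k) (t m + 4 * ρ m))
          (h.col_mem hmk (by omega) (by omega)) hm2 (by omega) (by omega) (by omega)
      · exact ih m' e2 e1 (by omega) e3 e4
  obtain ⟨a, b, hab, ha1, hb1, ha2, hb2⟩ := h.near k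
  have hua : u k ≤ a := h.left k a b hab ha1 (by omega) hb1 (by omega)
  have hbt : b + ρ k ≤ t k := by
    by_contra hb
    exact h.free k a b hab ha1 hb1 (by omega) (by omega)
  rcases src k a b hik le_rfl hab (by omega) ha1 with hG | ⟨m', e1, e2, e3, e4⟩
  · have := low _ _ hG (by omega) ha1
    omega
  · exact key m' e1 e2 e3 e4

open Classical in
/-- The requests that are served from within their own radius, and whose square meets
no later square of this kind. -/
noncomputable def roots (v t ρ u : ℕ → ℕ) (m : ℕ) : Finset ℕ :=
  (Finset.range m).filter fun i => v i < u i + ρ i ∧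
    ∀ j < m, i < j → v j < u j + ρ j → ¬ Overlap v t ρ i j

/-- Assign to each request that is served from within its radius, and that is no root, the first later
square of this kind that meets its own square. The requests assigned to `j` have disjoint tails
near the right side of the square of `j`, so their radii add up to at most `ρ j / 2`. -/
theorem sum_uncovered_le (h : SquareRun v t ρ u s G) (m : ℕ) :
    ∑ i ∈ (Finset.range m).filter (fun i => v i < u i + ρ i), ρ i ≤
      2 * ∑ i ∈ roots v t ρ u m, ρ i := by
  classical
  set U := (Finset.range m).filter (fun i => v i < u i + ρ i) with hU
  set W := U.filter (fun i => ∃ j < m, i < j ∧ v j < u j + ρ j ∧ Overlap v t ρ i j) with hW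
  have hroots : roots v t ρ u m =
      U.filter (fun i => ¬ ∃ j < m, i < j ∧ v j < u j + ρ j ∧ Overlap v t ρ i j) := by
    ext i
    simp only [roots, hU, Finset.mem_filter, Finset.mem_range]
    push Not
    tauto
  have hsplit : ∑ i ∈ U, ρ i = ∑ i ∈ W, ρ i + ∑ i ∈ roots v t ρ u m, ρ i := by
    rw [hroots, hW, Finset.sum_filter_add_sum_filter_not]
  have hex : ∀ i : ℕ, ∃ j, (∃ j < m, i < j ∧ v j < u j + ρ j ∧ Overlap v t ρ i j) →
      (j < m ∧ i < j ∧ v j < u j + ρ j ∧ Overlap v t ρ i j) ∧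
      ∀ k, k < m → i < k → v k < u k + ρ k → Overlap v t ρ i k → j ≤ k := by
    intro i
    by_cases hi : ∃ j < m, i < j ∧ v j < u j + ρ j ∧ Overlap v t ρ i j
    · obtain ⟨a, ha⟩ := hi
      refine ⟨Nat.find (⟨a, ha⟩ : ∃ j, j < m ∧ i < j ∧ v j < u j + ρ j ∧ Overlap v t ρ i j),
        fun _ => ⟨Nat.find_spec
          (⟨a, ha⟩ : ∃ j, j < m ∧ i < j ∧ v j < u j + ρ j ∧ Overlap v t ρ i j), ?_⟩⟩
      intro k h1 h2 h3 h4
      exact Nat.find_min' _ ⟨h1, h2, h3, h4⟩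
    · exact ⟨0, fun hh => absurd hh hi⟩
  choose par hpar using hex
  have hWpar : ∀ i ∈ W, (par i < m ∧ i < par i ∧ v (par i) < u (par i) + ρ (par i) ∧
      Overlap v t ρ i (par i)) ∧
      ∀ k, k < m → i < k → v k < u k + ρ k → Overlap v t ρ i k → par i ≤ k := by
    intro i hi
    exact hpar i (Finset.mem_filter.1 hi).2
  have hmaps : ∀ i ∈ W, par i ∈ U := by
    intro i hi
    obtain ⟨⟨h1, -, h3, -⟩, -⟩ := hWpar i hi
    exact Finset.mem_filter.2 ⟨Finset.mem_range.2 h1, h3⟩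
  have hfib : ∀ j ∈ U, 2 * ∑ i ∈ W.filter (fun i => par i = j), ρ i ≤ ρ j := by
    intro j hj
    set B := W.filter (fun i => par i = j) with hB
    have hBmem : ∀ i ∈ B, i < j ∧ v j < u j + ρ j ∧ Overlap v t ρ i j ∧ i ∈ W ∧ par i = j := by
      intro i hi
      obtain ⟨hiW, rfl⟩ := Finset.mem_filter.1 hi
      obtain ⟨⟨-, h2, h3, h4⟩, -⟩ := hWpar i hiW
      exact ⟨h2, h3, h4, hiW, rfl⟩
    have hdisj : (B : Set ℕ).PairwiseDisjoint (fun i => Finset.Ico (t i) (t i + 4 * ρ i)) := by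
      have hlt : ∀ i ∈ B, ∀ k ∈ B, i < k →
          Disjoint (Finset.Ico (t i) (t i + 4 * ρ i)) (Finset.Ico (t k) (t k + 4 * ρ k)) := by
        intro i hi k hk hik
        obtain ⟨i1, i2, i3, i4, i5⟩ := hBmem i hi
        obtain ⟨k1, k2, k3, k4, k5⟩ := hBmem k hk
        have hno : ¬ Overlap v t ρ i k := by
          intro ho
          have hkU := Finset.mem_filter.1 (Finset.mem_filter.1 k4).1
          have := (hWpar i i4).2 k (Finset.mem_range.1 hkU.1) hik hkU.2 ho
          omega
        have := h.tail_le_of_overlap hik k1 i3 k3 hno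
        rw [Finset.disjoint_left]
        intro x hx hx'
        rw [Finset.mem_Ico] at hx hx'
        omega
      intro i hi k hk hne
      rcases lt_or_gt_of_ne hne with hlt' | hlt'
      · exact hlt i hi k hk hlt'
      · exact (hlt k hk i hi hlt').symm
    have hcard : ∑ i ∈ B, 4 * ρ i ≤ (Finset.Ico (t j + 1 - ρ j) (t j + ρ j)).card := by
      have : ∑ i ∈ B, 4 * ρ i = (B.biUnion fun i => Finset.Ico (t i) (t i + 4 * ρ i)).card := by
        rw [Finset.card_biUnion hdisj]
        simp
      rw [this]
      apply Finset.card_le_card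
      intro x hx
      obtain ⟨i, hi, hx⟩ := Finset.mem_biUnion.1 hx
      obtain ⟨i1, i2, i3, i4, i5⟩ := hBmem i hi
      have e1 := h.four_mul_le_of_overlap i1 i2 i3
      have e2 := (h.lt_of_overlap i1 i3).2.2
      have e3 := h.mono i1.le
      rw [Finset.mem_Ico] at hx ⊢
      omega
    rw [Nat.card_Ico, ← Finset.mul_sum] at hcard
    omega
  have hsum : 2 * ∑ i ∈ W, ρ i ≤ ∑ j ∈ U, ρ j := by
    rw [← Finset.sum_fiberwise_of_maps_to hmaps, Finset.mul_sum]
    exact Finset.sum_le_sum hfib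
  omega

/-- The requests that are served from outside their radius have pairwise disjoint squares. -/
theorem covered_disjoint (h : SquareRun v t ρ u s G) {i k : ℕ} (hi : u i + ρ i ≤ v i)
    (hk : u k + ρ k ≤ v k) (hne : i ≠ k) : ¬ Overlap v t ρ i k := by
  rcases lt_or_gt_of_ne hne with hlt | hlt
  · exact h.not_overlap_of_covered hlt hi
  · rintro ⟨x, y, h1, h2⟩
    exact h.not_overlap_of_covered hlt hk ⟨x, y, h2, h1⟩

theorem roots_disjoint {m i k : ℕ} (hi : i ∈ roots v t ρ u m) (hk : k ∈ roots v t ρ u m)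
    (hne : i ≠ k) : ¬ Overlap v t ρ i k := by
  simp only [roots, Finset.mem_filter, Finset.mem_range] at hi hk
  rcases lt_or_gt_of_ne hne with hlt | hlt
  · exact hi.2.2 k hk.1 hlt hk.2.1
  · rintro ⟨x, y, h1, h2⟩
    exact hk.2.2 i hi.1 hlt hi.2.1 ⟨x, y, h2, h1⟩

end SquareRun

/-! ### The pseudo online algorithm as a sequence of states -/

theorem mem_col {v s t a b : ℕ} : (a, b) ∈ col v s t ↔ a = v ∧ s ≤ b ∧ b ≤ t := by
  simp [col, and_comm, eq_comm]

theorem mem_row {u v t a b : ℕ} : (a, b) ∈ row u v t ↔ b = t ∧ u ≤ a ∧ a ≤ v := by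
  simp [row, and_comm, and_assoc, eq_comm]

theorem mem_nodesAt {F : Finset (ℕ × ℕ)} {t a : ℕ} : a ∈ nodesAt F t ↔ (a, t) ∈ F := by
  simp [nodesAt]

theorem mem_timesAt {F : Finset (ℕ × ℕ)} {u b : ℕ} : b ∈ timesAt F u ↔ (u, b) ∈ F := by
  simp [timesAt]

theorem mem_inSquare {F : Finset (ℕ × ℕ)} {r : ℕ × ℕ} {ρ a b : ℕ} :
    (a, b) ∈ inSquare F r ρ ↔
      (a, b) ∈ F ∧ (a ≤ r.1 ∧ r.1 ≤ a + ρ) ∧ (b ≤ r.2 ∧ r.2 ≤ b + ρ) := by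
  simp [inSquare]

theorem untopD_min_mem {S : Finset ℕ} (hS : S.Nonempty) : S.min.untopD 0 ∈ S := by
  rw [← Finset.coe_min' hS]
  exact Finset.min'_mem S hS

theorem untopD_min_le {S : Finset ℕ} {a : ℕ} (ha : a ∈ S) : S.min.untopD 0 ≤ a := by
  rw [← Finset.coe_min' ⟨a, ha⟩]
  exact Finset.min'_le S a ha

theorem radius_le {F : Finset (ℕ × ℕ)} {r : ℕ × ℕ} {a b : ℕ} (h : (a, b) ∈ F) (h1 : a ≤ r.1)
    (h2 : b ≤ r.2) : radius F r ≤ max (r.1 - a) (r.2 - b) := by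
  apply untopD_min_le
  exact Finset.mem_image.2 ⟨(a, b), Finset.mem_filter.2 ⟨h, h1, h2⟩, rfl⟩

theorem exists_radius_eq {F : Finset (ℕ × ℕ)} {r : ℕ × ℕ} {a b : ℕ} (h : (a, b) ∈ F)
    (h1 : a ≤ r.1) (h2 : b ≤ r.2) :
    ∃ a b, (a, b) ∈ F ∧ a ≤ r.1 ∧ b ≤ r.2 ∧ max (r.1 - a) (r.2 - b) = radius F r := by
  have hne : ((F.filter (fun q => q.1 ≤ r.1 ∧ q.2 ≤ r.2)).image
    (fun q => max (r.1 - q.1) (r.2 - q.2))).Nonempty :=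
    ⟨_, Finset.mem_image.2 ⟨(a, b), Finset.mem_filter.2 ⟨h, h1, h2⟩, rfl⟩⟩
  obtain ⟨⟨a', b'⟩, hq, he⟩ := Finset.mem_image.1 (untopD_min_mem hne)
  obtain ⟨hq1, hq2, hq3⟩ := Finset.mem_filter.1 hq
  exact ⟨a', b', hq1, hq2, hq3, he⟩

section Sequence

variable (τ : TieBreak) (r : ℕ → ℕ × ℕ)

/-- The states of the pseudo online algorithm on the infinite sequence `r` of requests. -/
def sqSeq : ℕ → SquareState
  | 0 => squareInit
  | i + 1 => squareStep τ (sqSeq i) (r i)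

/-- The solution when the request `i` is handled, including the column of the origin. -/
def solAt (i : ℕ) : Finset (ℕ × ℕ) := (sqSeq τ r i).sol ∪ col 0 (sqSeq τ r i).time (r i).2

/-- The radius of the request `i`. -/
def radAt (i : ℕ) : ℕ := radius (solAt τ r i) (r i)

/-- The serving node of the request `i`. -/
def nodeAt (i : ℕ) : ℕ :=
  ((inSquare (solAt τ r i) (r i) (5 * radAt τ r i)).image Prod.fst).min.untopD 0

/-- The time of the serving replica of the request `i`. -/
def copyAt (i : ℕ) : ℕ :=
  τ.time (timesAt (inSquare (solAt τ r i) (r i) (5 * radAt τ r i)) (nodeAt τ r i))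

theorem sqSeq_succ (i : ℕ) : sqSeq τ r (i + 1) =
    { sol := solAt τ r i ∪ col (nodeAt τ r i) (copyAt τ r i) (r i).2 ∪
        row (nodeAt τ r i) (r i).1 (r i).2 ∪
        col (nodeAt τ r i) (r i).2 ((r i).2 + 4 * radAt τ r i)
      base := (sqSeq τ r i).base ∪ row (nodeAt τ r i) (r i).1 (r i).2
      tail := (sqSeq τ r i).tail ∪ col (nodeAt τ r i) (r i).2 ((r i).2 + 4 * radAt τ r i)
      time := (r i).2
      node := nodeAt τ r i } := rfl

theorem sqSeq_base (j a b : ℕ) : (a, b) ∈ (sqSeq τ r j).base ↔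
    ∃ i < j, b = (r i).2 ∧ nodeAt τ r i ≤ a ∧ a ≤ (r i).1 := by
  induction j with
  | zero => simp [sqSeq, squareInit]
  | succ j ih =>
    rw [sqSeq_succ]
    simp only [Finset.mem_union, mem_row, ih]
    constructor
    · rintro (⟨i, hi, h⟩ | h)
      · exact ⟨i, by omega, h⟩
      · exact ⟨j, by omega, h⟩
    · rintro ⟨i, hi, h⟩
      rcases Nat.lt_succ_iff_lt_or_eq.1 hi with hi | rfl
      · exact Or.inl ⟨i, hi, h⟩
      · exact Or.inr h

theorem sqSeq_tail (j a b : ℕ) : (a, b) ∈ (sqSeq τ r j).tail ↔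
    ∃ i < j, a = nodeAt τ r i ∧ (r i).2 ≤ b ∧ b ≤ (r i).2 + 4 * radAt τ r i := by
  induction j with
  | zero => simp [sqSeq, squareInit]
  | succ j ih =>
    rw [sqSeq_succ]
    simp only [Finset.mem_union, mem_col, ih]
    constructor
    · rintro (⟨i, hi, h⟩ | h)
      · exact ⟨i, by omega, h⟩
      · exact ⟨j, by omega, h⟩
    · rintro ⟨i, hi, h⟩
      rcases Nat.lt_succ_iff_lt_or_eq.1 hi with hi | rfl
      · exact Or.inl ⟨i, hi, h⟩
      · exact Or.inr h

variable (hr : Monotone fun i => (r i).2)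
include hr

theorem sqSeq_time_le (i : ℕ) : (sqSeq τ r i).time ≤ (r i).2 := by
  cases i with
  | zero => simp [sqSeq, squareInit]
  | succ i => exact hr (Nat.le_succ i)

theorem zero_mem_solAt (i : ℕ) : (0, (r i).2) ∈ solAt τ r i :=
  Finset.mem_union_right _ (mem_col.2 ⟨rfl, sqSeq_time_le τ r hr i, le_rfl⟩)

theorem radAt_near (i : ℕ) : ∃ a b, (a, b) ∈ solAt τ r i ∧ a ≤ (r i).1 ∧ b ≤ (r i).2 ∧
    (r i).1 ≤ a + radAt τ r i ∧ (r i).2 ≤ b + radAt τ r i := by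
  obtain ⟨a, b, h1, h2, h3, h4⟩ :=
    exists_radius_eq (zero_mem_solAt τ r hr i) (Nat.zero_le _) le_rfl
  refine ⟨a, b, h1, h2, h3, ?_, ?_⟩ <;> simp only [radAt] <;> omega

theorem nodeAt_mem (i : ℕ) : nodeAt τ r i ∈
    (inSquare (solAt τ r i) (r i) (5 * radAt τ r i)).image Prod.fst := by
  apply untopD_min_mem
  obtain ⟨a, b, h1, h2, h3, h4, h5⟩ := radAt_near τ r hr i
  exact ⟨a, Finset.mem_image.2 ⟨(a, b), mem_inSquare.2 ⟨h1, ⟨h2, by omega⟩, h3, by omega⟩, rfl⟩⟩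

theorem serving_mem (i : ℕ) : (nodeAt τ r i, copyAt τ r i) ∈
    inSquare (solAt τ r i) (r i) (5 * radAt τ r i) := by
  rw [← mem_timesAt]
  apply τ.time_mem
  obtain ⟨⟨a, b⟩, h1, h2⟩ := Finset.mem_image.1 (nodeAt_mem τ r hr i)
  simp only at h2
  exact ⟨b, mem_timesAt.2 (h2 ▸ h1)⟩

theorem sqSeq_sol (j a b : ℕ) : (a, b) ∈ (sqSeq τ r j).sol ↔ (a = 0 ∧ b ≤ (sqSeq τ r j).time) ∨
    ∃ i < j, (a = nodeAt τ r i ∧ copyAt τ r i ≤ b ∧ b ≤ (r i).2 + 4 * radAt τ r i) ∨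
      (b = (r i).2 ∧ nodeAt τ r i ≤ a ∧ a ≤ (r i).1) := by
  induction j with
  | zero => simp [sqSeq, squareInit]
  | succ j ih =>
    have h1 := sqSeq_time_le τ r hr j
    have h2 := (mem_inSquare.1 (serving_mem τ r hr j)).2.2.1
    rw [sqSeq_succ]
    simp only [Finset.mem_union, mem_row, mem_col, solAt, ih]
    constructor
    · rintro (((((⟨h, h'⟩ | ⟨i, hi, h⟩) | ⟨h, h', h''⟩) | h) | h) | h)
      · exact Or.inl ⟨h, by omega⟩
      · exact Or.inr ⟨i, by omega, h⟩
      · exact Or.inl ⟨h, h''⟩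
      · exact Or.inr ⟨j, by omega, Or.inl ⟨h.1, h.2.1, by omega⟩⟩
      · exact Or.inr ⟨j, by omega, Or.inr h⟩
      · exact Or.inr ⟨j, by omega, Or.inl ⟨h.1, by omega, h.2.2⟩⟩
    · rintro (⟨h, h'⟩ | ⟨i, hi, h⟩)
      · by_cases hb : b ≤ (sqSeq τ r j).time
        · exact Or.inl (Or.inl (Or.inl (Or.inl (Or.inl ⟨h, hb⟩))))
        · exact Or.inl (Or.inl (Or.inl (Or.inr ⟨h, by omega, h'⟩)))
      · rcases Nat.lt_succ_iff_lt_or_eq.1 hi with hi | rfl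
        · exact Or.inl (Or.inl (Or.inl (Or.inl (Or.inr ⟨i, hi, h⟩))))
        · rcases h with h | h
          · by_cases hb : b ≤ (r i).2
            · exact Or.inl (Or.inl (Or.inr ⟨h.1, h.2.1, hb⟩))
            · exact Or.inr ⟨h.1, by omega, h.2.2⟩
          · exact Or.inl (Or.inr h)

theorem squareRun : SquareRun (fun i => (r i).1) (fun i => (r i).2) (radAt τ r) (nodeAt τ r)
    (copyAt τ r) (solAt τ r) where
  mono := hr
  mem_iff j a b := by
    have h1 := sqSeq_time_le τ r hr j
    simp only [solAt, Finset.mem_union, sqSeq_sol τ r hr, mem_col]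
    constructor
    · rintro ((⟨h, h'⟩ | h) | ⟨h, h', h''⟩)
      · exact Or.inl ⟨h, by omega⟩
      · exact Or.inr h
      · exact Or.inl ⟨h, h''⟩
    · rintro (⟨h, h'⟩ | h)
      · by_cases hb : b ≤ (sqSeq τ r j).time
        · exact Or.inl (Or.inl ⟨h, hb⟩)
        · exact Or.inr ⟨h, by omega, h'⟩
      · exact Or.inl (Or.inr h)
  free i a b hmem h1 h2 h3 h4 := by
    have := radius_le hmem h1 h2
    simp only [radAt] at h3 h4
    omega
  near := radAt_near τ r hr
  serve i := (mem_inSquare.1 (serving_mem τ r hr i)).1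
  u_le i := (mem_inSquare.1 (serving_mem τ r hr i)).2.1.1
  le_u i := (mem_inSquare.1 (serving_mem τ r hr i)).2.1.2
  s_le i := (mem_inSquare.1 (serving_mem τ r hr i)).2.2.1
  le_s i := (mem_inSquare.1 (serving_mem τ r hr i)).2.2.2
  left i a b hmem h1 h2 h3 h4 :=
    untopD_min_le (Finset.mem_image.2 ⟨(a, b), mem_inSquare.2 ⟨hmem, ⟨h1, h2⟩, h3, h4⟩, rfl⟩)

theorem radAt_le (i : ℕ) : radAt τ r i ≤ (r i).1 := by
  have := radius_le (zero_mem_solAt τ r hr i) (Nat.zero_le _) le_rfl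
  simp only [radAt]
  omega

end Sequence

/-! ### The storage phase -/

theorem mem_nbhd {δ l v u : ℕ} : u ∈ nbhd δ l v ↔ u ≤ v ∧ v / δ ^ l ≤ u / δ ^ l + 1 := by
  simp [nbhd]

theorem self_mem_nbhd (δ l v : ℕ) : v ∈ nbhd δ l v := mem_nbhd.2 ⟨le_rfl, Nat.le_succ _⟩

theorem stayActive_iff {δ l : ℕ} {σ : SquareState} {v t : ℕ} : StayActive δ l σ v t ↔
    ∃ s, ((v, s) ∈ σ.base ∨ (v, s) ∈ σ.tail) ∧ s ≤ t ∧ t < s + δ ^ l := by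
  unfold StayActive
  constructor
  · rintro ⟨⟨a, b⟩, h1, rfl, h2, h3⟩
    exact ⟨b, Finset.mem_union.1 h1, h2, h3⟩
  · rintro ⟨b, h1, h2, h3⟩
    exact ⟨(v, b), Finset.mem_union.2 h1, rfl, h2, h3⟩

section Storage

variable (τ : TieBreak) (δ n : ℕ) (σ : SquareState) (t : ℕ) (C : Finset ℕ)

/-- One step of the storage phase. -/
def pick (l : ℕ) (E : Finset ℕ) (v : ℕ) : Finset ℕ :=
  if StayActive δ l σ v t ∧ E ∩ nbhd δ l v = ∅ then
    insert (τ.node (nbhd δ l v ∩ (nodesAt σ.base t ∪ C))) E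
  else E

theorem storage_eq : storage τ δ n σ t C = (List.range (Nat.log δ n + 1)).foldl
    (fun D l => (List.range n).foldl (pick τ δ σ t C l) D) ({0} ∪ nodesAt σ.tail t) := rfl

/-- What makes the storage phase possible: a stay-active node has a tail replica, or there is a
copy in its neighborhood. -/
def Supplied (l : ℕ) : Prop := ∀ v, StayActive δ l σ v t →
  v ∈ nodesAt σ.tail t ∨ (nbhd δ l v ∩ (nodesAt σ.base t ∪ C)).Nonempty

variable {δ σ t C}

theorem pick_level {l : ℕ} (hs : Supplied δ σ t C l) {D : Finset ℕ} (h0 : 0 ∈ D)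
    (htail : nodesAt σ.tail t ⊆ D) (m : ℕ) :
    D ⊆ (List.range m).foldl (pick τ δ σ t C l) D ∧
    (List.range m).foldl (pick τ δ σ t C l) D ⊆ D ∪ (nodesAt σ.base t ∪ C) ∧
    (∀ v < m, StayActive δ l σ v t →
      ((List.range m).foldl (pick τ δ σ t C l) D ∩ nbhd δ l v).Nonempty) ∧
    ∃ S : Finset ℕ, ((List.range m).foldl (pick τ δ σ t C l) D).card ≤ D.card + S.card ∧
      (∀ v ∈ S, v < m ∧ StayActive δ l σ v t ∧ δ ^ l ≤ v) ∧
      Set.InjOn (fun v => v / δ ^ l) S := by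
  induction m with
  | zero => exact ⟨by simp, by simp, by simp, ∅, by simp, by simp, by simp⟩
  | succ m ih =>
    obtain ⟨h1, h2, h3, S, h4, h5, h6⟩ := ih
    rw [List.range_succ, List.foldl_append, List.foldl_cons, List.foldl_nil]
    set E := (List.range m).foldl (pick τ δ σ t C l) D with hE
    unfold pick
    split_ifs with hc
    · obtain ⟨hact, hemp⟩ := hc
      have hne : (nbhd δ l m ∩ (nodesAt σ.base t ∪ C)).Nonempty := by
        refine (hs m hact).resolve_left fun hm => ?_
        have : m ∈ E ∩ nbhd δ l m := Finset.mem_inter.2 ⟨h1 (htail hm), self_mem_nbhd _ _ _⟩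
        rw [hemp] at this
        simp at this
      have ha := τ.node_mem _ hne
      set a := τ.node (nbhd δ l m ∩ (nodesAt σ.base t ∪ C)) with ha'
      obtain ⟨ha1, ha2⟩ := Finset.mem_inter.1 ha
      refine ⟨h1.trans (Finset.subset_insert _ _), ?_, ?_, insert m S, ?_, ?_, ?_⟩
      · exact Finset.insert_subset (Finset.mem_union_right _ ha2) h2
      · intro v hv hact'
        rcases Nat.lt_succ_iff_lt_or_eq.1 hv with hv | rfl
        · exact (h3 v hv hact').mono
            (Finset.inter_subset_inter_right (Finset.subset_insert _ _))
        · exact ⟨a, Finset.mem_inter.2 ⟨Finset.mem_insert_self _ _, ha1⟩⟩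
      · have hmS : m ∉ S := fun hm => lt_irrefl _ (h5 m hm).1
        rw [Finset.card_insert_of_notMem hmS]
        have := Finset.card_insert_le a E
        omega
      · intro v hv
        rcases Finset.mem_insert.1 hv with rfl | hv
        · refine ⟨Nat.lt_succ_self _, hact, ?_⟩
          by_contra hlt
          have : (0 : ℕ) ∈ E ∩ nbhd δ l v := by
            refine Finset.mem_inter.2 ⟨h1 h0, mem_nbhd.2 ⟨Nat.zero_le _, ?_⟩⟩
            rw [Nat.div_eq_of_lt (not_le.1 hlt)]
            exact Nat.zero_le _
          rw [hemp] at this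
          simp at this
        · exact ⟨(h5 v hv).1.trans (Nat.lt_succ_self _), (h5 v hv).2⟩
      · -- a selected node in the interval of `m` would already be in its neighborhood
        have hnew : ∀ v ∈ S, v / δ ^ l ≠ m / δ ^ l := by
          intro v hv he
          obtain ⟨w, hw⟩ := h3 v (h5 v hv).1 (h5 v hv).2.1
          obtain ⟨hw1, hw2⟩ := Finset.mem_inter.1 hw
          obtain ⟨hw3, hw4⟩ := mem_nbhd.1 hw2
          have hv' := (h5 v hv).1
          have : w ∈ E ∩ nbhd δ l m :=
            Finset.mem_inter.2 ⟨hw1, mem_nbhd.2 ⟨by omega, by omega⟩⟩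
          rw [hemp] at this
          simp at this
        rw [Finset.coe_insert]
        intro v hv w hw hvw
        simp only at hvw
        rcases hv with rfl | hv <;> rcases hw with rfl | hw
        · rfl
        · exact absurd hvw.symm (hnew w hw)
        · exact absurd hvw (hnew v hv)
        · exact h6 hv hw hvw
    · refine ⟨h1, h2, ?_, S, h4, fun v hv => ⟨(h5 v hv).1.trans (Nat.lt_succ_self _), (h5 v hv).2⟩,
        h6⟩
      intro v hv hact
      rcases Nat.lt_succ_iff_lt_or_eq.1 hv with hv | rfl
      · exact h3 v hv hact
      · by_contra hne
        exact hc ⟨hact, Finset.not_nonempty_iff_eq_empty.1 hne⟩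

theorem pick_levels (k : ℕ) (hs : ∀ l < k, Supplied δ σ t C l) :
    ∀ E, E = (List.range k).foldl (fun D l => (List.range n).foldl (pick τ δ σ t C l) D)
      ({0} ∪ nodesAt σ.tail t) →
    {0} ∪ nodesAt σ.tail t ⊆ E ∧ E ⊆ ({0} ∪ nodesAt σ.tail t) ∪ (nodesAt σ.base t ∪ C) ∧
    (∀ l < k, ∀ v < n, StayActive δ l σ v t → (E ∩ nbhd δ l v).Nonempty) ∧
    ∃ S : ℕ → Finset ℕ,
      E.card ≤ (1 + (nodesAt σ.tail t).card) + ∑ l ∈ Finset.range k, (S l).card ∧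
      ∀ l < k, (∀ v ∈ S l, StayActive δ l σ v t ∧ δ ^ l ≤ v) ∧
        Set.InjOn (fun v => v / δ ^ l) (S l) := by
  induction k with
  | zero =>
    rintro E rfl
    refine ⟨by simp, by simp, by simp, fun _ => ∅, ?_, by simp⟩
    simpa using Finset.card_union_le {0} (nodesAt σ.tail t)
  | succ k ih =>
    obtain ⟨h1, h2, h3, S, h4, h5⟩ := ih (fun l hl => hs l (by omega)) _ rfl
    rintro E' rfl
    rw [List.range_succ, List.foldl_append, List.foldl_cons, List.foldl_nil]
    set E := (List.range k).foldl (fun D l => (List.range n).foldl (pick τ δ σ t C l) D)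
      ({0} ∪ nodesAt σ.tail t) with hE
    obtain ⟨g1, g2, g3, T, g4, g5, g6⟩ := pick_level τ (hs k (Nat.lt_succ_self k))
      (h1 (Finset.mem_union_left _ (Finset.mem_singleton_self 0)))
      (Finset.subset_union_right.trans h1) n
    refine ⟨h1.trans g1, g2.trans (Finset.union_subset h2 Finset.subset_union_right), ?_,
      fun l => if l = k then T else S l, ?_, ?_⟩
    · intro l hl v hv hact
      rcases Nat.lt_succ_iff_lt_or_eq.1 hl with hl | rfl
      · exact (h3 l hl v hv hact).mono (Finset.inter_subset_inter_right g1)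
      · exact g3 v hv hact
    · have e : ∑ l ∈ Finset.range k, (if l = k then T else S l).card =
          ∑ l ∈ Finset.range k, (S l).card :=
        Finset.sum_congr rfl fun l hl => by rw [if_neg (Finset.mem_range.1 hl).ne]
      rw [Finset.sum_range_succ, e]
      simp only [if_true]
      omega
    · intro l hl
      rcases Nat.lt_succ_iff_lt_or_eq.1 hl with hl | rfl
      · simp only [if_neg hl.ne]
        exact h5 l hl
      · simp only [if_true]
        exact ⟨fun v hv => (g5 v hv).2, g6⟩

end Storage

section Kept

variable (τ : TieBreak) {δ n : ℕ} {σ : SquareState}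

/-- At every time the storage phase is possible: a node that is stay-active because of an earlier
replica was so at the previous time, too, and then a copy was kept in its neighborhood. -/
theorem supplied_kept (hb : ∀ a b, (a, b) ∈ σ.base ∨ (a, b) ∈ σ.tail → a < n)
    (t : ℕ) : ∀ l < Nat.log δ n + 1, Supplied δ σ t (kept τ δ n σ t) l := by
  have cur : ∀ t l v, (∀ s < t, s + δ ^ l ≤ t ∨ ¬ ((v, s) ∈ σ.base ∨ (v, s) ∈ σ.tail)) →
      StayActive δ l σ v t → v ∈ nodesAt σ.tail t ∨
        (nbhd δ l v ∩ (nodesAt σ.base t ∪ kept τ δ n σ t)).Nonempty := by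
    intro t l v hno hact
    obtain ⟨s, h1, h2, h3⟩ := stayActive_iff.1 hact
    rcases h2.lt_or_eq with h2 | rfl
    · rcases hno s h2 with h | h
      · omega
      · exact absurd h1 h
    · rcases h1 with h1 | h1
      · exact Or.inr ⟨v, Finset.mem_inter.2 ⟨self_mem_nbhd _ _ _,
          Finset.mem_union_left _ (mem_nodesAt.2 h1)⟩⟩
      · exact Or.inl (mem_nodesAt.2 h1)
  induction t with
  | zero =>
    intro l _ v hact
    exact cur 0 l v (fun s hs => by omega) hact
  | succ t ih =>
    intro l hl v hact
    by_cases hact' : StayActive δ l σ v t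
    · have hv : v < n := by
        obtain ⟨s, h1, -⟩ := stayActive_iff.1 hact'
        exact hb v s h1
      obtain ⟨-, -, h3, -⟩ := pick_levels τ n _ ih _ (storage_eq τ δ n σ t _)
      obtain ⟨w, hw⟩ := h3 l hl v hv hact'
      obtain ⟨hw1, hw2⟩ := Finset.mem_inter.1 hw
      exact Or.inr ⟨w, Finset.mem_inter.2 ⟨hw2, Finset.mem_union_right _ hw1⟩⟩
    · refine cur (t + 1) l v (fun s hs => ?_) hact
      by_contra hcon
      push Not at hcon
      exact hact' (stayActive_iff.2 ⟨s, hcon.2, by omega, by omega⟩)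

theorem kept_succ_spec (hb : ∀ a b, (a, b) ∈ σ.base ∨ (a, b) ∈ σ.tail → a < n)
    (t : ℕ) :
    {0} ∪ nodesAt σ.tail t ⊆ kept τ δ n σ (t + 1) ∧
    kept τ δ n σ (t + 1) ⊆
      ({0} ∪ nodesAt σ.tail t) ∪ (nodesAt σ.base t ∪ kept τ δ n σ t) ∧
    (∀ l < Nat.log δ n + 1, ∀ v < n, StayActive δ l σ v t →
      (kept τ δ n σ (t + 1) ∩ nbhd δ l v).Nonempty) ∧
    ∃ S : ℕ → Finset ℕ, (kept τ δ n σ (t + 1)).card ≤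
        (1 + (nodesAt σ.tail t).card) + ∑ l ∈ Finset.range (Nat.log δ n + 1), (S l).card ∧
      ∀ l < Nat.log δ n + 1, (∀ v ∈ S l, StayActive δ l σ v t ∧ δ ^ l ≤ v) ∧
        Set.InjOn (fun v => v / δ ^ l) (S l) :=
  pick_levels τ n _ (supplied_kept τ hb t) _ (storage_eq τ δ n σ t _)

theorem zero_mem_kept (hb : ∀ a b, (a, b) ∈ σ.base ∨ (a, b) ∈ σ.tail → a < n)
    (t : ℕ) : 0 ∈ kept τ δ n σ t := by
  cases t with
  | zero => simp [kept]
  | succ t =>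
    exact (kept_succ_spec τ hb t).1 (Finset.mem_union_left _ (Finset.mem_singleton_self 0))

variable (δ n) in
/-- The copies at time `t` depend only on the replicas of earlier times. -/
theorem kept_congr {σ' : SquareState} (t : ℕ)
    (hb : ∀ a b, b < t → ((a, b) ∈ σ.base ↔ (a, b) ∈ σ'.base))
    (ht : ∀ a b, b < t → ((a, b) ∈ σ.tail ↔ (a, b) ∈ σ'.tail)) :
    kept τ δ n σ t = kept τ δ n σ' t := by
  induction t with
  | zero => rfl
  | succ t ih =>
    have e1 : nodesAt σ.base t = nodesAt σ'.base t := by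
      ext a
      rw [mem_nodesAt, mem_nodesAt, hb a t (Nat.lt_succ_self t)]
    have e2 : nodesAt σ.tail t = nodesAt σ'.tail t := by
      ext a
      rw [mem_nodesAt, mem_nodesAt, ht a t (Nat.lt_succ_self t)]
    have e3 : ∀ l v, StayActive δ l σ v t ↔ StayActive δ l σ' v t := by
      intro l v
      rw [stayActive_iff, stayActive_iff]
      refine exists_congr fun s => and_congr_left fun hs => ?_
      rw [hb v s (by omega), ht v s (by omega)]
    have e4 := ih (fun a b h => hb a b (by omega)) (fun a b h => ht a b (by omega))
    have e5 : ∀ l, pick τ δ σ t (kept τ δ n σ t) l = pick τ δ σ' t (kept τ δ n σ' t) l := by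
      intro l
      funext E v
      unfold pick
      rw [e1, e4]
      exact if_congr (and_congr_left' (e3 l v)) rfl rfl
    change storage τ δ n σ t (kept τ δ n σ t) = storage τ δ n σ' t (kept τ δ n σ' t)
    rw [storage_eq, storage_eq, e2]
    simp only [e5]

end Kept

/-! ### Counting the copies -/

/-- Every replica of `F` other than the origin has a predecessor in `F`. -/
def PredClosed (F : Finset (ℕ × ℕ)) : Prop := ∀ a b, (a, b) ∈ F → (a = 0 ∧ b = 0) ∨
  (∃ a', a = a' + 1 ∧ (a', b) ∈ F) ∨ ∃ b', b = b' + 1 ∧ (a, b') ∈ F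

theorem PredClosed.exists_back {F : Finset (ℕ × ℕ)} (hF : PredClosed F) {a b : ℕ}
    (hab : (a, b) ∈ F) (m : ℕ) (hm : m ≤ a + b) :
    ∃ x y, (x, y) ∈ F ∧ x ≤ a ∧ y ≤ b ∧ x + y + m = a + b := by
  induction m with
  | zero => exact ⟨a, b, hab, le_rfl, le_rfl, by omega⟩
  | succ m ih =>
    obtain ⟨x, y, h1, h2, h3, h4⟩ := ih (by omega)
    rcases hF x y h1 with ⟨h5, h6⟩ | ⟨x', h5, h6⟩ | ⟨y', h5, h6⟩
    · omega
    · exact ⟨x', y, h6, by omega, by omega, by omega⟩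
    · exact ⟨x, y', h6, by omega, by omega, by omega⟩

/-- Suppose that at each time nodes in different intervals of length `d` are selected, each at least
`d` and with a replica of `F` during the last `d` time units. The path of `F` that ends in this replica
puts `d` replicas into a box of size proportional to `d`, and a replica lies in few
such boxes. So the number of selections is at most proportional to the size of `F`. -/
theorem sum_card_selected_le {F : Finset (ℕ × ℕ)} (hF : PredClosed F) {d : ℕ} (hd : 0 < d) (T : ℕ)
    (S : ℕ → Finset ℕ)
    (hS : ∀ t, ∀ v ∈ S t, d ≤ v ∧ ∃ s, (v, s) ∈ F ∧ s ≤ t ∧ t < s + d)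
    (hinj : ∀ t, Set.InjOn (fun v => v / d) (S t)) :
    ∑ t ∈ Finset.range T, (S t).card ≤ 4 * F.card := by
  classical
  let rel : (Σ _ : ℕ, ℕ) → ℕ × ℕ → Prop := fun p q =>
    (q.1 ≤ p.2 ∧ p.2 < q.1 + d) ∧ q.2 ≤ p.1 ∧ p.1 < q.2 + 2 * d
  have key := Finset.card_mul_le_card_mul (s := (Finset.range T).sigma S) (t := F) rel
    (m := d) (n := 4 * d) ?_ ?_
  · rw [Finset.card_sigma] at key
    have : d * ∑ t ∈ Finset.range T, (S t).card ≤ d * (4 * F.card) := by linarith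
    exact Nat.le_of_mul_le_mul_left this hd
  · rintro ⟨t, v⟩ hp
    obtain ⟨-, hv⟩ := Finset.mem_sigma.1 hp
    obtain ⟨hdv, s, hs1, hs2, hs3⟩ := hS t v hv
    have hback : ∀ m : Fin d, ∃ q : ℕ × ℕ, q ∈ F.filter (rel ⟨t, v⟩) ∧
        q.1 + q.2 + m = v + s := by
      intro m
      obtain ⟨x, y, h1, h2, h3, h4⟩ := hF.exists_back hs1 m (by omega)
      have := m.2
      refine ⟨(x, y), Finset.mem_filter.2 ⟨h1, ⟨h2, ?_⟩, ?_, ?_⟩, h4⟩ <;> simp only <;> omega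
    choose f hf1 hf2 using hback
    have hfi : Function.Injective f := by
      intro m m' hmm
      have e1 := hf2 m
      have e2 := hf2 m'
      rw [hmm] at e1
      exact Fin.ext (by omega)
    calc d = (Finset.univ.image f).card := by
          rw [Finset.card_image_of_injective _ hfi, Finset.card_univ, Fintype.card_fin]
      _ ≤ _ := Finset.card_le_card (by
          intro q hq
          obtain ⟨m, -, rfl⟩ := Finset.mem_image.1 hq
          exact hf1 m)
  · rintro ⟨x, y⟩ -
    have hcard : (Finset.Ico y (y + 2 * d) ×ˢ ({x / d, x / d + 1} : Finset ℕ)).card ≤ 4 * d := by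
      rw [Finset.card_product, Nat.card_Ico]
      have : ({x / d, x / d + 1} : Finset ℕ).card ≤ 2 := Finset.card_le_two
      calc (y + 2 * d - y) * ({x / d, x / d + 1} : Finset ℕ).card ≤ (y + 2 * d - y) * 2 :=
            Nat.mul_le_mul_left _ this
        _ = 4 * d := by omega
    refine le_trans ?_ hcard
    refine Finset.card_le_card_of_injOn (fun p => (p.1, p.2 / d)) ?_ ?_
    · rintro ⟨t, v⟩ hp
      obtain ⟨-, ⟨h1, h2⟩, h3, h4⟩ := Finset.mem_filter.1 hp
      simp only at h1 h2 h3 h4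
      refine Finset.mem_product.2 ⟨Finset.mem_Ico.2 ⟨h3, h4⟩, ?_⟩
      have e1 : x / d ≤ v / d := Nat.div_le_div_right h1
      have e2 : v / d ≤ (x + d) / d := Nat.div_le_div_right h2.le
      rw [Nat.add_div_right _ hd] at e2
      simp only [Finset.mem_insert, Finset.mem_singleton]
      omega
    · rintro ⟨t, v⟩ hp ⟨t', v'⟩ hp' he
      obtain ⟨hp1, -⟩ := Finset.mem_filter.1 (Finset.mem_coe.1 hp)
      obtain ⟨hp1', -⟩ := Finset.mem_filter.1 (Finset.mem_coe.1 hp')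
      simp only [Prod.mk.injEq] at he
      obtain ⟨rfl, he⟩ := he
      have := hinj t (Finset.mem_sigma.1 hp1).2 (Finset.mem_sigma.1 hp1').2 he
      simp only at this
      rw [this]

theorem sum_card_nodesAt_le (F : Finset (ℕ × ℕ)) (T : ℕ) :
    ∑ t ∈ Finset.range T, (nodesAt F t).card ≤ F.card := by
  calc ∑ t ∈ Finset.range T, (nodesAt F t).card
      ≤ ∑ t ∈ Finset.range T, (F.filter (fun q => q.2 = t)).card :=
        Finset.sum_le_sum fun t _ => Finset.card_image_le
    _ = ((Finset.range T).biUnion fun t => F.filter (fun q => q.2 = t)).card := by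
        rw [Finset.card_biUnion]
        intro t _ t' _ hne
        exact Finset.disjoint_filter.2 fun q _ h1 h2 => hne (h1.symm.trans h2)
    _ ≤ F.card := Finset.card_le_card (Finset.biUnion_subset.2 fun t _ => Finset.filter_subset _ _)

/-- The number of copies that are kept during `T` time units: the origin, the tails, and
for each level at most four copies per replica of the pseudo online solution. -/
theorem sum_card_kept_le (τ : TieBreak) {δ n : ℕ} {σ : SquareState} (hδ : 0 < δ)
    (hb : ∀ a b, (a, b) ∈ σ.base ∨ (a, b) ∈ σ.tail → a < n)
    (hsol : ∀ a b, (a, b) ∈ σ.base ∨ (a, b) ∈ σ.tail → (a, b) ∈ σ.sol) (hp : PredClosed σ.sol)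
    (T : ℕ) : ∑ t ∈ Finset.range T, (kept τ δ n σ (t + 1)).card ≤
      T + σ.tail.card + (Nat.log δ n + 1) * (4 * σ.sol.card) := by
  choose S hS1 hS2 using fun t => (kept_succ_spec τ hb t).2.2.2
  calc ∑ t ∈ Finset.range T, (kept τ δ n σ (t + 1)).card
      ≤ ∑ t ∈ Finset.range T, ((1 + (nodesAt σ.tail t).card) +
          ∑ l ∈ Finset.range (Nat.log δ n + 1), (S t l).card) :=
        Finset.sum_le_sum fun t _ => hS1 t
    _ = T + ∑ t ∈ Finset.range T, (nodesAt σ.tail t).card +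
          ∑ l ∈ Finset.range (Nat.log δ n + 1), ∑ t ∈ Finset.range T, (S t l).card := by
        rw [Finset.sum_add_distrib, Finset.sum_add_distrib, Finset.sum_comm]
        simp
    _ ≤ _ := by
        refine add_le_add (Nat.add_le_add_left (sum_card_nodesAt_le _ _) _) ?_
        calc _ ≤ ∑ l ∈ Finset.range (Nat.log δ n + 1), 4 * σ.sol.card := by
              refine Finset.sum_le_sum fun l hl => ?_
              have hl' := Finset.mem_range.1 hl
              refine sum_card_selected_le hp (pow_pos hδ l) T (fun t => S t l) ?_
                (fun t => (hS2 t l hl').2)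
              intro t v hv
              obtain ⟨h1, h2⟩ := (hS2 t l hl').1 v hv
              obtain ⟨s, h3, h4⟩ := stayActive_iff.1 h1
              exact ⟨h2, s, hsol _ _ h3, h4⟩
          _ = _ := by simp

/-! ### Reachability, and runs on sequences -/

/-- `F` contains a monotone rectilinear path from the origin to `p`. -/
def Reach (F : List Seg) (p : Point) : Prop := Relation.ReflTransGen (MonoStep F) (0, 0) p

theorem covered_mono {F F' : List Seg} (h : F ⊆ F') : covered F ⊆ covered F' := by
  rintro p ⟨s, hs, hp⟩
  exact ⟨s, h hs, hp⟩

theorem MonoStep.mono {F F' : List Seg} (h : F ⊆ F') {a b : Point} (hab : MonoStep F a b) :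
    MonoStep F' a b := ⟨hab.1, hab.2.trans (covered_mono h)⟩

theorem Reach.mono {F F' : List Seg} (h : F ⊆ F') {p : Point} (hp : Reach F p) : Reach F' p :=
  Relation.ReflTransGen.mono (fun _ _ => MonoStep.mono h) _ _ hp

theorem Feasible.mono {F F' : List Seg} (h : F ⊆ F') {Q : List Point} (hF : Feasible F Q) :
    Feasible F' Q := fun p hp => Reach.mono h (hF p hp)

theorem monoStep_horiz {F : List Seg} {y a b c d : ℝ} (hs : Seg.horiz y a b ∈ F) (h1 : a ≤ c)
    (h2 : c ≤ d) (h3 : d ≤ b) : MonoStep F (c, y) (d, y) := by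
  refine ⟨Or.inl ⟨h2, rfl⟩, ?_⟩
  rintro ⟨x, y'⟩ ⟨⟨hx1, hy1⟩, hx2, hy2⟩
  simp only at hx1 hx2 hy1 hy2
  refine ⟨_, hs, ?_, le_antisymm hy2 hy1⟩
  rw [uIcc_of_le (by linarith)]
  exact ⟨h1.trans hx1, hx2.trans h3⟩

theorem monoStep_vert {F : List Seg} {x a b c d : ℝ} (hs : Seg.vert x a b ∈ F) (h1 : a ≤ c)
    (h2 : c ≤ d) (h3 : d ≤ b) : MonoStep F (x, c) (x, d) := by
  refine ⟨Or.inr ⟨rfl, h2⟩, ?_⟩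
  rintro ⟨x', y⟩ ⟨⟨hx1, hy1⟩, hx2, hy2⟩
  simp only at hx1 hx2 hy1 hy2
  refine ⟨_, hs, le_antisymm hx2 hx1, ?_⟩
  rw [uIcc_of_le (by linarith)]
  exact ⟨h1.trans hy1, hy2.trans h3⟩

theorem Reach.horiz {F : List Seg} {y a b c d : ℝ} (h : Reach F (c, y))
    (hs : Seg.horiz y a b ∈ F) (h1 : a ≤ c) (h2 : c ≤ d) (h3 : d ≤ b) : Reach F (d, y) :=
  Relation.ReflTransGen.tail h (monoStep_horiz hs h1 h2 h3)

theorem Reach.vert {F : List Seg} {x a b c d : ℝ} (h : Reach F (x, c))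
    (hs : Seg.vert x a b ∈ F) (h1 : a ≤ c) (h2 : c ≤ d) (h3 : d ≤ b) : Reach F (x, d) :=
  Relation.ReflTransGen.tail h (monoStep_vert hs h1 h2 h3)

theorem runFrom_append (A : Algorithm) (h Q Q' : List Point) :
    runFrom A h (Q ++ Q') = runFrom A h Q ++ runFrom A (h ++ Q) Q' := by
  induction Q generalizing h with
  | nil => simp [runFrom]
  | cons q Q ih => simp [runFrom, ih]

theorem run_append (A : Algorithm) (Q Q' : List Point) :
    run A (Q ++ Q') = run A Q ++ runFrom A Q Q' := by
  simp [run, runFrom_append]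

theorem run_snoc (A : Algorithm) (Q : List Point) (p : Point) :
    run A (Q ++ [p]) = run A Q ++ A Q p := by
  simp [run_append, runFrom]

theorem lastY_snoc (Q : List Point) (p : Point) : lastY (Q ++ [p]) = p.2 := by
  simp [lastY]

theorem lastY_nil : lastY [] = 0 := by simp [lastY]

/-- The first `m` points of a sequence. -/
def pre (p : ℕ → Point) (m : ℕ) : List Point := (List.range m).map p

theorem pre_succ (p : ℕ → Point) (m : ℕ) : pre p (m + 1) = pre p m ++ [p m] := by
  simp [pre, List.range_succ]

theorem mem_pre {p : ℕ → Point} {m : ℕ} {q : Point} : q ∈ pre p m ↔ ∃ i < m, p i = q := by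
  simp [pre]

/-- An infinite sequence of points of the strip `[0, M] × [0, ∞)` with nondecreasing heights. -/
structure StripSeq (M : ℝ) (p : ℕ → Point) : Prop where
  nonneg : ∀ i, 0 ≤ (p i).1
  le : ∀ i, (p i).1 ≤ M
  mono : Monotone fun i => (p i).2
  zero_le : 0 ≤ (p 0).2

theorem ValidRequests.snoc {Q : List Point} {p : Point} (h : ValidRequests (Q ++ [p])) :
    ValidRequests Q ∧ (0 ≤ p.1 ∧ 0 ≤ p.2) ∧ lastY Q ≤ p.2 ∧ ∀ q ∈ Q, q.2 ≤ p.2 := by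
  obtain ⟨h1, h2⟩ := h
  rw [List.map_append, List.pairwise_append] at h2
  have h3 : ∀ q ∈ Q, q.2 ≤ p.2 := fun q hq => h2.2.2 _ (List.mem_map_of_mem hq) _ (by simp)
  refine ⟨⟨fun q hq => h1 q (by simp [hq]), h2.1⟩, h1 p (by simp), ?_, h3⟩
  rcases List.eq_nil_or_concat' Q with rfl | ⟨Q', q, rfl⟩
  · rw [lastY_nil]
    exact (h1 p (by simp)).2
  · rw [lastY_snoc]
    exact h3 q (by simp)

/-- Every finite request sequence extends to an infinite one: repeat the point of the
`y`-axis at the height of the last request. -/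
theorem exists_stripSeq {M : ℝ} (hM : 0 ≤ M) {Q : List Point} (hQ : ValidRequests Q)
    (hx : ∀ q ∈ Q, q.1 ≤ M) : ∃ p, StripSeq M p ∧ pre p Q.length = Q := by
  induction Q using List.reverseRecOn with
  | nil =>
    exact ⟨fun _ => (0, 0), ⟨by simp, by simpa using hM, fun _ _ _ => le_rfl, le_rfl⟩, rfl⟩
  | append_singleton Q q ih =>
    obtain ⟨h1, h2, h3, h4⟩ := hQ.snoc
    obtain ⟨p, hp, hpQ⟩ := ih h1 (fun q hq => hx q (by simp [hq]))
    have hle : ∀ i < Q.length, (p i).2 ≤ q.2 := by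
      intro i hi
      apply h4
      rw [← hpQ, mem_pre]
      exact ⟨i, hi, rfl⟩
    refine ⟨fun i => if i < Q.length then p i else if i = Q.length then q else (0, q.2),
      ⟨?_, ?_, ?_, ?_⟩, ?_⟩
    · intro i
      split_ifs
      exacts [hp.nonneg i, h2.1, le_rfl]
    · intro i
      split_ifs
      exacts [hp.le i, hx q (by simp), hM]
    · intro i j hij
      simp only
      split_ifs <;> first | exact hp.mono hij | exact le_rfl | (exact hle i (by assumption)) | omega
    · split_ifs
      exacts [hp.zero_le, h2.2, h2.2]
    · rw [List.length_append, List.length_singleton, pre_succ]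
      congr 1
      · conv_rhs => rw [← hpQ]
        unfold pre
        apply List.map_congr_left
        intro i hi
        rw [if_pos (List.mem_range.1 hi)]
      · simp

/-! ### The online algorithm on the grid as a sequence of states -/

section Line

variable (τ : TieBreak) (δ n : ℕ) (r : ℕ → ℕ × ℕ)

/-- The states of the online algorithm on the grid on the infinite sequence `r` of requests. -/
def lineSeq : ℕ → LineState
  | 0 => lineInit
  | i + 1 => lineStep τ δ n (lineSeq i) (r i)

/-- The source of the delivery route of the request `i`. -/
def srcAt (i : ℕ) : ℕ := (lineSeq τ δ n r (i + 1)).src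

theorem lineSeq_sq (i : ℕ) : (lineSeq τ δ n r i).sq = sqSeq τ r i := by
  induction i with
  | zero => rfl
  | succ i ih =>
    change squareStep τ (lineSeq τ δ n r i).sq (r i) = squareStep τ (sqSeq τ r i) (r i)
    rw [ih]

theorem lineRun_eq (m : ℕ) : lineRun τ δ n ((List.range m).map r) = lineSeq τ δ n r m := by
  induction m with
  | zero => rfl
  | succ m ih =>
    rw [List.range_succ, List.map_append]
    unfold lineRun at ih ⊢
    rw [List.foldl_append, ih]
    rfl

theorem lineSeq_routes (j a b : ℕ) : (a, b) ∈ (lineSeq τ δ n r j).routes ↔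
    ∃ i < j, b = (r i).2 ∧ srcAt τ δ n r i ≤ a ∧ a ≤ (r i).1 := by
  induction j with
  | zero => simp [lineSeq, lineInit]
  | succ j ih =>
    have : (lineSeq τ δ n r (j + 1)).routes =
        (lineSeq τ δ n r j).routes ∪ row (srcAt τ δ n r j) (r j).1 (r j).2 := rfl
    rw [this, Finset.mem_union, mem_row, ih]
    constructor
    · rintro (⟨i, hi, h⟩ | h)
      · exact ⟨i, by omega, h⟩
      · exact ⟨j, by omega, h⟩
    · rintro ⟨i, hi, h⟩
      rcases Nat.lt_succ_iff_lt_or_eq.1 hi with hi | rfl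
      · exact Or.inl ⟨i, hi, h⟩
      · exact Or.inr h

/-- The nodes with a copy when the delivery phase of the request `i` begins. -/
def availAt (i : ℕ) : Finset ℕ :=
  kept τ δ n (sqSeq τ r i) (r i).2 ∪ nodesAt (lineSeq τ δ n r i).routes (r i).2

theorem srcAt_eq (i : ℕ) : srcAt τ δ n r i =
    (((availAt τ δ n r i).filter (fun w => w ≤ nodeAt τ r i)).max).unbotD 0 := by
  change (((kept τ δ n (lineSeq τ δ n r i).sq (r i).2 ∪ nodesAt (lineSeq τ δ n r i).routes
    (r i).2).filter (fun w => w ≤ (squareStep τ (lineSeq τ δ n r i).sq (r i)).node)).max).unbotD 0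
    = _
  rw [lineSeq_sq]
  rfl

variable {r}

theorem le_srcAt {i w : ℕ} (hw : w ∈ availAt τ δ n r i) (hle : w ≤ nodeAt τ r i) :
    w ≤ srcAt τ δ n r i := by
  have hmem : w ∈ (availAt τ δ n r i).filter (fun w => w ≤ nodeAt τ r i) :=
    Finset.mem_filter.2 ⟨hw, hle⟩
  rw [srcAt_eq, ← Finset.coe_max' ⟨w, hmem⟩]
  exact Finset.le_max' _ w hmem

/-- The requests of the grid have nodes less than `n` and nondecreasing times. -/
structure GridSeq (n : ℕ) (r : ℕ → ℕ × ℕ) : Prop where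
  lt : ∀ i, (r i).1 < n
  mono : Monotone fun i => (r i).2

variable {n}

theorem GridSeq.node_lt (h : GridSeq n r) (j a b : ℕ)
    (hab : (a, b) ∈ (sqSeq τ r j).base ∨ (a, b) ∈ (sqSeq τ r j).tail) : a < n := by
  rcases hab with hab | hab
  · obtain ⟨i, -, -, -, h3⟩ := (sqSeq_base τ r j a b).1 hab
    exact h3.trans_lt (h.lt i)
  · obtain ⟨i, -, rfl, -⟩ := (sqSeq_tail τ r j a b).1 hab
    exact ((squareRun τ r h.mono).u_le i).trans_lt (h.lt i)

theorem GridSeq.zero_mem_kept (h : GridSeq n r) (j t : ℕ) : 0 ∈ kept τ δ n (sqSeq τ r j) t :=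
  RSA.zero_mem_kept τ (h.node_lt τ j) t

theorem GridSeq.srcAt_mem (h : GridSeq n r) (i : ℕ) :
    srcAt τ δ n r i ∈ availAt τ δ n r i ∧ srcAt τ δ n r i ≤ nodeAt τ r i := by
  have hne : ((availAt τ δ n r i).filter (fun w => w ≤ nodeAt τ r i)).Nonempty :=
    ⟨0, Finset.mem_filter.2 ⟨Finset.mem_union_left _ (h.zero_mem_kept τ δ i _), Nat.zero_le _⟩⟩
  have := Finset.max'_mem _ hne
  rw [srcAt_eq, ← Finset.coe_max' hne]
  exact Finset.mem_filter.1 this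

theorem GridSeq.base_subset_routes (h : GridSeq n r) {j a b : ℕ}
    (hab : (a, b) ∈ (sqSeq τ r j).base) : (a, b) ∈ (lineSeq τ δ n r j).routes := by
  obtain ⟨i, h1, h2, h3, h4⟩ := (sqSeq_base τ r j a b).1 hab
  exact (lineSeq_routes τ δ n r j a b).2 ⟨i, h1, h2, (h.srcAt_mem τ δ i).2.trans h3, h4⟩

/-- The copies up to the time of the request `j` do not depend on `j` and the later requests. -/
theorem GridSeq.kept_stable (h : GridSeq n r) {j k t : ℕ} (hjk : j ≤ k) (ht : t ≤ (r j).2) :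
    kept τ δ n (sqSeq τ r j) t = kept τ δ n (sqSeq τ r k) t := by
  refine kept_congr τ δ n t (fun a b hb => ?_) (fun a b hb => ?_)
  · rw [sqSeq_base, sqSeq_base]
    constructor
    · rintro ⟨i, hi, h1⟩
      exact ⟨i, hi.trans_le hjk, h1⟩
    · rintro ⟨i, hi, h1, h2⟩
      refine ⟨i, ?_, h1, h2⟩
      by_contra hlt
      have := h.mono (not_lt.1 hlt)
      simp only at this
      omega
  · rw [sqSeq_tail, sqSeq_tail]
    constructor
    · rintro ⟨i, hi, h1⟩
      exact ⟨i, hi.trans_le hjk, h1⟩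
    · rintro ⟨i, hi, h1, h2, h3⟩
      refine ⟨i, ?_, h1, h2, h3⟩
      by_contra hlt
      have := h.mono (not_lt.1 hlt)
      simp only at this
      omega

theorem sqSeq_time_zero : (sqSeq τ r 0).time = 0 := rfl

theorem sqSeq_time_succ (i : ℕ) : (sqSeq τ r (i + 1)).time = (r i).2 := rfl

/-- A node with a tail replica at time `t` has a base replica at that time or keeps a copy. -/
theorem GridSeq.tail_subset (h : GridSeq n r) {j a t : ℕ} (hab : (a, t) ∈ (sqSeq τ r j).tail) :
    (a, t) ∈ (sqSeq τ r j).base ∨ a ∈ kept τ δ n (sqSeq τ r j) t := by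
  obtain ⟨i, h1, h2, h3, h4⟩ := (sqSeq_tail τ r j a t).1 hab
  rcases h3.eq_or_lt with h3 | h3
  · refine Or.inl ((sqSeq_base τ r j a t).2 ⟨i, h1, h3.symm, h2.ge, ?_⟩)
    rw [h2]
    exact (squareRun τ r h.mono).u_le i
  · obtain ⟨t', rfl⟩ : ∃ t', t = t' + 1 := ⟨t - 1, by omega⟩
    refine Or.inr ((kept_succ_spec τ (h.node_lt τ j) t').1 (Finset.mem_union_right _ ?_))
    exact mem_nodesAt.2 ((sqSeq_tail τ r j a t').2 ⟨i, h1, h2, by omega, by omega⟩)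

/-- Copies are only kept where there were copies or a delivery route just before. -/
theorem GridSeq.kept_succ_subset (h : GridSeq n r) {j a t : ℕ}
    (ha : a ∈ kept τ δ n (sqSeq τ r j) (t + 1)) :
    a ∈ kept τ δ n (sqSeq τ r j) t ∨
      ((a, t) ∈ (lineSeq τ δ n r j).routes ∧ t ≤ (sqSeq τ r j).time) := by
  have key : (a, t) ∈ (sqSeq τ r j).base → a ∈ kept τ δ n (sqSeq τ r j) t ∨
      ((a, t) ∈ (lineSeq τ δ n r j).routes ∧ t ≤ (sqSeq τ r j).time) := by
    intro hb
    refine Or.inr ⟨h.base_subset_routes τ δ hb, ?_⟩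
    obtain ⟨i, h1, h2, -⟩ := (sqSeq_base τ r j a t).1 hb
    obtain ⟨j', rfl⟩ : ∃ j', j = j' + 1 := ⟨j - 1, by omega⟩
    rw [h2, sqSeq_time_succ]
    exact h.mono (Nat.lt_succ_iff.1 h1)
  have h2 := (kept_succ_spec τ (h.node_lt τ j) t).2.1 ha
  rw [Finset.mem_union, Finset.mem_union, Finset.mem_union, Finset.mem_singleton, mem_nodesAt,
    mem_nodesAt] at h2
  rcases h2 with (rfl | h2) | h2 | h2
  · exact Or.inl (h.zero_mem_kept τ δ j t)
  · rcases h.tail_subset τ δ h2 with h3 | h3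
    · exact key h3
    · exact Or.inl h3
  · exact key h2
  · exact Or.inl h2

end Line

/-! ### Feasibility of the algorithm in the strip -/

section Strip

variable (τ : TieBreak) {n : ℕ} {p : ℕ → Point}

theorem gridSeq_of_stripSeq (hn : 0 < n) (hp : StripSeq n p) :
    GridSeq n (fun i => gridPoint n (p i)) where
  lt i := by
    have : min ⌊(p i).1⌋₊ (n - 1) ≤ n - 1 := min_le_right _ _
    simp only [gridPoint]
    omega
  mono i j hij := Nat.ceil_mono (hp.mono hij)

/-- The height of the request before the request `m`. -/
def prevY (p : ℕ → Point) : ℕ → ℝ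
  | 0 => 0
  | m + 1 => (p m).2

theorem lastY_pre (p : ℕ → Point) (m : ℕ) : lastY (pre p m) = prevY p m := by
  cases m with
  | zero => simp [pre, lastY, prevY]
  | succ m => rw [pre_succ, lastY_snoc]; rfl

variable (n p) in
/-- The state of the pseudo online algorithm before the request `p m`. -/
noncomputable abbrev stateAt (m : ℕ) : SquareState := sqSeq τ (fun i => gridPoint n (p i)) m

variable (n p) in
/-- The copies at time `t`, according to the state before the request `p m`. -/
noncomputable abbrev keptAt (m t : ℕ) : Finset ℕ := kept τ (gridDelta n) n (stateAt τ n p m) t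

variable (n p) in
/-- The source of the delivery route of the request `p m`. -/
noncomputable abbrev srcOf (m : ℕ) : ℕ :=
  srcAt τ (gridDelta n) n (fun i => gridPoint n (p i)) m

variable (n p) in
/-- The delivery routes before the request `p m`. -/
noncomputable abbrev routesAt (m : ℕ) : Finset (ℕ × ℕ) :=
  (lineSeq τ (gridDelta n) n (fun i => gridPoint n (p i)) m).routes

theorem serveGrid_pre (m : ℕ) : serveGrid τ n (pre p m) (p m) =
    ((List.range' (stateAt τ n p m).time
        ((gridPoint n (p m)).2 - (stateAt τ n p m).time)).flatMap (fun t =>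
      (keptAt τ n p m (t + 1)).toList.map (fun v => Seg.vert (v : ℕ) (t : ℕ) (t + 1))))
    ++ [Seg.horiz (p m).2 (srcOf τ n p m) (gridPoint n (p m)).1,
        Seg.horiz (p m).2 (gridPoint n (p m)).1 (p m).1]
    ++ (Finset.Icc (srcOf τ n p m) (gridPoint n (p m)).1).toList.map
      (fun k => Seg.vert (k : ℕ) (p m).2 (gridPoint n (p m)).2) := by
  have h : (pre p m).map (gridPoint n) = (List.range m).map (fun i => gridPoint n (p i)) := by
    simp [pre, Function.comp_def]
  have hcast : ∀ l : List ℕ, (do let a ← l; pure (a : ℝ)) = l.map (fun a : ℕ => (a : ℝ)) :=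
    fun l => List.map_eq_flatMap.symm
  unfold serveGrid
  dsimp only
  rw [h, lineRun_eq, lineSeq_sq]
  simp only [hcast, List.map_map]
  rfl

theorem mem_serveGrid_pre {m : ℕ} {s : Seg} : s ∈ serveGrid τ n (pre p m) (p m) ↔
    (∃ t, (stateAt τ n p m).time ≤ t ∧ t < (gridPoint n (p m)).2 ∧
      ∃ v ∈ keptAt τ n p m (t + 1), s = Seg.vert (v : ℕ) (t : ℕ) (t + 1)) ∨
    s = Seg.horiz (p m).2 (srcOf τ n p m) (gridPoint n (p m)).1 ∨
    s = Seg.horiz (p m).2 (gridPoint n (p m)).1 (p m).1 ∨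
    ∃ k, srcOf τ n p m ≤ k ∧ k ≤ (gridPoint n (p m)).1 ∧
      s = Seg.vert (k : ℕ) (p m).2 (gridPoint n (p m)).2 := by
  rw [serveGrid_pre]
  simp only [List.mem_append, List.mem_flatMap, List.mem_range'_1, List.mem_map, Finset.mem_toList,
    List.mem_cons, List.not_mem_nil, or_false, Finset.mem_Icc]
  constructor
  · rintro ((⟨t, ⟨h1, h2⟩, v, hv, rfl⟩ | h | h) | ⟨k, ⟨h1, h2⟩, rfl⟩)
    · exact Or.inl ⟨t, h1, by omega, v, hv, rfl⟩
    · exact Or.inr (Or.inl h)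
    · exact Or.inr (Or.inr (Or.inl h))
    · exact Or.inr (Or.inr (Or.inr ⟨k, h1, h2, rfl⟩))
  · rintro (⟨t, h1, h2, v, hv, rfl⟩ | h | h | ⟨k, h1, h2, rfl⟩)
    · exact Or.inl (Or.inl ⟨t, ⟨h1, by omega⟩, v, hv, rfl⟩)
    · exact Or.inl (Or.inr (Or.inl h))
    · exact Or.inl (Or.inr (Or.inr h))
    · exact Or.inr ⟨k, ⟨h1, h2⟩, rfl⟩

theorem prevY_le_time (m : ℕ) : prevY p m ≤ (stateAt τ n p m).time := by
  cases m with
  | zero => simp [prevY, sqSeq_time_zero]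
  | succ m => exact Nat.le_ceil _

theorem prevY_le (hp : StripSeq n p) (m : ℕ) : prevY p m ≤ (p m).2 := by
  cases m with
  | zero => exact hp.zero_le
  | succ m => exact hp.mono (Nat.le_succ m)

theorem StripSeq.snd_nonneg {M : ℝ} (hp : StripSeq M p) (i : ℕ) : 0 ≤ (p i).2 :=
  hp.zero_le.trans (hp.mono (Nat.zero_le i))

/-- The segments that are added for a request lie at or above the height of the previous one. -/
theorem le_of_mem_serveGrid (hp : StripSeq n p) (m : ℕ) {s : Seg}
    (hs : s ∈ serveGrid τ n (pre p m) (p m)) {z : Point} (hz : z ∈ s.carrier) :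
    prevY p m ≤ z.2 := by
  have h1 := prevY_le_time τ (n := n) (p := p) m
  have h2 := prevY_le hp m
  rcases (mem_serveGrid_pre τ).1 hs with ⟨t, ht, -, v, -, rfl⟩ | rfl | rfl | ⟨k, -, -, rfl⟩
  · obtain ⟨-, h3⟩ := hz
    rw [uIcc_of_le (by linarith)] at h3
    have : ((stateAt τ n p m).time : ℝ) ≤ t := by exact_mod_cast ht
    linarith [h3.1]
  · rw [hz.2]; exact h2
  · rw [hz.2]; exact h2
  · obtain ⟨-, h3⟩ := hz
    have : (p m).2 ≤ ((gridPoint n (p m)).2 : ℝ) := Nat.le_ceil _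
    rw [uIcc_of_le this] at h3
    exact h2.trans h3.1

/-- The solution contains paths to the requests, and at every moment to all nodes that have a copy
according to the algorithm on the grid. -/
theorem serveGrid_invariant (hn : 0 < n) (hp : StripSeq n p) (m : ℕ) :
    Feasible (run (serveGrid τ n) (pre p m)) (pre p m) ∧
    ∀ w, (w ∈ keptAt τ n p m (stateAt τ n p m).time ∨
        (w, (stateAt τ n p m).time) ∈ routesAt τ n p m) →
      ∀ y : ℝ, prevY p m ≤ y → y ≤ (stateAt τ n p m).time →
        Reach (run (serveGrid τ n) (pre p m)) ((w : ℕ), y) := by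
  have hg := gridSeq_of_stripSeq hn hp
  induction m with
  | zero =>
    refine ⟨by simp [Feasible, pre], ?_⟩
    intro w hw y hy1 hy2
    have hy : y = 0 := le_antisymm (by simpa [sqSeq_time_zero] using hy2) hy1
    have hw0 : w = 0 := by
      rcases hw with hw | hw
      · simpa [kept, sqSeq_time_zero] using hw
      · change (w, _) ∈ (∅ : Finset (ℕ × ℕ)) at hw
        simp at hw
    subst hy hw0
    unfold Reach
    norm_num
    exact Relation.ReflTransGen.refl
  | succ m ih =>
    obtain ⟨ih1, ih2⟩ := ih
    rw [pre_succ, run_snoc]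
    set F := run (serveGrid τ n) (pre p m) with hF
    set S := serveGrid τ n (pre p m) (p m) with hS
    set T := (stateAt τ n p m).time with hT
    have hT' : (stateAt τ n p (m + 1)).time = (gridPoint n (p m)).2 := rfl
    set t' := (gridPoint n (p m)).2 with ht'
    set v := (gridPoint n (p m)).1 with hv
    set u := srcOf τ n p m with hu
    have hTt : T ≤ t' := sqSeq_time_le τ _ hg.mono m
    have hyt : (p m).2 ≤ (t' : ℝ) := Nat.le_ceil _
    have hty : ∀ t : ℕ, t < t' → (t : ℝ) < (p m).2 := fun t ht => Nat.lt_ceil.1 ht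
    have hpy := prevY_le hp m
    have hpT := prevY_le_time τ (n := n) (p := p) m
    have hsub : F ⊆ F ++ S := List.subset_append_left _ _
    have hvert : ∀ t, T ≤ t → t < t' → ∀ w ∈ keptAt τ n p m (t + 1),
        Seg.vert (w : ℕ) (t : ℕ) (t + 1) ∈ F ++ S := fun t h1 h2 w hw =>
      List.mem_append_right _ ((mem_serveGrid_pre τ).2 (Or.inl ⟨t, h1, h2, w, hw, rfl⟩))
    -- the copies of the storage phases are connected
    have hkept : ∀ t, T ≤ t → t ≤ t' → ∀ w ∈ keptAt τ n p m t, Reach (F ++ S) ((w : ℕ), (t : ℕ)) := by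
      intro t ht
      induction t, ht using Nat.le_induction with
      | base =>
        intro _ w hw
        exact (ih2 w (Or.inl hw) _ hpT le_rfl).mono hsub
      | succ t ht iht =>
        intro htt w hw
        have hseg := hvert t ht (by omega) w hw
        have hreach : Reach (F ++ S) ((w : ℕ), (t : ℕ)) := by
          rcases hg.kept_succ_subset τ _ hw with h | ⟨h, hle⟩
          · exact iht (by omega) w h
          · have : t = T := le_antisymm hle ht
            subst this
            exact (ih2 w (Or.inr h) _ hpT le_rfl).mono hsub
        push_cast
        exact hreach.vert hseg le_rfl (by linarith) le_rfl
    -- the nodes with a copy at the delivery are connected from the height of the request on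
    have havail : ∀ w, (w ∈ keptAt τ n p m t' ∨ (w, t') ∈ routesAt τ n p m) →
        ∀ y : ℝ, (p m).2 ≤ y → y ≤ t' → Reach (F ++ S) ((w : ℕ), y) := by
      intro w hw y hy1 hy2
      rcases hTt.eq_or_lt with hTt | hTt
      · exact (ih2 w (by rw [hTt]; exact hw) y (hpy.trans hy1) (by rw [hTt]; exact hy2)).mono hsub
      · have hw' : w ∈ keptAt τ n p m t' := by
          refine hw.resolve_right fun h => ?_
          obtain ⟨i, hi, h2, -⟩ := (lineSeq_routes τ _ n _ m w t').1 h
          obtain ⟨m', rfl⟩ : ∃ m', m = m' + 1 := ⟨m - 1, by omega⟩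
          have := hg.mono (Nat.lt_succ_iff.1 hi)
          rw [hT, sqSeq_time_succ] at hTt
          simp only at this hTt
          omega
        obtain ⟨t, ht⟩ : ∃ t, t' = t + 1 := ⟨t' - 1, by omega⟩
        rw [ht] at hw'
        have hseg := hvert t (by omega) (by omega) w hw'
        have htp := hty t (by omega)
        have htc : (t' : ℝ) = t + 1 := by rw [ht]; push_cast; ring
        have hreach : Reach (F ++ S) ((w : ℕ), (t : ℕ)) := by
          rcases hg.kept_succ_subset τ _ hw' with h | ⟨h, hle⟩
          · exact hkept t (by omega) (by omega) w h
          · have : t = T := le_antisymm hle (by omega)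
            subst this
            exact (ih2 w (Or.inr h) _ hpT le_rfl).mono hsub
        exact hreach.vert hseg le_rfl (by linarith) (by linarith)
    obtain ⟨hu1, hu2⟩ := hg.srcAt_mem τ (gridDelta n) m
    have huv : u ≤ v := hu2.trans ((squareRun τ _ hg.mono).u_le m)
    have hu3 : u ∈ keptAt τ n p m t' ∨ (u, t') ∈ routesAt τ n p m := by
      rcases Finset.mem_union.1 hu1 with h | h
      · exact Or.inl h
      · exact Or.inr (mem_nodesAt.1 h)
    have hroute : ∀ k : ℕ, u ≤ k → k ≤ v → Reach (F ++ S) ((k : ℕ), (p m).2) := by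
      intro k h1 h2
      refine (havail u hu3 _ le_rfl hyt).horiz (a := u) (b := v)
        (List.mem_append_right _ ((mem_serveGrid_pre τ).2 (Or.inr (Or.inl rfl)))) le_rfl ?_ ?_
      · exact_mod_cast h1
      · exact_mod_cast h2
    have hvx : (v : ℝ) ≤ (p m).1 := by
      have h1 : v ≤ ⌊(p m).1⌋₊ := min_le_left _ _
      calc (v : ℝ) ≤ (⌊(p m).1⌋₊ : ℝ) := by exact_mod_cast h1
        _ ≤ (p m).1 := Nat.floor_le (hp.nonneg m)
    have hpm : Reach (F ++ S) (p m) :=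
      (hroute v huv le_rfl).horiz (d := (p m).1) (a := v) (b := (p m).1)
        (List.mem_append_right _ ((mem_serveGrid_pre τ).2 (Or.inr (Or.inr (Or.inl rfl))))) le_rfl
        hvx le_rfl
    constructor
    · intro q hq
      rcases List.mem_append.1 hq with hq | hq
      · exact (ih1.mono hsub) q hq
      · rw [List.mem_singleton.1 hq]
        exact hpm
    · intro w hw y hy1 hy2
      rw [hT'] at hw hy2
      have hstab : keptAt τ n p (m + 1) t' = keptAt τ n p m t' :=
        (hg.kept_stable τ (gridDelta n) (Nat.le_succ m) le_rfl).symm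
      rw [hstab] at hw
      have hold : (w ∈ keptAt τ n p m t' ∨ (w, t') ∈ routesAt τ n p m) ∨ (u ≤ w ∧ w ≤ v) := by
        rcases hw with hw | hw
        · exact Or.inl (Or.inl hw)
        · obtain ⟨i, hi, h2, h3, h4⟩ := (lineSeq_routes τ _ n _ (m + 1) w t').1 hw
          rcases Nat.lt_succ_iff_lt_or_eq.1 hi with hi | rfl
          · exact Or.inl (Or.inr ((lineSeq_routes τ _ n _ m w t').2 ⟨i, hi, h2, h3, h4⟩))
          · exact Or.inr ⟨h3, h4⟩
      rcases hold with h | ⟨h1, h2⟩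
      · exact havail w h y hy1 hy2
      · exact (hroute w h1 h2).vert (a := (p m).2) (b := t')
          (List.mem_append_right _
            ((mem_serveGrid_pre τ).2 (Or.inr (Or.inr (Or.inr ⟨w, h1, h2, rfl⟩))))) le_rfl hy1 hy2

/-- The algorithm in the strip solves the online problem, and it always has a path up the `y`-axis to
the height of the last request. -/
theorem serveGrid_spec (hn : 0 < n) (h : List Point) (q : Point) (hQ : ValidRequests (h ++ [q]))
    (hx : ∀ a ∈ h ++ [q], a.1 ≤ n) :
    (∀ s ∈ serveGrid τ n h q, ∀ z ∈ s.carrier, lastY h ≤ z.2) ∧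
    Feasible (run (serveGrid τ n) (h ++ [q])) (h ++ [q]) ∧
    Reach (run (serveGrid τ n) (h ++ [q])) (0, q.2) := by
  obtain ⟨p, hp, hpQ⟩ := exists_stripSeq (Nat.cast_nonneg n) hQ hx
  rw [List.length_append, List.length_singleton, pre_succ] at hpQ
  obtain ⟨h1, h2⟩ := List.append_inj' hpQ rfl
  rw [List.singleton_inj] at h2
  set m := h.length
  rw [← h1, ← h2]
  refine ⟨fun s hs z hz => ?_, ?_, ?_⟩
  · rw [lastY_pre]
    exact le_of_mem_serveGrid τ hp m hs hz
  · rw [← pre_succ]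
    exact (serveGrid_invariant τ hn hp (m + 1)).1
  · rw [← pre_succ]
    have := (serveGrid_invariant τ hn hp (m + 1)).2 0
      (Or.inl ((gridSeq_of_stripSeq hn hp).zero_mem_kept τ _ _ _)) (p m).2 le_rfl
      (prevY_le_time τ (n := n) (p := p) (m + 1))
    simpa using this

end Strip

/-! ### The cost of the algorithm in the strip -/

section Count

variable (τ : TieBreak) {δ n : ℕ} {r : ℕ → ℕ × ℕ}

/-- The delivery routes exceed the base rows by at most `10 * δ` times the radius: the serving replica
makes the serving node stay-active at the level on which the intervals are just longer
than five radii, so that there is a copy in its neighborhood. -/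
theorem GridSeq.nodeAt_le_srcAt (h : GridSeq n r) (hδ : 1 < δ) (i : ℕ) :
    nodeAt τ r i ≤ srcAt τ δ n r i + 10 * δ * radAt τ r i := by
  have H := squareRun τ r h.mono
  set u := nodeAt τ r i with hu
  set ρ := radAt τ r i with hρ
  have hun : u < n := (H.u_le i).trans_lt (h.lt i)
  have avail_case : u ∈ availAt τ δ n r i → u ≤ srcAt τ δ n r i + 10 * δ * ρ := fun hm =>
    (le_srcAt τ δ n hm le_rfl).trans (Nat.le_add_right _ _)
  have h0 : 0 ∈ availAt τ δ n r i := Finset.mem_union_left _ (h.zero_mem_kept τ δ i _)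
  rcases Nat.eq_zero_or_pos u with hu0 | hu0
  · omega
  -- a base or tail replica of `u` during the last `5 * ρ` time units
  obtain ⟨b, hb, hb1, hb2⟩ : ∃ b, ((u, b) ∈ (sqSeq τ r i).base ∨ (u, b) ∈ (sqSeq τ r i).tail) ∧
      b ≤ (r i).2 ∧ (r i).2 ≤ b + 5 * ρ := by
    have hs1 := H.s_le i
    have hs2 := H.le_s i
    rcases (H.mem_iff _ _ _).1 (H.serve i) with ⟨h1, -⟩ | ⟨k, hk, ⟨h1, h2, h3⟩ | ⟨h1, h2, h3⟩⟩
    · omega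
    · have hm := H.mono hk.le
      rcases le_or_gt (copyAt τ r i) (r k).2 with hle | hlt
      · refine ⟨(r k).2, Or.inl ((sqSeq_base τ r i u _).2 ⟨k, hk, rfl, h1.ge, ?_⟩), hm, ?_⟩
        · rw [hu, h1]
          exact H.u_le k
        · omega
      · exact ⟨copyAt τ r i, Or.inr ((sqSeq_tail τ r i u _).2 ⟨k, hk, h1, hlt.le, h3⟩), hs1, hs2⟩
    · exact ⟨copyAt τ r i, Or.inl ((sqSeq_base τ r i u _).2 ⟨k, hk, h1, h2, h3⟩), hs1, hs2⟩
  rcases hb1.eq_or_lt with rfl | hlt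
  · refine avail_case ?_
    have hbase : (u, (r i).2) ∈ (sqSeq τ r i).base → u ∈ availAt τ δ n r i := fun hbb =>
      Finset.mem_union_right _ (mem_nodesAt.2 (h.base_subset_routes τ δ hbb))
    rcases hb with hb | hb
    · exact hbase hb
    · rcases h.tail_subset τ δ hb with hb | hb
      · exact hbase hb
      · exact Finset.mem_union_left _ hb
  · have hρ0 : 1 < 5 * ρ := by omega
    have hc1 := Nat.le_pow_clog hδ (5 * ρ)
    have hc2 := Nat.pow_pred_clog_lt_self hδ hρ0
    set l := Nat.clog δ (5 * ρ) with hl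
    have hl0 : 0 < l := Nat.clog_pos hδ hρ0
    have hpow : δ ^ l ≤ 5 * δ * ρ := by
      obtain ⟨k, hk⟩ : ∃ k, l = k + 1 := ⟨l - 1, by omega⟩
      rw [hk] at hc2 ⊢
      rw [Nat.pred_succ] at hc2
      calc δ ^ (k + 1) = δ ^ k * δ := pow_succ _ _
        _ ≤ 5 * ρ * δ := Nat.mul_le_mul_right _ hc2.le
        _ = 5 * δ * ρ := by ring
    have h10 : 10 * δ * ρ = 2 * (5 * δ * ρ) := by ring
    rcases lt_or_ge l (Nat.log δ n + 1) with hll | hll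
    · obtain ⟨t, ht⟩ : ∃ t, (r i).2 = t + 1 := ⟨(r i).2 - 1, by omega⟩
      have hact : StayActive δ l (sqSeq τ r i) u t :=
        stayActive_iff.2 ⟨b, hb, by omega, by omega⟩
      obtain ⟨w, hw⟩ := (kept_succ_spec τ (h.node_lt τ i) t).2.2.1 l hll u hun hact
      obtain ⟨hw1, hw2⟩ := Finset.mem_inter.1 hw
      obtain ⟨hw3, hw4⟩ := mem_nbhd.1 hw2
      have hw5 : w ∈ availAt τ δ n r i := by
        refine Finset.mem_union_left _ ?_
        rw [ht]
        exact hw1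
      have hw6 := le_srcAt τ δ n hw5 hw3
      have hd : 0 < δ ^ l := pow_pos (by omega) l
      have e1 := Nat.lt_mul_div_succ u hd
      have e2 := Nat.mul_div_le w (δ ^ l)
      have e3 : δ ^ l * (u / δ ^ l + 1) ≤ δ ^ l * (w / δ ^ l + 2) :=
        Nat.mul_le_mul_left _ (by omega)
      have e4 : δ ^ l * (w / δ ^ l + 2) = δ ^ l * (w / δ ^ l) + 2 * δ ^ l := by ring
      omega
    · have e1 := Nat.lt_pow_succ_log_self hδ n
      have e2 : δ ^ (Nat.log δ n).succ ≤ δ ^ l := Nat.pow_le_pow_right (by omega) hll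
      omega

theorem GridSeq.predClosed (h : GridSeq n r) (j : ℕ) : PredClosed (sqSeq τ r j).sol := by
  have H := squareRun τ r h.mono
  have hmem := sqSeq_sol τ r h.mono
  induction j with
  | zero =>
    intro a b hab
    exact Or.inl (by simpa [sqSeq, squareInit] using hab)
  | succ j ih =>
    have hsol : PredClosed (solAt τ r j) := by
      intro a b hab
      rcases Finset.mem_union.1 hab with hab | hab
      · rcases ih a b hab with h1 | ⟨a', h1, h2⟩ | ⟨b', h1, h2⟩
        · exact Or.inl h1
        · exact Or.inr (Or.inl ⟨a', h1, Finset.mem_union_left _ h2⟩)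
        · exact Or.inr (Or.inr ⟨b', h1, Finset.mem_union_left _ h2⟩)
      · obtain ⟨rfl, h1, h2⟩ := mem_col.1 hab
        rcases Nat.eq_zero_or_pos b with rfl | hb
        · exact Or.inl ⟨rfl, rfl⟩
        · exact Or.inr (Or.inr ⟨b - 1, by omega, H.zero_mem (by omega)⟩)
    have hsub : solAt τ r j ⊆ (sqSeq τ r (j + 1)).sol := by
      intro q hq
      rw [sqSeq_succ]
      exact Finset.mem_union_left _ (Finset.mem_union_left _ (Finset.mem_union_left _ hq))
    -- the parts of the new path are traversed from the serving replica on
    have hcol : ∀ b, copyAt τ r j ≤ b → b ≤ (r j).2 + 4 * radAt τ r j →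
        (nodeAt τ r j, b) ∈ (sqSeq τ r (j + 1)).sol := fun b h1 h2 =>
      (hmem _ _ _).2 (Or.inr ⟨j, Nat.lt_succ_self j, Or.inl ⟨rfl, h1, h2⟩⟩)
    have hrow : ∀ a, nodeAt τ r j ≤ a → a ≤ (r j).1 →
        (a, (r j).2) ∈ (sqSeq τ r (j + 1)).sol := fun a h1 h2 =>
      (hmem _ _ _).2 (Or.inr ⟨j, Nat.lt_succ_self j, Or.inr ⟨rfl, h1, h2⟩⟩)
    have old : ∀ a b, (a, b) ∈ solAt τ r j → (a = 0 ∧ b = 0) ∨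
        (∃ a', a = a' + 1 ∧ (a', b) ∈ (sqSeq τ r (j + 1)).sol) ∨
        ∃ b', b = b' + 1 ∧ (a, b') ∈ (sqSeq τ r (j + 1)).sol := by
      intro a b hab
      rcases hsol a b hab with h1 | ⟨a', h1, h2⟩ | ⟨b', h1, h2⟩
      · exact Or.inl h1
      · exact Or.inr (Or.inl ⟨a', h1, hsub h2⟩)
      · exact Or.inr (Or.inr ⟨b', h1, hsub h2⟩)
    have hnode : ∀ b, copyAt τ r j ≤ b → b ≤ (r j).2 + 4 * radAt τ r j →
        (nodeAt τ r j = 0 ∧ b = 0) ∨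
        (∃ a', nodeAt τ r j = a' + 1 ∧ (a', b) ∈ (sqSeq τ r (j + 1)).sol) ∨
        ∃ b', b = b' + 1 ∧ (nodeAt τ r j, b') ∈ (sqSeq τ r (j + 1)).sol := by
      intro b h1 h2
      rcases h1.eq_or_lt with rfl | h1
      · exact old _ _ (H.serve j)
      · exact Or.inr (Or.inr ⟨b - 1, by omega, hcol _ (by omega) (by omega)⟩)
    intro a b hab
    have hsj := H.s_le j
    rw [sqSeq_succ] at hab
    simp only [Finset.mem_union, mem_col, mem_row] at hab
    rcases hab with ((hab | ⟨rfl, h1, h2⟩) | ⟨rfl, h1, h2⟩) | ⟨rfl, h1, h2⟩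
    · exact old a b hab
    · exact hnode b h1 (by omega)
    · rcases h1.eq_or_lt with rfl | h1
      · exact hnode _ hsj (by omega)
      · exact Or.inr (Or.inl ⟨a - 1, by omega, hrow _ (by omega) (by omega)⟩)
    · exact hnode b (by omega) h2

theorem card_col (v s t : ℕ) : (col v s t).card = t + 1 - s := by simp [col]

theorem card_row (u v t : ℕ) : (row u v t).card = v + 1 - u := by simp [row]

theorem GridSeq.card_tail_le (m : ℕ) :
    (sqSeq τ r m).tail.card ≤ ∑ i ∈ Finset.range m, (4 * radAt τ r i + 1) := by
  induction m with
  | zero => simp [sqSeq, squareInit]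
  | succ m ih =>
    rw [sqSeq_succ, Finset.sum_range_succ]
    refine (Finset.card_union_le _ _).trans ?_
    rw [card_col]
    omega

theorem GridSeq.card_sol_le (h : GridSeq n r) (m : ℕ) : (sqSeq τ r m).sol.card ≤
    1 + (sqSeq τ r m).time + ∑ i ∈ Finset.range m, (14 * radAt τ r i + 4) := by
  have H := squareRun τ r h.mono
  induction m with
  | zero => simp [sqSeq, squareInit]
  | succ m ih =>
    have h1 := sqSeq_time_le τ r h.mono m
    have h2 := H.s_le m
    have h3 := H.le_s m
    have h4 := H.u_le m
    have h5 := H.le_u m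
    rw [Finset.sum_range_succ, sqSeq_time_succ, sqSeq_succ]
    simp only
    have c1 := Finset.card_union_le (solAt τ r m ∪ col (nodeAt τ r m) (copyAt τ r m) (r m).2 ∪
        row (nodeAt τ r m) (r m).1 (r m).2)
      (col (nodeAt τ r m) (r m).2 ((r m).2 + 4 * radAt τ r m))
    have c2 := Finset.card_union_le (solAt τ r m ∪ col (nodeAt τ r m) (copyAt τ r m) (r m).2)
      (row (nodeAt τ r m) (r m).1 (r m).2)
    have c3 := Finset.card_union_le (solAt τ r m) (col (nodeAt τ r m) (copyAt τ r m) (r m).2)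
    have c4 : (solAt τ r m).card ≤ _ :=
      Finset.card_union_le (sqSeq τ r m).sol (col 0 (sqSeq τ r m).time (r m).2)
    rw [card_col] at c1 c3 c4
    rw [card_row] at c2
    omega

end Count

theorem cost_flatMap {α : Type*} (l : List α) (f : α → List Seg) :
    cost (l.flatMap f) = (l.map fun a => cost (f a)).sum := by
  induction l with
  | nil => simp [cost]
  | cons a l ih => rw [List.flatMap_cons, cost_append, ih, List.map_cons, List.sum_cons]

section StripCost

variable (τ : TieBreak) {n : ℕ} {p : ℕ → Point}

theorem cost_serveGrid_le (hn : 0 < n) (hp : StripSeq n p) (m : ℕ) :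
    cost (serveGrid τ n (pre p m) (p m)) ≤
      ∑ t ∈ Finset.Ico (stateAt τ n p m).time (gridPoint n (p m)).2,
        ((keptAt τ n p m (t + 1)).card : ℝ) +
      (2 * ((gridPoint n (p m)).1 - srcOf τ n p m : ℕ) + 2) := by
  have hg := gridSeq_of_stripSeq hn hp
  have huv : srcOf τ n p m ≤ (gridPoint n (p m)).1 :=
    (hg.srcAt_mem τ (gridDelta n) m).2.trans ((squareRun τ _ hg.mono).u_le m)
  set u := srcOf τ n p m with hu
  have h0 := hp.nonneg m
  have h1 := hp.le m
  have hy0 := hp.snd_nonneg m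
  have hvx : ((gridPoint n (p m)).1 : ℝ) ≤ (p m).1 := by
    have h2 : (gridPoint n (p m)).1 ≤ ⌊(p m).1⌋₊ := min_le_left _ _
    exact (Nat.cast_le.2 h2).trans (Nat.floor_le h0)
  have hxv : (p m).1 ≤ (gridPoint n (p m)).1 + 1 := by
    have h2 := Nat.lt_floor_add_one (p m).1
    have h3 : (gridPoint n (p m)).1 = min ⌊(p m).1⌋₊ (n - 1) := rfl
    rcases min_choice ⌊(p m).1⌋₊ (n - 1) with h4 | h4
    · rw [h3, h4]; exact h2.le
    · rw [h3, h4, Nat.cast_sub hn]; push_cast; linarith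
  have hyt : (p m).2 ≤ ((gridPoint n (p m)).2 : ℝ) := Nat.le_ceil _
  have hty : ((gridPoint n (p m)).2 : ℝ) < (p m).2 + 1 := Nat.ceil_lt_add_one hy0
  rw [serveGrid_pre, cost_append, cost_append, cost_flatMap]
  set v := (gridPoint n (p m)).1 with hv
  set t' := (gridPoint n (p m)).2 with ht'
  have c1 : ((List.range' (stateAt τ n p m).time (t' - (stateAt τ n p m).time)).map fun t =>
      cost ((keptAt τ n p m (t + 1)).toList.map
        (fun v => Seg.vert (v : ℕ) (t : ℕ) (t + 1)))).sum =
      ∑ t ∈ Finset.Ico (stateAt τ n p m).time t', ((keptAt τ n p m (t + 1)).card : ℝ) := by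
    have : ∀ t : ℕ, cost ((keptAt τ n p m (t + 1)).toList.map
        (fun v => Seg.vert (v : ℕ) (t : ℕ) (t + 1))) = ((keptAt τ n p m (t + 1)).card : ℝ) := by
      intro t
      simp [cost, Function.comp_def, Seg.length]
    simp only [this]
    rfl
  have c2 : cost [Seg.horiz (p m).2 u v, Seg.horiz (p m).2 v (p m).1] ≤ (v - u : ℕ) + 1 := by
    simp only [cost, List.map_cons, List.map_nil, List.sum_cons, List.sum_nil, Seg.length,
      add_zero]
    have huv' : (u : ℝ) ≤ v := Nat.cast_le.2 huv
    rw [abs_of_nonneg (sub_nonneg.2 huv'), abs_of_nonneg (sub_nonneg.2 hvx), Nat.cast_sub huv]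
    linarith
  have c3 : cost ((Finset.Icc u v).toList.map (fun k => Seg.vert (k : ℕ) (p m).2 t')) ≤
      (v - u : ℕ) + 1 := by
    have e1 : cost ((Finset.Icc u v).toList.map (fun k => Seg.vert (k : ℕ) (p m).2 t')) =
        ((v + 1 - u : ℕ) : ℝ) * |(t' : ℝ) - (p m).2| := by
      simp [cost, Function.comp_def, Seg.length]
    have e2 : ((v + 1 - u : ℕ) : ℝ) = (v - u : ℕ) + 1 := by
      rw [Nat.sub_add_comm huv]
      push_cast
      ring
    rw [e1, e2, abs_of_nonneg (by linarith)]
    have e3 : (0 : ℝ) ≤ ((v - u : ℕ) : ℝ) + 1 := by positivity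
    calc (((v - u : ℕ) : ℝ) + 1) * ((t' : ℝ) - (p m).2) ≤ (((v - u : ℕ) : ℝ) + 1) * 1 :=
          mul_le_mul_of_nonneg_left (by linarith) e3
      _ = _ := by ring
  rw [c1]
  linarith

theorem cost_run_serveGrid_le (hn : 0 < n) (hp : StripSeq n p) (m : ℕ) :
    cost (run (serveGrid τ n) (pre p m)) ≤
      ∑ t ∈ Finset.range (stateAt τ n p m).time, ((keptAt τ n p m (t + 1)).card : ℝ) +
      ∑ i ∈ Finset.range m, (2 * (((gridPoint n (p i)).1 - srcOf τ n p i : ℕ) : ℝ) + 2) := by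
  have hg := gridSeq_of_stripSeq hn hp
  induction m with
  | zero => simp [pre, run, runFrom, cost, sqSeq_time_zero]
  | succ m ih =>
    have h1 : (stateAt τ n p m).time ≤ (gridPoint n (p m)).2 := sqSeq_time_le τ _ hg.mono m
    have h2 : (stateAt τ n p (m + 1)).time = (gridPoint n (p m)).2 := rfl
    have h3 : ∑ t ∈ Finset.range (gridPoint n (p m)).2, ((keptAt τ n p (m + 1) (t + 1)).card : ℝ) =
        ∑ t ∈ Finset.range (gridPoint n (p m)).2, ((keptAt τ n p m (t + 1)).card : ℝ) := by
      refine Finset.sum_congr rfl fun t ht => ?_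
      have := hg.kept_stable τ (gridDelta n) (Nat.le_succ m) (t := t + 1) (Finset.mem_range.1 ht)
      simp only [keptAt, stateAt]
      rw [this]
    have h4 := cost_serveGrid_le τ hn hp m
    rw [pre_succ, run_snoc, cost_append, Finset.sum_range_succ, h2, h3,
      ← Finset.sum_range_add_sum_Ico _ h1]
    linarith

/-! ### The radii and the cost of a solution -/

theorem measurable_gridPoint (n : ℕ) : Measurable (gridPoint n) := by
  unfold gridPoint
  refine Measurable.prodMk ?_ ?_
  · exact (Nat.measurable_floor.comp measurable_fst).min measurable_const
  · exact Nat.measurable_ceil.comp measurable_snd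

/-- Every solution has, for each request, length at least the radius minus one inside the square
of the request, so disjoint squares bound its cost from below. -/
theorem sum_radius_le_cost (hn : 0 < n) (hp : StripSeq n p) {m : ℕ} {F : List Seg}
    (hF : Feasible F (pre p m)) (S : Finset ℕ) (hS : ∀ i ∈ S, i < m)
    (hd : ∀ i ∈ S, ∀ k ∈ S, i ≠ k → ¬ Overlap (fun i => (gridPoint n (p i)).1)
      (fun i => (gridPoint n (p i)).2) (radAt τ fun i => gridPoint n (p i)) i k) :
    ∑ i ∈ S, ((radAt τ (fun i => gridPoint n (p i)) i : ℝ) - 1) ≤ cost F := by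
  have hg := gridSeq_of_stripSeq hn hp
  set ρ := radAt τ fun i => gridPoint n (p i) with hρ
  set A : ℕ → Set Point := fun i => gridPoint n ⁻¹' {q | InSq (fun i => (gridPoint n (p i)).1)
      (fun i => (gridPoint n (p i)).2) ρ i q.1 q.2} with hA
  have hAm : ∀ i, MeasurableSet (A i) := fun i =>
    measurable_gridPoint n (MeasurableSet.of_discrete)
  refine sum_le_cost S A _ (fun i _ => hAm i) ?_ ?_
  · intro i hi k hk hne
    rw [Function.onFun, Set.disjoint_left]
    intro z hz1 hz2
    exact hd i hi k hk hne ⟨_, _, hz1, hz2⟩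
  · intro i hi
    rcases Nat.eq_zero_or_pos (ρ i) with h0 | hpos
    · rw [h0, ENNReal.ofReal_of_nonpos (by simp)]
      exact zero_le
    obtain ⟨γ, hγ⟩ := exists_curveTo (hF (p i) (mem_pre.2 ⟨i, hS i hi, rfl⟩))
    have hx0 := hp.nonneg i
    have hy0 := hp.snd_nonneg i
    have hvx : ((gridPoint n (p i)).1 : ℝ) ≤ (p i).1 := by
      have h2 : (gridPoint n (p i)).1 ≤ ⌊(p i).1⌋₊ := min_le_left _ _
      exact (Nat.cast_le.2 h2).trans (Nat.floor_le hx0)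
    have hvn : (gridPoint n (p i)).1 < n := hg.lt i
    have hρv : ρ i ≤ (gridPoint n (p i)).1 := radAt_le τ _ hg.mono i
    have hρv' : (ρ i : ℝ) ≤ ((gridPoint n (p i)).1 : ℝ) := by exact_mod_cast hρv
    have hty : ((gridPoint n (p i)).2 : ℝ) < (p i).2 + 1 := Nat.ceil_lt_add_one hy0
    have hρ1 : (1 : ℝ) ≤ ρ i := by exact_mod_cast hpos
    have key := hγ.ofReal_le (hAm i) (a := (p i).1 + (p i).2 - (ρ i - 1)) (b := (p i).1 + (p i).2)
      (by linarith) le_rfl ?_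
    · have e : (p i).1 + (p i).2 - ((p i).1 + (p i).2 - ((ρ i : ℝ) - 1)) = ρ i - 1 := by ring
      rwa [e] at key
    · intro z hz
      have hz' : z ∈ Icc 0 ((p i).1 + (p i).2) := ⟨by linarith [hz.1], hz.2.le⟩
      have hs := hγ.sum_eq z hz'
      obtain ⟨hl1, hl2⟩ := hγ.le_end hz'
      have hz1 := hz.1
      have hxf := Nat.lt_floor_add_one (γ z).1
      have hyc := Nat.le_ceil (γ z).2
      refine ⟨⟨?_, ?_⟩, ?_, ?_⟩
      · exact min_le_min_right _ (Nat.floor_mono hl1)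
      · have h1 : (gridPoint n (p i)).1 < ⌊(γ z).1⌋₊ + ρ i := by
          have h2 : ((gridPoint n (p i)).1 : ℝ) + 1 < (⌊(γ z).1⌋₊ : ℝ) + 1 + ρ i := by linarith
          have h3 : (gridPoint n (p i)).1 + 1 < ⌊(γ z).1⌋₊ + 1 + ρ i := by exact_mod_cast h2
          omega
        change (gridPoint n (p i)).1 < min ⌊(γ z).1⌋₊ (n - 1) + ρ i
        omega
      · exact Nat.ceil_mono hl2
      · have h2 : ((gridPoint n (p i)).2 : ℝ) < (⌈(γ z).2⌉₊ : ℝ) + ρ i := by linarith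
        exact_mod_cast h2

/-- The radii of all requests add up to at most a constant times the cost of any solution, plus the
number of requests. -/
theorem sum_radii_le (hn : 0 < n) (hp : StripSeq n p) {m : ℕ} {F : List Seg}
    (hF : Feasible F (pre p m)) :
    ∑ i ∈ Finset.range m, (radAt τ (fun i => gridPoint n (p i)) i : ℝ) ≤ 3 * (cost F + m) := by
  have hg := gridSeq_of_stripSeq hn hp
  have H := squareRun τ _ hg.mono
  set r := fun i => gridPoint n (p i) with hr
  set ρ := radAt τ r with hρ
  set u := nodeAt τ r with hu
  have bound : ∀ S : Finset ℕ, S ⊆ Finset.range m →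
      (∀ i ∈ S, ∀ k ∈ S, i ≠ k → ¬ Overlap (fun i => (r i).1) (fun i => (r i).2) ρ i k) →
      ∑ i ∈ S, (ρ i : ℝ) ≤ cost F + m := by
    intro S hS hd
    have h1 := sum_radius_le_cost τ hn hp hF S (fun i hi => Finset.mem_range.1 (hS hi)) hd
    rw [Finset.sum_sub_distrib] at h1
    have h2 : S.card ≤ m := by simpa using Finset.card_le_card hS
    have h3 : (S.card : ℝ) ≤ m := by exact_mod_cast h2
    simp only [Finset.sum_const, nsmul_eq_mul, mul_one] at h1
    linarith
  have h1 := bound ((Finset.range m).filter (fun i => ¬ (r i).1 < u i + ρ i))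
    (Finset.filter_subset _ _) (by
      intro i hi k hk hne
      exact H.covered_disjoint (not_lt.1 (Finset.mem_filter.1 hi).2)
        (not_lt.1 (Finset.mem_filter.1 hk).2) hne)
  have h2 := bound (SquareRun.roots (fun i => (r i).1) (fun i => (r i).2) ρ u m)
    (fun i hi => by simp only [SquareRun.roots, Finset.mem_filter] at hi; exact hi.1)
    (fun i hi k hk hne => SquareRun.roots_disjoint hi hk hne)
  have h3 : ∑ i ∈ (Finset.range m).filter (fun i => (r i).1 < u i + ρ i), (ρ i : ℝ) ≤
      2 * ∑ i ∈ SquareRun.roots (fun i => (r i).1) (fun i => (r i).2) ρ u m, (ρ i : ℝ) := by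
    exact_mod_cast H.sum_uncovered_le m
  rw [← Finset.sum_filter_add_sum_filter_not (Finset.range m) (fun i => (r i).1 < u i + ρ i)]
  linarith

end StripCost

/-! ### The parameters at the guesses, and the competitive ratio in the strip -/

theorem one_le_four_pow (l : ℕ) : 1 ≤ 4 ^ l := Nat.one_le_pow _ _ (by norm_num)

theorem four_le_guess (l : ℕ) : 4 ≤ 4 ^ 4 ^ l := by
  calc 4 = 4 ^ 1 := rfl
    _ ≤ 4 ^ 4 ^ l := Nat.pow_le_pow_right (by norm_num) (one_le_four_pow l)

theorem guess_eq_two_pow (l : ℕ) : 4 ^ 4 ^ l = 2 ^ 2 ^ (2 * l + 1) := by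
  have h : 2 ^ (2 * l + 1) = 2 * 4 ^ l := by rw [pow_succ, pow_mul]; ring
  rw [h, pow_mul]
  norm_num

theorem logb_guess (l : ℕ) : Real.logb 2 ((4 ^ 4 ^ l : ℕ) : ℝ) = 2 ^ (2 * l + 1) := by
  have h : ((4 ^ 4 ^ l : ℕ) : ℝ) = 2 ^ (2 ^ (2 * l + 1) : ℕ) := by
    rw [guess_eq_two_pow]
    norm_num
  rw [h, Real.logb_pow, Real.logb_self_eq_one (by norm_num)]
  push_cast
  ring

theorem ratio_guess (l : ℕ) : Real.logb 2 ((4 ^ 4 ^ l : ℕ) : ℝ) /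
    Real.logb 2 (Real.logb 2 ((4 ^ 4 ^ l : ℕ) : ℝ)) = 2 ^ (2 * l + 1) / (2 * l + 1) := by
  rw [logb_guess, Real.logb_pow, Real.logb_self_eq_one (by norm_num)]
  push_cast
  ring

theorem logRatio_guess (l : ℕ) : logRatio (4 ^ 4 ^ l) = 2 ^ (2 * l + 1) / (2 * l + 1) := by
  unfold logRatio
  rw [max_eq_left (four_le_guess l), ratio_guess]

theorem gridDelta_guess (l : ℕ) : gridDelta (4 ^ 4 ^ l) = ⌈logRatio (4 ^ 4 ^ l)⌉₊ := by
  rw [logRatio_guess]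
  unfold gridDelta
  rw [ratio_guess]

theorem two_pow_le_logRatio_guess (l : ℕ) : (2 : ℝ) ^ max l 1 ≤ logRatio (4 ^ 4 ^ l) := by
  rw [logRatio_guess, le_div_iff₀ (by positivity)]
  rcases Nat.eq_zero_or_pos l with rfl | hl
  · norm_num
  · rw [max_eq_left hl]
    have h1 : 2 * l + 1 ≤ 2 ^ (l + 1) := by
      have := Nat.lt_two_pow_self (n := l)
      rw [pow_succ]
      omega
    have h2 : (2 * l + 1 : ℝ) ≤ 2 ^ (l + 1) := by exact_mod_cast h1
    calc (2 : ℝ) ^ l * (2 * l + 1) ≤ 2 ^ l * 2 ^ (l + 1) := by gcongr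
      _ = 2 ^ (2 * l + 1) := by rw [← pow_add]; congr 1; omega

theorem two_le_logRatio_guess (l : ℕ) : 2 ≤ logRatio (4 ^ 4 ^ l) := by
  refine le_trans ?_ (two_pow_le_logRatio_guess l)
  calc (2 : ℝ) = 2 ^ 1 := by norm_num
    _ ≤ 2 ^ max l 1 := pow_le_pow_right₀ (by norm_num) (le_max_right _ _)

theorem two_pow_le_gridDelta_guess (l : ℕ) : 2 ^ max l 1 ≤ gridDelta (4 ^ 4 ^ l) := by
  have h1 := (two_pow_le_logRatio_guess l).trans (Nat.le_ceil _)
  rw [gridDelta_guess]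
  exact_mod_cast h1

theorem gridDelta_guess_le (l : ℕ) :
    (gridDelta (4 ^ 4 ^ l) : ℝ) ≤ 3 / 2 * logRatio (4 ^ 4 ^ l) := by
  have h := two_le_logRatio_guess l
  rw [gridDelta_guess]
  linarith [Nat.ceil_lt_add_one (show 0 ≤ logRatio (4 ^ 4 ^ l) by linarith)]

/-- The number of levels is of the order of the branching parameter. -/
theorem log_gridDelta_guess_le (l : ℕ) :
    (Nat.log (gridDelta (4 ^ 4 ^ l)) (4 ^ 4 ^ l) : ℝ) ≤ 3 * logRatio (4 ^ 4 ^ l) := by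
  set δ := gridDelta (4 ^ 4 ^ l) with hδ
  set e := Nat.log δ (4 ^ 4 ^ l) with he
  have h1 : 2 ^ (max l 1 * e) ≤ 2 ^ (2 ^ (2 * l + 1)) := by
    calc 2 ^ (max l 1 * e) = (2 ^ max l 1) ^ e := pow_mul _ _ _
      _ ≤ δ ^ e := Nat.pow_le_pow_left (two_pow_le_gridDelta_guess l) e
      _ ≤ 4 ^ 4 ^ l := Nat.pow_log_le_self _ (by positivity)
      _ = 2 ^ (2 ^ (2 * l + 1)) := guess_eq_two_pow l
  have h2 : max l 1 * e ≤ 2 ^ (2 * l + 1) := (Nat.pow_le_pow_iff_right (by norm_num)).1 h1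
  have h3 : (2 * l + 1) * e ≤ 3 * 2 ^ (2 * l + 1) := by
    calc (2 * l + 1) * e ≤ (3 * max l 1) * e := Nat.mul_le_mul_right _ (by omega)
      _ = 3 * (max l 1 * e) := by ring
      _ ≤ _ := Nat.mul_le_mul_left _ h2
  have h4 : ((2 * l + 1) * e : ℝ) ≤ 3 * 2 ^ (2 * l + 1) := by exact_mod_cast h3
  rw [logRatio_guess, ← mul_div_assoc, le_div_iff₀ (by positivity)]
  linarith

section StripRatio

variable (τ : TieBreak) {n : ℕ} {p : ℕ → Point}

theorem sum_card_keptAt_le (hn : 0 < n) (hp : StripSeq n p) (hδ : 0 < gridDelta n) (m T : ℕ) :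
    ∑ t ∈ Finset.range T, (keptAt τ n p m (t + 1)).card ≤
      T + (stateAt τ n p m).tail.card +
        (Nat.log (gridDelta n) n + 1) * (4 * (stateAt τ n p m).sol.card) := by
  have hg := gridSeq_of_stripSeq hn hp
  refine sum_card_kept_le τ hδ (hg.node_lt τ m) ?_ (hg.predClosed τ m) T
  have hmem := sqSeq_sol τ _ hg.mono
  intro a b hab
  refine (hmem m a b).2 (Or.inr ?_)
  rcases hab with hab | hab
  · obtain ⟨i, hi, h1, h2⟩ := (sqSeq_base τ _ m a b).1 hab
    exact ⟨i, hi, Or.inr ⟨h1, h2⟩⟩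
  · obtain ⟨i, hi, h1, h2, h3⟩ := (sqSeq_tail τ _ m a b).1 hab
    exact ⟨i, hi, Or.inl ⟨h1, ((squareRun τ _ hg.mono).s_le i).trans h2, h3⟩⟩

/-- In the strip, the cost of the algorithm is of the order of its parameter `δ` and the number
of levels times the cost of any solution plus `n`. -/
theorem cost_run_serveGrid_pre_le (hn : 2 ≤ n) (hp : StripSeq n p) (hδ : 1 < gridDelta n) {m : ℕ}
    (hm : m ≤ n) {F : List Seg} (hF : Feasible F (pre p m)) :
    cost (run (serveGrid τ n) (pre p m)) ≤
      (46 + 188 * (Nat.log (gridDelta n) n + 1) + 60 * gridDelta n) * (cost F + n) := by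
  have hn0 : 0 < n := by omega
  have hg := gridSeq_of_stripSeq hn0 hp
  set ρ := radAt τ fun i => gridPoint n (p i) with hρ
  set R : ℝ := ∑ i ∈ Finset.range m, (ρ i : ℝ) with hR
  set X : ℝ := cost F + n with hX
  set δ := gridDelta n with hδdef
  set lg := Nat.log δ n with hlg
  have hc := cost_nonneg F
  have hn' : (2 : ℝ) ≤ n := by exact_mod_cast hn
  have hm' : (m : ℝ) ≤ n := by exact_mod_cast hm
  have hR3 : R ≤ 3 * X := (sum_radii_le τ hn0 hp hF).trans (by linarith)
  have hT : ((stateAt τ n p m).time : ℝ) ≤ cost F + 1 := by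
    cases m with
    | zero => simp [sqSeq_time_zero]; linarith
    | succ m =>
      have h1 := add_le_cost (hF (p m) (mem_pre.2 ⟨m, Nat.lt_succ_self m, rfl⟩))
      have h2 : ((gridPoint n (p m)).2 : ℝ) < (p m).2 + 1 :=
        Nat.ceil_lt_add_one (hp.snd_nonneg m)
      have h3 := hp.nonneg m
      rw [stateAt, sqSeq_time_succ]
      linarith
  have htail : ((stateAt τ n p m).tail.card : ℝ) ≤ 4 * R + m := by
    have h1 : ((stateAt τ n p m).tail.card : ℝ) ≤
        ((∑ i ∈ Finset.range m, (4 * ρ i + 1) : ℕ) : ℝ) := by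
      exact_mod_cast GridSeq.card_tail_le τ m
    refine h1.trans (le_of_eq ?_)
    push_cast
    rw [Finset.sum_add_distrib, ← Finset.mul_sum]
    simp [hR]
  have hsol : ((stateAt τ n p m).sol.card : ℝ) ≤
      1 + (stateAt τ n p m).time + (14 * R + 4 * m) := by
    have h1 : ((stateAt τ n p m).sol.card : ℝ) ≤
        ((1 + (stateAt τ n p m).time + ∑ i ∈ Finset.range m, (14 * ρ i + 4) : ℕ) : ℝ) := by
      exact_mod_cast hg.card_sol_le τ m
    refine h1.trans (le_of_eq ?_)
    push_cast
    rw [Finset.sum_add_distrib, ← Finset.mul_sum]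
    simp [hR]
    ring
  have hkept : (∑ t ∈ Finset.range (stateAt τ n p m).time,
      ((keptAt τ n p m (t + 1)).card : ℝ)) ≤ 14 * X + 188 * (lg + 1) * X := by
    have h1 : (∑ t ∈ Finset.range (stateAt τ n p m).time,
        ((keptAt τ n p m (t + 1)).card : ℝ)) ≤ (stateAt τ n p m).time +
          (stateAt τ n p m).tail.card + (lg + 1) * (4 * (stateAt τ n p m).sol.card) := by
      exact_mod_cast sum_card_keptAt_le τ hn0 hp (by omega) m _
    have h2 : ((lg : ℝ) + 1) * (4 * (stateAt τ n p m).sol.card) ≤ (lg + 1) * (188 * X) := by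
      refine mul_le_mul_of_nonneg_left ?_ (by positivity)
      linarith
    linarith
  have hroute : (∑ i ∈ Finset.range m,
      (2 * (((gridPoint n (p i)).1 - srcOf τ n p i : ℕ) : ℝ) + 2)) ≤ (32 + 60 * δ) * X := by
    have h1 : ∀ i ∈ Finset.range m,
        (2 * (((gridPoint n (p i)).1 - srcOf τ n p i : ℕ) : ℝ) + 2) ≤
          (10 + 20 * δ) * ρ i + 2 := by
      intro i _
      have e1 := hg.nodeAt_le_srcAt τ (δ := δ) hδ i
      have e2 := (squareRun τ _ hg.mono).le_u i
      have e3 : (gridPoint n (p i)).1 - srcOf τ n p i ≤ 5 * ρ i + 10 * δ * ρ i := by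
        simp only [srcOf]
        simp only [← hδdef, ← hρ] at e1 e2 ⊢
        omega
      have e4 : (((gridPoint n (p i)).1 - srcOf τ n p i : ℕ) : ℝ) ≤
          5 * ρ i + 10 * δ * ρ i := by exact_mod_cast e3
      linarith
    refine (Finset.sum_le_sum h1).trans ?_
    rw [Finset.sum_add_distrib, ← Finset.mul_sum, ← hR]
    simp only [Finset.sum_const, Finset.card_range, nsmul_eq_mul]
    have h2 : (10 + 20 * (δ : ℝ)) * R ≤ (10 + 20 * δ) * (3 * X) :=
      mul_le_mul_of_nonneg_left hR3 (by positivity)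
    linarith
  refine (cost_run_serveGrid_le τ hn0 hp m).trans ?_
  linarith

end StripRatio

/-- On at most `n` points of the strip of width `n`, where `n` is a guess, the cost of
the algorithm is `O(log n / log log n)` times the cost of any solution plus `n`. -/
theorem cost_run_serveGrid_guess_le (τ : TieBreak) (l : ℕ) {Q : List Point} (hQ : ValidRequests Q)
    (hx : ∀ q ∈ Q, q.1 ≤ (4 ^ 4 ^ l : ℕ)) (hlen : Q.length ≤ 4 ^ 4 ^ l) {F : List Seg}
    (hF : Feasible F Q) : cost (run (serveGrid τ (4 ^ 4 ^ l)) Q) ≤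
      800 * logRatio (4 ^ 4 ^ l) * (cost F + (4 ^ 4 ^ l : ℕ)) := by
  set n := 4 ^ 4 ^ l with hn
  obtain ⟨p, hp, hpQ⟩ := exists_stripSeq (Nat.cast_nonneg n) hQ hx
  rw [← hpQ] at hF ⊢
  have h2 := two_le_logRatio_guess l
  have hδ1 : 1 < gridDelta n := (Nat.one_lt_two_pow (by omega)).trans_le
    (two_pow_le_gridDelta_guess l)
  have h4 := four_le_guess l
  refine (cost_run_serveGrid_pre_le τ (by omega) hp hδ1 hlen hF).trans ?_
  have hlg := log_gridDelta_guess_le l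
  have hδ := gridDelta_guess_le l
  rw [← hn] at h2 hlg hδ
  have hX : 0 ≤ cost F + (n : ℝ) := add_nonneg (cost_nonneg F) (Nat.cast_nonneg n)
  exact mul_le_mul_of_nonneg_right (by linarith) hX

/-! ### Changes of coordinates -/

theorem Reach.nonneg {F : List Seg} {p : Point} (h : Reach F p) : 0 ≤ p.1 ∧ 0 ≤ p.2 := by
  obtain ⟨γ, hγ⟩ := exists_curveTo h
  exact hγ.nonneg

theorem mem_uIcc_mul_right {a b x c : ℝ} (hc : 0 ≤ c) (h : x ∈ uIcc a b) :
    x * c ∈ uIcc (a * c) (b * c) := by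
  rw [mem_uIcc] at h ⊢
  rcases h with ⟨h1, h2⟩ | ⟨h1, h2⟩
  · exact Or.inl ⟨mul_le_mul_of_nonneg_right h1 hc, mul_le_mul_of_nonneg_right h2 hc⟩
  · exact Or.inr ⟨mul_le_mul_of_nonneg_right h1 hc, mul_le_mul_of_nonneg_right h2 hc⟩

theorem mem_uIcc_add_right {a b x c : ℝ} (h : x ∈ uIcc a b) : x + c ∈ uIcc (a + c) (b + c) := by
  rw [mem_uIcc] at h ⊢
  simpa using h

theorem exists_mem_uIcc_mul_right {a b z c : ℝ} (hc : 0 < c) (h : z ∈ uIcc (a * c) (b * c)) :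
    ∃ x ∈ uIcc a b, x * c = z := by
  refine ⟨z / c, ?_, div_mul_cancel₀ _ hc.ne'⟩
  rw [mem_uIcc] at h ⊢
  rwa [le_div_iff₀ hc, le_div_iff₀ hc, div_le_iff₀ hc, div_le_iff₀ hc]

section OfGrid

variable {M : ℝ} {n : ℕ} {y₀ : ℝ}

theorem mem_carrier_ofGrid (hM : 0 < M) (hn : 0 < n) {s : Seg} {z : Point}
    (hz : z ∈ (ofGrid M n y₀ s).carrier) :
    ∃ w ∈ s.carrier, z = (w.1 * (M / n), w.2 * (M / n) + y₀) := by
  have hc : 0 < M / n := by positivity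
  cases s with
  | horiz y a b =>
    obtain ⟨h1, h2⟩ := hz
    obtain ⟨x, hx, hxz⟩ := exists_mem_uIcc_mul_right hc h1
    exact ⟨(x, y), ⟨hx, rfl⟩, Prod.ext hxz.symm h2⟩
  | vert x a b =>
    obtain ⟨h1, h2⟩ := hz
    have h3 := mem_uIcc_add_right (c := -y₀) h2
    rw [add_neg_cancel_right, add_neg_cancel_right] at h3
    obtain ⟨y, hy, hyz⟩ := exists_mem_uIcc_mul_right hc h3
    exact ⟨(x, y), ⟨rfl, hy⟩, Prod.ext h1 (by simp only; linarith)⟩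

theorem covered_ofGrid (hM : 0 < M) {F G : List Seg} (h : F.map (ofGrid M n y₀) ⊆ G)
    {z : Point} (hz : z ∈ covered F) : (z.1 * (M / n), z.2 * (M / n) + y₀) ∈ covered G := by
  have hc : 0 ≤ M / n := by positivity
  obtain ⟨s, hs, hzs⟩ := hz
  refine ⟨_, h (List.mem_map_of_mem hs), ?_⟩
  cases s with
  | horiz y a b =>
    obtain ⟨h1, h2⟩ := hzs
    exact ⟨mem_uIcc_mul_right hc h1, by simp only [h2]⟩
  | vert x a b =>
    obtain ⟨h1, h2⟩ := hzs
    exact ⟨by simp only [h1], mem_uIcc_add_right (mem_uIcc_mul_right hc h2)⟩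

/-- Paths in the coordinates of a subset of the requests become paths that start at its origin. -/
theorem Reach.ofGrid (hM : 0 < M) (hn : 0 < n) {F G : List Seg}
    (h : F.map (RSA.ofGrid M n y₀) ⊆ G) (h0 : Reach G (0, y₀)) {q : Point} (hq : Reach F q) :
    Reach G (q.1 * (M / n), q.2 * (M / n) + y₀) := by
  have hc : 0 < M / n := by positivity
  unfold Reach at hq
  induction hq with
  | refl => simpa using h0
  | @tail a b _ hab ih =>
    refine Relation.ReflTransGen.tail ih ⟨?_, ?_⟩
    · rcases hab.1 with ⟨h1, h2⟩ | ⟨h1, h2⟩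
      · exact Or.inl ⟨mul_le_mul_of_nonneg_right h1 hc.le, by simp only [h2]⟩
      · refine Or.inr ⟨by simp only [h1], ?_⟩
        have := mul_le_mul_of_nonneg_right h2 hc.le
        simp only
        linarith
    · rintro ⟨x, y⟩ ⟨⟨hx1, hy1⟩, hx2, hy2⟩
      simp only at hx1 hx2 hy1 hy2
      have hw : ((x / (M / n), (y - y₀) / (M / n)) : Point) ∈ covered F := by
        apply hab.2
        refine ⟨⟨?_, ?_⟩, ?_, ?_⟩ <;> simp only
        · rwa [le_div_iff₀ hc]
        · rw [le_div_iff₀ hc]; linarith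
        · rwa [div_le_iff₀ hc]
        · rw [div_le_iff₀ hc]; linarith
      have := covered_ofGrid hM h hw
      simp only [div_mul_cancel₀ _ hc.ne', sub_add_cancel] at this
      exact this

theorem cost_map_ofGrid (hM : 0 ≤ M) (F : List Seg) :
    cost (F.map (ofGrid M n y₀)) = M / n * cost F := by
  have hc : 0 ≤ M / n := by positivity
  induction F with
  | nil => simp [cost]
  | cons s F ih =>
    rw [List.map_cons, cost_cons, cost_cons, ih, mul_add]
    congr 1
    cases s with
    | horiz y a b =>
      simp only [ofGrid, Seg.length]
      rw [← sub_mul, abs_mul, abs_of_nonneg hc, mul_comm]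
    | vert x a b =>
      simp only [ofGrid, Seg.length]
      rw [add_sub_add_right_eq_sub, ← sub_mul, abs_mul, abs_of_nonneg hc, mul_comm]

theorem ofGrid_toGrid (hM : 0 < M) (hn : 0 < n) (p : Point) :
    ((toGrid M n y₀ p).1 * (M / n), (toGrid M n y₀ p).2 * (M / n) + y₀) = p := by
  have hn' : (0 : ℝ) < n := by exact_mod_cast hn
  ext <;> simp only [toGrid] <;> field_simp
  ring

end OfGrid

/-! ### The part of a solution between two heights -/

/-- The length of the part of a segment at heights at most `y`. -/
noncomputable def Seg.lengthBelow (y : ℝ) : Seg → ℝ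
  | .horiz y' a b => open Classical in if y' ≤ y then |b - a| else 0
  | .vert _ a b => |min y b - min y a|

/-- The cost of the part of `F` at heights at most `y`. -/
noncomputable def costBelow (F : List Seg) (y : ℝ) : ℝ := (F.map (Seg.lengthBelow y)).sum

/-- The part of a segment at heights in `(y₀, y₁]` (or, for vertical segments,
in `[y₀, y₁]`), moved down by `y₀` and scaled by the factor `c`. -/
noncomputable def clipSeg (c y₀ y₁ : ℝ) : Seg → List Seg
  | .horiz y a b => open Classical in
      if y₀ < y ∧ y ≤ y₁ then [.horiz ((y - y₀) * c) (a * c) (b * c)] else []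
  | .vert x a b => [.vert (x * c) ((max y₀ (min y₁ a) - y₀) * c) ((max y₀ (min y₁ b) - y₀) * c)]

/-- The part of `F` at heights in `(y₀, y₁]`, moved down by `y₀` and scaled by the factor `c`, together
with the segment that joins the origin to `(M * c, 0)`. -/
noncomputable def clip (c M y₀ y₁ : ℝ) (F : List Seg) : List Seg :=
  .horiz 0 0 (M * c) :: F.flatMap (clipSeg c y₀ y₁)

theorem Seg.lengthBelow_mono (s : Seg) : Monotone fun y => s.lengthBelow y := by
  intro y y' h
  cases s with
  | horiz y' a b =>
    simp only [Seg.lengthBelow]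
    split_ifs with h1 h2
    · exact le_rfl
    · exact absurd (h1.trans h) h2
    · exact abs_nonneg _
    · exact le_rfl
  | vert x a b =>
    simp only [Seg.lengthBelow]
    rcases le_total a b with hab | hab
    · rw [abs_of_nonneg (sub_nonneg.2 (min_le_min_left _ hab)),
        abs_of_nonneg (sub_nonneg.2 (min_le_min_left _ hab))]
      simp only [min_def]
      split_ifs <;> linarith
    · rw [abs_of_nonpos (sub_nonpos.2 (min_le_min_left _ hab)),
        abs_of_nonpos (sub_nonpos.2 (min_le_min_left _ hab))]
      simp only [min_def]
      split_ifs <;> linarith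

theorem Seg.lengthBelow_nonneg (s : Seg) (y : ℝ) : 0 ≤ s.lengthBelow y := by
  cases s with
  | horiz y' a b =>
    simp only [Seg.lengthBelow]
    split_ifs
    exacts [abs_nonneg _, le_rfl]
  | vert x a b => exact abs_nonneg _

theorem Seg.lengthBelow_le (s : Seg) (y : ℝ) : s.lengthBelow y ≤ s.length := by
  cases s with
  | horiz y' a b =>
    simp only [Seg.lengthBelow, Seg.length]
    split_ifs
    exacts [le_rfl, abs_nonneg _]
  | vert x a b =>
    have := abs_min_sub_min_le_max y b y a
    rwa [sub_self, abs_zero, max_eq_right (abs_nonneg _)] at this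

theorem costBelow_mono (F : List Seg) : Monotone (costBelow F) := fun _ _ h =>
  List.sum_le_sum fun s _ => s.lengthBelow_mono h

theorem costBelow_nonneg (F : List Seg) (y : ℝ) : 0 ≤ costBelow F y := by
  apply List.sum_nonneg
  intro x hx
  obtain ⟨s, -, rfl⟩ := List.mem_map.1 hx
  exact s.lengthBelow_nonneg y

theorem costBelow_le (F : List Seg) (y : ℝ) : costBelow F y ≤ cost F :=
  List.sum_le_sum fun s _ => s.lengthBelow_le y

theorem cost_clipSeg {c y₀ y₁ : ℝ} (hc : 0 ≤ c) (h : y₀ ≤ y₁) (s : Seg) :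
    cost (clipSeg c y₀ y₁ s) = c * (s.lengthBelow y₁ - s.lengthBelow y₀) := by
  cases s with
  | horiz y a b =>
    simp only [clipSeg, Seg.lengthBelow]
    by_cases h0 : y ≤ y₀
    · rw [if_neg (fun h1 => not_le.2 h1.1 h0), if_pos (h0.trans h), if_pos h0]
      simp [cost]
    · by_cases h1 : y ≤ y₁
      · rw [if_pos ⟨not_le.1 h0, h1⟩, if_pos h1, if_neg h0]
        simp only [cost, List.map_cons, List.map_nil, List.sum_cons, List.sum_nil, Seg.length,
          add_zero, sub_zero]
        rw [← sub_mul, abs_mul, abs_of_nonneg hc, mul_comm]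
      · rw [if_neg (fun h2 => h1 h2.2), if_neg h1, if_neg h0]
        simp [cost]
  | vert x a b =>
    have e : ∀ x, max y₀ (min y₁ x) = min y₁ x + y₀ - min y₀ x := by
      intro x
      have h1 := max_add_min y₀ (min y₁ x)
      rw [← min_assoc, min_eq_left h] at h1
      linarith
    simp only [cost, clipSeg, List.map_cons, List.map_nil, List.sum_cons, List.sum_nil,
      Seg.length, add_zero, Seg.lengthBelow]
    rw [← sub_mul, abs_mul, abs_of_nonneg hc, mul_comm, sub_sub_sub_cancel_right]
    congr 1
    rcases le_total a b with hab | hab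
    · rw [abs_of_nonneg (sub_nonneg.2 (max_le_max_left _ (min_le_min_left _ hab))),
        abs_of_nonneg (sub_nonneg.2 (min_le_min_left _ hab)),
        abs_of_nonneg (sub_nonneg.2 (min_le_min_left _ hab)), e, e]
      ring
    · rw [abs_of_nonpos (sub_nonpos.2 (max_le_max_left _ (min_le_min_left _ hab))),
        abs_of_nonpos (sub_nonpos.2 (min_le_min_left _ hab)),
        abs_of_nonpos (sub_nonpos.2 (min_le_min_left _ hab)), e, e]
      ring

theorem cost_clip {c M y₀ y₁ : ℝ} (hc : 0 ≤ c) (hM : 0 ≤ M) (h : y₀ ≤ y₁) (F : List Seg) :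
    cost (clip c M y₀ y₁ F) = c * (M + (costBelow F y₁ - costBelow F y₀)) := by
  rw [clip, cost_cons, cost_flatMap, mul_add]
  congr 1
  · simp only [Seg.length, sub_zero]
    rw [abs_of_nonneg (mul_nonneg hM hc), mul_comm]
  · induction F with
    | nil => simp [costBelow]
    | cons s F ih =>
      simp only [costBelow, List.map_cons, List.sum_cons] at ih ⊢
      rw [ih, cost_clipSeg hc h]
      ring

theorem covered_clip {c M y₀ y₁ : ℝ} (hc : 0 ≤ c) {F : List Seg} {z : Point}
    (hz : z ∈ covered F) (h0 : 0 ≤ z.1) (hM : z.1 ≤ M) (h1 : y₀ ≤ z.2) (h2 : z.2 ≤ y₁) :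
    (z.1 * c, (z.2 - y₀) * c) ∈ covered (clip c M y₀ y₁ F) := by
  have hrow : y₀ = z.2 → (z.1 * c, (z.2 - y₀) * c) ∈ covered (clip c M y₀ y₁ F) := by
    intro h
    refine ⟨_, List.mem_cons_self, ?_, by simp [h]⟩
    have := mem_uIcc_mul_right hc (mem_uIcc.2 (Or.inl ⟨h0, hM⟩))
    rwa [zero_mul] at this
  obtain ⟨s, hs, hzs⟩ := hz
  cases s with
  | horiz y a b =>
    obtain ⟨h3, h4⟩ := hzs
    rcases h1.eq_or_lt with h1 | h1
    · exact hrow h1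
    · refine ⟨.horiz ((y - y₀) * c) (a * c) (b * c), List.mem_cons_of_mem _
        (List.mem_flatMap.2 ⟨_, hs, ?_⟩), mem_uIcc_mul_right hc h3, by rw [h4]⟩
      rw [clipSeg, if_pos (by rw [← h4]; exact ⟨h1, h2⟩)]
      exact List.mem_singleton_self _
  | vert x a b =>
    obtain ⟨h3, h4⟩ := hzs
    refine ⟨_, List.mem_cons_of_mem _ (List.mem_flatMap.2 ⟨_, hs, List.mem_singleton_self _⟩),
      by simp only [h3], mem_uIcc_mul_right hc ?_⟩
    simp only [sub_eq_add_neg]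
    apply mem_uIcc_add_right
    have e : z.2 = max y₀ (min y₁ z.2) := by rw [min_eq_right h2, max_eq_right h1]
    have hmono : Monotone fun t => max y₀ (min y₁ t) := fun t t' ht =>
      max_le_max_left _ (min_le_min_left _ ht)
    rw [e]
    rcases mem_uIcc.1 h4 with ⟨h5, h6⟩ | ⟨h5, h6⟩
    · exact mem_uIcc.2 (Or.inl ⟨hmono h5, hmono h6⟩)
    · exact mem_uIcc.2 (Or.inr ⟨hmono h5, hmono h6⟩)

/-- A path that enters the heights above `y₀` can be replaced below `y₀` by the segment along the
height `y₀`. -/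
theorem Reach.clip {c M y₀ y₁ : ℝ} (hc : 0 < c) {F : List Seg} {p : Point}
    (hp : Reach F p) (hM : p.1 ≤ M) (hy : 0 ≤ y₀) (h1 : y₀ ≤ p.2) (h2 : p.2 ≤ y₁) :
    Reach (RSA.clip c M y₀ y₁ F) (p.1 * c, (p.2 - y₀) * c) := by
  have hrow : ∀ x, 0 ≤ x → x ≤ M → Reach (RSA.clip c M y₀ y₁ F) (x * c, 0) := by
    intro x hx hxM
    refine Reach.horiz (c := 0) Relation.ReflTransGen.refl List.mem_cons_self le_rfl ?_ ?_
    · positivity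
    · exact mul_le_mul_of_nonneg_right hxM hc.le
  have hstep : ∀ a b : Point, 0 ≤ a.1 → a ≤ b → b.1 ≤ M → y₀ ≤ a.2 → b.2 ≤ y₁ →
      Icc a b ⊆ covered F → Icc (a.1 * c, (a.2 - y₀) * c) (b.1 * c, (b.2 - y₀) * c) ⊆
        covered (RSA.clip c M y₀ y₁ F) := by
    rintro a b h0 - hbM ha hb hab ⟨x, y⟩ ⟨⟨hx1, hy1⟩, hx2, hy2⟩
    simp only at hx1 hx2 hy1 hy2
    rw [← le_div_iff₀ hc] at hx1 hy1
    rw [← div_le_iff₀ hc] at hx2 hy2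
    have := covered_clip (M := M) (y₀ := y₀) (y₁ := y₁) hc.le
      (hab (show ((x / c, y / c + y₀) : Point) ∈ Icc a b from
        ⟨⟨hx1, by simp only; linarith⟩, hx2, by simp only; linarith⟩))
      (h0.trans hx1) (hx2.trans hbM) (by simp only; linarith) (by simp only; linarith)
    simpa only [add_sub_cancel_right, div_mul_cancel₀ _ hc.ne'] using this
  unfold Reach at hp
  induction hp with
  | refl =>
    obtain rfl : y₀ = 0 := le_antisymm h1 hy
    simpa using hrow 0 le_rfl hM
  | @tail a b hab hs ih =>
    have ha0 := Reach.nonneg hab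
    have hb0 := Reach.nonneg (Relation.ReflTransGen.tail hab hs)
    rcases hs.1 with ⟨h3, h4⟩ | ⟨h3, h4⟩
    · refine Relation.ReflTransGen.tail (ih (h3.trans hM) (h4 ▸ h1) (h4 ▸ h2)) ⟨Or.inl
        ⟨mul_le_mul_of_nonneg_right h3 hc.le, by simp only [h4]⟩, ?_⟩
      exact hstep a b ha0.1 ⟨h3, h4.le⟩ hM (h4 ▸ h1) h2 hs.2
    · rcases le_total y₀ a.2 with h5 | h5
      · refine Relation.ReflTransGen.tail (ih (h3 ▸ hM) h5 (h4.trans h2)) ⟨Or.inr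
          ⟨by simp only [h3], mul_le_mul_of_nonneg_right (by linarith) hc.le⟩, ?_⟩
        exact hstep a b ha0.1 ⟨h3.le, h4⟩ hM h5 h2 hs.2
      · refine Relation.ReflTransGen.tail (hrow b.1 hb0.1 hM) ⟨Or.inr
          ⟨rfl, mul_nonneg (by linarith) hc.le⟩, ?_⟩
        have := hstep (b.1, y₀) b hb0.1 ⟨le_rfl, h1⟩ hM le_rfl h2
          ((Icc_subset_Icc_left (show a ≤ (b.1, y₀) from ⟨h3.le, h5⟩)).trans hs.2)
        simpa using this

/-! ### The guesses -/

theorem xGuess_zero : xGuess 0 = 0 := if_pos rfl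

theorem xGuess_of_pos {m : ℝ} (hm : 0 < m) : xGuess m = 2 ^ ⌈Real.logb 2 m⌉ := if_neg hm.ne'

theorem le_xGuess {m : ℝ} (hm : 0 ≤ m) : m ≤ xGuess m := by
  rcases hm.eq_or_lt with rfl | hm
  · rw [xGuess_zero]
  · rw [xGuess_of_pos hm, ← Real.rpow_intCast]
    exact (Real.logb_le_iff_le_rpow (by norm_num) hm).1 (Int.le_ceil _)

theorem xGuess_le {m : ℝ} (hm : 0 ≤ m) : xGuess m ≤ 2 * m := by
  rcases hm.eq_or_lt with rfl | hm
  · rw [xGuess_zero, mul_zero]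
  · rw [xGuess_of_pos hm, ← Real.rpow_intCast]
    calc (2 : ℝ) ^ (⌈Real.logb 2 m⌉ : ℝ) ≤ 2 ^ (1 + Real.logb 2 m) :=
          Real.rpow_le_rpow_of_exponent_le (by norm_num)
            (by linarith [Int.ceil_lt_add_one (Real.logb 2 m)])
      _ = 2 * m := by
          rw [Real.rpow_add (by norm_num), Real.rpow_one,
            Real.rpow_logb (by norm_num) (by norm_num) hm]

theorem xGuess_nonneg {m : ℝ} (hm : 0 ≤ m) : 0 ≤ xGuess m := hm.trans (le_xGuess hm)

theorem xGuess_mono {m m' : ℝ} (hm : 0 ≤ m) (h : m ≤ m') : xGuess m ≤ xGuess m' := by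
  rcases hm.eq_or_lt with rfl | hm
  · rw [xGuess_zero]
    exact xGuess_nonneg h
  · rw [xGuess_of_pos hm, xGuess_of_pos (hm.trans_le h)]
    exact zpow_le_zpow_right₀ (by norm_num)
      (Int.ceil_mono (Real.logb_le_logb_of_le (by norm_num) hm h))

theorem two_mul_xGuess_le {m m' : ℝ} (hm : 0 ≤ m) (h : xGuess m < m') :
    2 * xGuess m ≤ xGuess m' := by
  have hm' : 0 < m' := (xGuess_nonneg hm).trans_lt h
  rcases hm.eq_or_lt with rfl | hm
  · rw [xGuess_zero, mul_zero]
    exact xGuess_nonneg hm'.le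
  · rw [xGuess_of_pos hm] at h ⊢
    rw [xGuess_of_pos hm', ← zpow_one_add₀ (by norm_num)]
    refine zpow_le_zpow_right₀ (by norm_num) ?_
    rw [← Real.rpow_intCast, ← Real.lt_logb_iff_rpow_lt (by norm_num) hm'] at h
    have := Int.lt_ceil.2 h
    omega

theorem le_guess (i : ℕ) : i ≤ 4 ^ 4 ^ i :=
  (Nat.lt_pow_self (by norm_num)).le.trans (Nat.lt_pow_self (by norm_num)).le

theorem countGuess_spec (i : ℕ) : (∃ l, countGuess i = 4 ^ 4 ^ l) ∧ i ≤ countGuess i := by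
  have h : countGuess i ∈ {n | ∃ l : ℕ, n = 4 ^ 4 ^ l ∧ i ≤ n} :=
    Nat.sInf_mem ⟨_, i, rfl, le_guess i⟩
  obtain ⟨l, h1, h2⟩ := h
  exact ⟨⟨l, h1⟩, h2⟩

theorem countGuess_le {i l : ℕ} (h : i ≤ 4 ^ 4 ^ l) : countGuess i ≤ 4 ^ 4 ^ l :=
  Nat.sInf_le ⟨l, rfl, h⟩

theorem countGuess_mono {i j : ℕ} (h : i ≤ j) : countGuess i ≤ countGuess j := by
  obtain ⟨⟨l, hl⟩, h1⟩ := countGuess_spec j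
  rw [hl] at h1 ⊢
  exact countGuess_le (h.trans h1)

theorem guess_strictMono : StrictMono fun l : ℕ => 4 ^ 4 ^ l := fun _ _ h =>
  Nat.pow_lt_pow_right (by norm_num) (Nat.pow_lt_pow_right (by norm_num) h)

theorem logRatio_guess_succ (l : ℕ) :
    logRatio (4 ^ 4 ^ l) ≤ 3 / 4 * logRatio (4 ^ 4 ^ (l + 1)) ∧
      logRatio (4 ^ 4 ^ (l + 1)) ≤ 4 * logRatio (4 ^ 4 ^ l) := by
  have e : (2 : ℝ) ^ (2 * (l + 1) + 1) = 4 * 2 ^ (2 * l + 1) := by ring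
  have hp : (0 : ℝ) < 2 ^ (2 * l + 1) := by positivity
  rw [logRatio_guess, logRatio_guess, e]
  push_cast
  constructor
  · rw [div_le_iff₀ (by positivity)]
    have h1 : (0 : ℝ) < 2 * (l + 1) + 1 := by positivity
    have : 3 / 4 * (4 * (2 : ℝ) ^ (2 * l + 1) / (2 * (l + 1) + 1)) * (2 * l + 1) =
        2 ^ (2 * l + 1) * (3 * (2 * l + 1) / (2 * (l + 1) + 1)) := by
      field_simp
    rw [this]
    refine le_mul_of_one_le_right hp.le ?_
    rw [one_le_div h1]
    have : (0 : ℝ) ≤ l := Nat.cast_nonneg l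
    linarith
  · rw [← mul_div_assoc]
    gcongr
    linarith

theorem logRatio_guess_mono : Monotone fun l : ℕ => logRatio (4 ^ 4 ^ l) := by
  refine monotone_nat_of_le_succ fun l => ?_
  have h1 := (logRatio_guess_succ l).1
  have h2 := two_le_logRatio_guess (l + 1)
  linarith

theorem logRatio_eq (N : ℕ) : ∃ x : ℝ, 2 ≤ x ∧ logRatio N = x / Real.logb 2 x ∧
    x = Real.logb 2 (max N 4 : ℕ) := by
  refine ⟨_, ?_, rfl, rfl⟩
  rw [Real.le_logb_iff_rpow_le (by norm_num) (by positivity)]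
  have : 4 ≤ max N 4 := le_max_right _ _
  have h : (4 : ℝ) ≤ (max N 4 : ℕ) := by exact_mod_cast this
  norm_num at h ⊢

/-- `x / log x` is nondecreasing up to a factor of two. -/
theorem div_logb_le {x x' : ℝ} (h2 : 2 ≤ x) (h : x ≤ x') :
    x / Real.logb 2 x ≤ 2 * (x' / Real.logb 2 x') := by
  have hx : 0 < x := by linarith
  have hx' : 0 < x' := by linarith
  have h1 : 1 ≤ Real.logb 2 x := by
    rw [Real.le_logb_iff_rpow_le (by norm_num) hx]
    simpa using h2
  have h1' : 1 ≤ Real.logb 2 x' :=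
    h1.trans (Real.logb_le_logb_of_le (by norm_num) hx h)
  have h3 : Real.logb 2 (x' / x) ≤ 2 * (x' / x - 1) := by
    have h4 : Real.log (x' / x) ≤ x' / x - 1 := Real.log_le_sub_one_of_pos (by positivity)
    have h5 : 0 ≤ Real.log (x' / x) := Real.log_nonneg ((one_le_div hx).2 h)
    rw [Real.logb, div_le_iff₀ (Real.log_pos (by norm_num))]
    have h6 := Real.log_two_gt_d9
    nlinarith
  have h4 : Real.logb 2 x' ≤ Real.logb 2 x * (2 * (x' / x)) := by
    rw [Real.logb_div hx'.ne' hx.ne'] at h3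
    have h5 : 1 ≤ x' / x := (one_le_div hx).2 h
    nlinarith
  rw [← mul_div_assoc, div_le_div_iff₀ (by linarith) (by linarith)]
  calc x * Real.logb 2 x' ≤ x * (Real.logb 2 x * (2 * (x' / x))) := by gcongr
    _ = 2 * x' * Real.logb 2 x := by field_simp

theorem one_le_logRatio (N : ℕ) : 1 ≤ logRatio N := by
  obtain ⟨x, hx, he, -⟩ := logRatio_eq N
  have h := div_logb_le le_rfl hx
  rw [Real.logb_self_eq_one (by norm_num), ← he] at h
  linarith

theorem logRatio_countGuess_le {k N : ℕ} (h : k ≤ N) :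
    logRatio (countGuess k) ≤ 8 * logRatio N := by
  have h1 := one_le_logRatio N
  obtain ⟨⟨l, hl⟩, -⟩ := countGuess_spec k
  rw [hl]
  cases l with
  | zero =>
    have : logRatio (4 ^ 4 ^ 0) = 2 := by rw [logRatio_guess]; norm_num
    linarith
  | succ l =>
    have hN : 4 ^ 4 ^ l ≤ N := by
      by_contra hlt
      have h2 := countGuess_le (h.trans (not_le.1 hlt).le)
      rw [hl] at h2
      exact absurd h2 (not_le.2 (guess_strictMono (Nat.lt_succ_self l)))
    have h3 := (logRatio_guess_succ l).2
    have h4 : logRatio (4 ^ 4 ^ l) ≤ 2 * logRatio N := by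
      obtain ⟨x, hx, he, hxe⟩ := logRatio_eq (4 ^ 4 ^ l)
      obtain ⟨x', -, he', hxe'⟩ := logRatio_eq N
      rw [he, he']
      refine div_logb_le hx ?_
      rw [hxe, hxe']
      refine Real.logb_le_logb_of_le (by norm_num) (by positivity) ?_
      exact_mod_cast max_le_max_right 4 hN
    linarith

/-! ### The subsets of the requests -/

/-- The state of the algorithm after the requests in `Q`. -/
noncomputable def phaseOf (Q : List Point) : Phase := Q.foldl phaseStep phaseInit

theorem phaseOf_snoc (Q : List Point) (p : Point) :
    phaseOf (Q ++ [p]) = phaseStep (phaseOf Q) p := by simp [phaseOf]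

/-- What the algorithm remembers about the requests in `Q`. -/
structure PhaseInv (Q : List Point) (s : Phase) : Prop where
  count : s.count = Q.length
  height : s.height = lastY Q
  suffix : s.pts <:+ Q
  y₀_nonneg : 0 ≤ s.y₀
  y₀_le_height : s.y₀ ≤ s.height
  y₀_le : ∀ q ∈ s.pts, s.y₀ ≤ q.2
  maxX_nonneg : 0 ≤ s.maxX
  maxX_mem : s.maxX = 0 ∨ ∃ q ∈ Q, q.1 = s.maxX
  le_maxX : ∀ q ∈ Q, q.1 ≤ s.maxX
  maxX_le : s.maxX ≤ s.M
  M_eq : ∃ m, 0 ≤ m ∧ m ≤ s.maxX ∧ s.M = xGuess m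
  init : Q = [] → s = phaseInit
  lastY_pts : Q ≠ [] → s.pts ≠ [] ∧ lastY s.pts = s.height
  n_eq : Q ≠ [] → Q.length ≤ s.n ∧ ∃ k ≤ Q.length, s.n = countGuess k

theorem PhaseInv.nil : PhaseInv [] phaseInit where
  count := rfl
  height := by simp [phaseInit, lastY_nil]
  suffix := by simp [phaseInit]
  y₀_nonneg := le_rfl
  y₀_le_height := le_rfl
  y₀_le := by simp [phaseInit]
  maxX_nonneg := le_rfl
  maxX_mem := Or.inl rfl
  le_maxX := by simp
  maxX_le := le_rfl
  M_eq := ⟨0, le_rfl, le_rfl, xGuess_zero.symm⟩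
  init _ := rfl
  lastY_pts h := absurd rfl h
  n_eq h := absurd rfl h

/-- The two ways in which a request is assigned to a subset. -/
theorem phaseStep_cases (s : Phase) (p : Point) :
    (p.1 ≤ s.M ∧ s.count + 1 ≤ s.n ∧ phaseStep s p = ⟨s.count + 1, p.2, max s.maxX p.1, s.M, s.n,
      s.y₀, s.pts ++ [p]⟩) ∨
    (¬ (p.1 ≤ s.M ∧ s.count + 1 ≤ s.n) ∧ phaseStep s p = ⟨s.count + 1, p.2, max s.maxX p.1,
      xGuess (max s.maxX p.1), countGuess (s.count + 1), s.height, [p]⟩) := by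
  unfold phaseStep
  split_ifs with h
  · exact Or.inl ⟨h.1, h.2, rfl⟩
  · exact Or.inr ⟨h, rfl⟩

theorem PhaseInv.snoc {Q : List Point} {s : Phase} {p : Point} (h : PhaseInv Q s)
    (hQ : ValidRequests (Q ++ [p])) : PhaseInv (Q ++ [p]) (phaseStep s p) := by
  obtain ⟨hQ1, ⟨hp1, hp2⟩, hp3, hp4⟩ := hQ.snoc
  have hhp : s.height ≤ p.2 := h.height.trans_le hp3
  have hmem : max s.maxX p.1 = 0 ∨ ∃ q ∈ Q ++ [p], q.1 = max s.maxX p.1 := by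
    rcases max_choice s.maxX p.1 with h1 | h1 <;> rw [h1]
    · rcases h.maxX_mem with h2 | ⟨q, hq, h2⟩
      · exact Or.inl h2
      · exact Or.inr ⟨q, by simp [hq], h2⟩
    · exact Or.inr ⟨p, by simp, rfl⟩
  have hle : ∀ q ∈ Q ++ [p], q.1 ≤ max s.maxX p.1 := by
    intro q hq
    rcases List.mem_append.1 hq with hq | hq
    · exact (h.le_maxX q hq).trans (le_max_left _ _)
    · rw [List.mem_singleton.1 hq]
      exact le_max_right _ _
  have h0 : 0 ≤ max s.maxX p.1 := h.maxX_nonneg.trans (le_max_left _ _)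
  rcases phaseStep_cases s p with ⟨h1, h2, he⟩ | ⟨h1, he⟩ <;> rw [he]
  · have hne : Q ≠ [] := by
      rintro rfl
      rw [h.init rfl] at h2
      simp [phaseInit] at h2
    exact {
      count := by simp [h.count]
      height := (lastY_snoc Q p).symm
      suffix := by
        obtain ⟨l, hl⟩ := h.suffix
        exact ⟨l, by rw [← List.append_assoc, hl]⟩
      y₀_nonneg := h.y₀_nonneg
      y₀_le_height := h.y₀_le_height.trans hhp
      y₀_le := by
        intro q hq
        rcases List.mem_append.1 hq with hq | hq
        · exact h.y₀_le q hq
        · rw [List.mem_singleton.1 hq]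
          exact h.y₀_le_height.trans hhp
      maxX_nonneg := h0
      maxX_mem := hmem
      le_maxX := hle
      maxX_le := max_le h.maxX_le h1
      M_eq := by
        obtain ⟨m, hm1, hm2, hm3⟩ := h.M_eq
        exact ⟨m, hm1, hm2.trans (le_max_left _ _), hm3⟩
      init := by simp
      lastY_pts := fun _ => ⟨by simp, lastY_snoc _ _⟩
      n_eq := fun _ => by
        obtain ⟨-, k, hk, hk'⟩ := h.n_eq hne
        exact ⟨by simpa [h.count] using h2, k, by simp; omega, hk'⟩ }
  · exact {
      count := by simp [h.count]
      height := (lastY_snoc Q p).symm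
      suffix := ⟨Q, rfl⟩
      y₀_nonneg := h.y₀_nonneg.trans h.y₀_le_height
      y₀_le_height := hhp
      y₀_le := by simpa using hhp
      maxX_nonneg := h0
      maxX_mem := hmem
      le_maxX := hle
      maxX_le := le_xGuess h0
      M_eq := ⟨_, h0, le_rfl, rfl⟩
      init := by simp
      lastY_pts := fun _ => ⟨by simp, by simp [lastY]⟩
      n_eq := fun _ => by
        have h3 := (countGuess_spec (s.count + 1)).2
        exact ⟨by simpa [h.count] using h3, s.count + 1, by simp [h.count], rfl⟩ }

theorem phaseInv {Q : List Point} (hQ : ValidRequests Q) : PhaseInv Q (phaseOf Q) := by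
  induction Q using List.reverseRecOn with
  | nil => exact PhaseInv.nil
  | append_singleton Q p ih =>
    rw [phaseOf_snoc]
    exact (ih hQ.snoc.1).snoc hQ

/-! ### Correctness of the algorithm -/

section OnRSA

variable (τ : TieBreak)

theorem onRSA_eq (Q : List Point) (p : Point) : onRSA τ Q p =
    open Classical in if (phaseOf (Q ++ [p])).M = 0 then [Seg.vert 0 (phaseOf Q).height p.2]
    else (serveGrid τ (phaseOf (Q ++ [p])).n
      ((phaseOf (Q ++ [p])).pts.dropLast.map
        (toGrid (phaseOf (Q ++ [p])).M (phaseOf (Q ++ [p])).n (phaseOf (Q ++ [p])).y₀))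
      (toGrid (phaseOf (Q ++ [p])).M (phaseOf (Q ++ [p])).n (phaseOf (Q ++ [p])).y₀ p)).map
        (ofGrid (phaseOf (Q ++ [p])).M (phaseOf (Q ++ [p])).n (phaseOf (Q ++ [p])).y₀) := by
  rw [phaseOf_snoc]
  rfl

/-- The points of the current subset in its own coordinates. -/
noncomputable def Phase.gridPts (s : Phase) : List Point := s.pts.map (toGrid s.M s.n s.y₀)

theorem PhaseInv.M_nonneg {Q : List Point} {s : Phase} (h : PhaseInv Q s) : 0 ≤ s.M :=
  h.maxX_nonneg.trans h.maxX_le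

theorem PhaseInv.le_M {Q : List Point} {s : Phase} (h : PhaseInv Q s) {q : Point}
    (hq : q ∈ Q) : q.1 ≤ s.M := (h.le_maxX q hq).trans h.maxX_le

theorem PhaseInv.gridPts_spec {Q : List Point} {s : Phase} (h : PhaseInv Q s)
    (hQ : ValidRequests Q) (hM : 0 < s.M) :
    ValidRequests s.gridPts ∧ ∀ q ∈ s.gridPts, q.1 ≤ s.n := by
  have hc : 0 ≤ (s.n : ℝ) / s.M := by positivity
  refine ⟨⟨?_, ?_⟩, ?_⟩
  · intro q hq
    obtain ⟨b, hb, rfl⟩ := List.mem_map.1 hq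
    exact ⟨mul_nonneg (hQ.1 b (h.suffix.subset hb)).1 hc,
      mul_nonneg (sub_nonneg.2 (h.y₀_le b hb)) hc⟩
  · have h1 : (s.pts.map Prod.snd).Pairwise (· ≤ ·) :=
      hQ.2.sublist (h.suffix.sublist.map _)
    rw [Phase.gridPts, List.map_map, List.pairwise_map]
    rw [List.pairwise_map] at h1
    exact h1.imp fun hab => mul_le_mul_of_nonneg_right (by linarith) hc
  · intro q hq
    obtain ⟨b, hb, rfl⟩ := List.mem_map.1 hq
    have h1 : b.1 * (s.n / s.M) ≤ s.M * (s.n / s.M) :=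
      mul_le_mul_of_nonneg_right (h.le_M (h.suffix.subset hb)) hc
    have h2 : s.M * (s.n / s.M) = s.n := by field_simp
    rw [h2] at h1
    exact h1

/-- The points of the subset that the request `p` joins, before it does so. -/
theorem phaseStep_pts {Q : List Point} {s : Phase} {p : Point} (h : PhaseInv Q s) :
    ∃ P, (phaseStep s p).pts = P ++ [p] ∧
      ((P = s.pts ∧ Q ≠ [] ∧ (phaseStep s p).M = s.M ∧ (phaseStep s p).n = s.n ∧
          (phaseStep s p).y₀ = s.y₀) ∨
        (P = [] ∧ (phaseStep s p).M = xGuess (max s.maxX p.1) ∧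
          (phaseStep s p).n = countGuess (s.count + 1) ∧ (phaseStep s p).y₀ = s.height ∧
          ¬ (p.1 ≤ s.M ∧ s.count + 1 ≤ s.n))) := by
  rcases phaseStep_cases s p with ⟨h1, h2, he⟩ | ⟨h1, he⟩ <;> rw [he]
  · refine ⟨s.pts, rfl, Or.inl ⟨rfl, ?_, rfl, rfl, rfl⟩⟩
    rintro rfl
    rw [h.init rfl] at h2
    simp [phaseInit] at h2
  · exact ⟨[], rfl, Or.inr ⟨rfl, rfl, rfl, rfl, h1⟩⟩

/-- What the solution of the algorithm contains after the requests in `Q`. -/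
structure SolutionInv (Q : List Point) (s : Phase) (F : List Seg) : Prop where
  feasible : Feasible F Q
  origin : Reach F (0, s.y₀)
  axis : Reach F (0, s.height)
  grid : s.M ≠ 0 → (run (serveGrid τ s.n) s.gridPts).map (ofGrid s.M s.n s.y₀) ⊆ F

theorem lastY_map_toGrid {M : ℝ} {n : ℕ} {y₀ : ℝ} {P : List Point} (hP : P ≠ []) :
    lastY (P.map (toGrid M n y₀)) = (lastY P - y₀) * (n / M) := by
  rcases List.eq_nil_or_concat' P with rfl | ⟨P', q, rfl⟩
  · exact absurd rfl hP
  · rw [List.map_append, List.map_singleton, lastY_snoc, lastY_snoc]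
    rfl

/-- The solution of the current subset starts from the end of the path along the `y`-axis, at the height
of the last request before this subset. -/
theorem onRSA_step {Q : List Point} {p : Point} (hQ : ValidRequests (Q ++ [p]))
    (hI : SolutionInv τ Q (phaseOf Q) (run (onRSA τ) Q)) :
    (∀ s ∈ onRSA τ Q p, ∀ z ∈ s.carrier, lastY Q ≤ z.2) ∧
      SolutionInv τ (Q ++ [p]) (phaseOf (Q ++ [p])) (run (onRSA τ) (Q ++ [p])) := by
  have h := phaseInv hQ.snoc.1
  have h' := phaseInv hQ
  have hstep := phaseOf_snoc Q p
  obtain ⟨hQ1, ⟨hp1, hp2⟩, hp3, hp4⟩ := hQ.snoc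
  have hhp : (phaseOf Q).height ≤ p.2 := h.height.trans_le hp3
  obtain ⟨P, hP, hcases⟩ := phaseStep_pts (p := p) h
  have hon := onRSA_eq τ Q p
  rw [← hstep] at hP hcases
  rw [run_snoc]
  set s := phaseOf Q with hs
  set s' := phaseOf (Q ++ [p]) with hs'
  set F := run (onRSA τ) Q with hF
  set G := onRSA τ Q p with hG
  have hsub : F ⊆ F ++ G := List.subset_append_left _ _
  have hheight : s'.height = p.2 := by rw [h'.height, lastY_snoc]
  have horigin : Reach F (0, s'.y₀) := by
    rcases hcases with ⟨-, -, -, -, h1⟩ | ⟨-, -, -, h1, -⟩ <;> rw [h1]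
    exacts [hI.origin, hI.axis]
  by_cases hM : s'.M = 0
  · rw [if_pos hM] at hon
    have hp0 : p.1 = 0 := le_antisymm (hM ▸ h'.le_M (by simp)) hp1
    have haxis : Reach (F ++ G) (0, p.2) := by
      refine Reach.vert (hI.axis.mono hsub) (a := s.height) (b := p.2) ?_ le_rfl hhp le_rfl
      rw [hon]
      simp
    refine ⟨?_, ?_, horigin.mono hsub, by rwa [hheight], fun h0 => absurd hM h0⟩
    · intro a ha z hz
      rw [hon, List.mem_singleton] at ha
      rw [ha] at hz
      have := hz.2
      rw [uIcc_of_le hhp] at this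
      rw [← h.height]
      exact this.1
    · intro q hq
      rcases List.mem_append.1 hq with hq | hq
      · exact Reach.mono hsub (hI.feasible q hq)
      · rw [List.mem_singleton.1 hq]
        have : p = (0, p.2) := Prod.ext hp0 rfl
        rw [this]
        exact haxis
  · rw [if_neg hM, hP, List.dropLast_concat] at hon
    have hMpos : 0 < s'.M := lt_of_le_of_ne h'.M_nonneg (Ne.symm hM)
    have hn : 0 < s'.n := by
      have := (h'.n_eq (by simp)).1
      simp only [List.length_append, List.length_singleton] at this
      omega
    obtain ⟨hv, hx⟩ := h'.gridPts_spec hQ hMpos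
    have hgp : s'.gridPts = P.map (toGrid s'.M s'.n s'.y₀) ++ [toGrid s'.M s'.n s'.y₀ p] := by
      simp [Phase.gridPts, hP]
    rw [hgp] at hv hx
    obtain ⟨g1, g2, g3⟩ := serveGrid_spec τ hn _ _ hv hx
    have hgrid : (run (serveGrid τ s'.n) s'.gridPts).map (ofGrid s'.M s'.n s'.y₀) ⊆ F ++ G := by
      rw [hgp, run_snoc, List.map_append, ← hon]
      refine List.append_subset.2 ⟨?_, List.subset_append_right _ _⟩
      rcases hcases with ⟨h1, -, h2, h3, h4⟩ | ⟨h1, -⟩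
      · rw [h2] at hM
        rw [h1, h2, h3, h4]
        exact List.Subset.trans (hI.grid hM) hsub
      · rw [h1]
        simp [run, runFrom]
    have hreach : ∀ q, Reach (run (serveGrid τ s'.n) s'.gridPts) q →
        Reach (F ++ G) (q.1 * (s'.M / s'.n), q.2 * (s'.M / s'.n) + s'.y₀) := fun q hq =>
      Reach.ofGrid hMpos hn hgrid (horigin.mono hsub) hq
    rw [← hgp] at g2 g3
    refine ⟨?_, ?_, horigin.mono hsub, ?_, fun _ => hgrid⟩
    · intro a ha z hz
      rw [hon] at ha
      obtain ⟨b, hb, rfl⟩ := List.mem_map.1 ha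
      obtain ⟨w, hw, rfl⟩ := mem_carrier_ofGrid hMpos hn hz
      have hlw := g1 b hb w hw
      have hl : lastY (P.map (toGrid s'.M s'.n s'.y₀)) = (s.height - s'.y₀) * (s'.n / s'.M) := by
        rcases hcases with ⟨h1, h5, h2, h3, h4⟩ | ⟨h1, -, -, h4, -⟩
        · obtain ⟨h6, h7⟩ := h.lastY_pts h5
          rw [h1, lastY_map_toGrid h6, h7]
        · rw [h1, h4, sub_self, zero_mul]
          exact lastY_nil
      have hc : 0 ≤ s'.M / s'.n := by positivity
      have h1 := mul_le_mul_of_nonneg_right hlw hc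
      have hn' : (0 : ℝ) < s'.n := by exact_mod_cast hn
      have h2 : (s.height - s'.y₀) * (s'.n / s'.M) * (s'.M / s'.n) = s.height - s'.y₀ := by
        field_simp
      rw [hl, h2] at h1
      rw [← h.height]
      simp only
      linarith
    · intro q hq
      rcases List.mem_append.1 hq with hq | hq
      · exact Reach.mono hsub (hI.feasible q hq)
      · rw [List.mem_singleton.1 hq]
        have := hreach _ (g2 (toGrid s'.M s'.n s'.y₀ p) (by rw [hgp]; simp))
        rwa [ofGrid_toGrid hMpos hn] at this
    · have h1 := hreach _ g3
      simp only [zero_mul] at h1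
      have h2 := congrArg Prod.snd (ofGrid_toGrid (y₀ := s'.y₀) hMpos hn p)
      simp only at h2
      rwa [h2, ← hheight] at h1

theorem solutionInv {Q : List Point} (hQ : ValidRequests Q) :
    SolutionInv τ Q (phaseOf Q) (run (onRSA τ) Q) := by
  induction Q using List.reverseRecOn with
  | nil =>
    exact ⟨by simp [Feasible], Relation.ReflTransGen.refl, Relation.ReflTransGen.refl,
      fun h => absurd rfl h⟩
  | append_singleton Q p ih => exact (onRSA_step τ hQ (ih hQ.snoc.1)).2

theorem isOnline_onRSA : IsOnline (onRSA τ) := fun _ _ hQ =>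
  have h := onRSA_step τ hQ (solutionInv τ hQ.snoc.1)
  ⟨h.1, h.2.feasible⟩

/-! ### The competitive ratio of the algorithm -/

/-- The cost of the algorithm on the current subset. -/
noncomputable def Phase.curCost (s : Phase) : ℝ :=
  open Classical in if s.M = 0 then s.height - s.y₀
  else s.M / s.n * cost (run (serveGrid τ s.n) s.gridPts)

theorem PhaseInv.curCost_le {Q : List Point} {s : Phase} (h : PhaseInv Q s)
    (hQ : ValidRequests Q) {F : List Seg} (hF : Feasible F Q) :
    s.curCost τ ≤ 800 * logRatio s.n *
      (2 * s.M + (costBelow F s.height - costBelow F s.y₀)) := by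
  have hg := one_le_logRatio s.n
  rcases eq_or_ne Q [] with rfl | hne
  · rw [h.init rfl]
    simp [Phase.curCost, phaseInit]
  have hreach : ∀ q ∈ s.pts, Reach F q := fun q hq => hF q (h.suffix.subset hq)
  have hy : ∀ q ∈ s.pts, q.2 ≤ s.height := by
    intro q hq
    obtain ⟨hne', hl⟩ := h.lastY_pts hne
    rw [← hl]
    rcases List.eq_nil_or_concat' s.pts with h0 | ⟨P, p, hP⟩
    · exact absurd h0 hne'
    · have h1 : (s.pts.map Prod.snd).Pairwise (· ≤ ·) :=
        hQ.2.sublist (h.suffix.sublist.map _)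
      rw [hP] at hq h1 ⊢
      rw [lastY_snoc]
      rw [List.map_append, List.pairwise_append] at h1
      rcases List.mem_append.1 hq with hq | hq
      · exact h1.2.2 _ (List.mem_map_of_mem hq) _ (by simp)
      · rw [List.mem_singleton.1 hq]
  unfold Phase.curCost
  split_ifs with hM
  · obtain ⟨hne', hl⟩ := h.lastY_pts hne
    rcases List.eq_nil_or_concat' s.pts with h0 | ⟨P, p, hP⟩
    · exact absurd h0 hne'
    rw [hP, lastY_snoc] at hl
    have hp : p ∈ s.pts := by simp [hP]
    have h1 := add_le_cost (Reach.clip (c := 1) (M := s.M) one_pos (hreach p hp)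
      (h.le_M (h.suffix.subset hp)) h.y₀_nonneg (h.y₀_le p hp) (hy p hp))
    rw [cost_clip zero_le_one h.M_nonneg h.y₀_le_height, hM] at h1
    have h2 := (hQ.1 p (h.suffix.subset hp)).1
    have h3 := costBelow_mono F h.y₀_le_height
    rw [hM]
    have h4 : costBelow F s.height - costBelow F s.y₀ ≤
        800 * logRatio s.n * (costBelow F s.height - costBelow F s.y₀) :=
      le_mul_of_one_le_left (by linarith) (by linarith)
    simp only at h1
    linarith
  · have hMpos : 0 < s.M := lt_of_le_of_ne h.M_nonneg (Ne.symm hM)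
    obtain ⟨hlen, k, -, hk⟩ := h.n_eq hne
    obtain ⟨⟨l, hl⟩, -⟩ := countGuess_spec k
    have hnl : s.n = 4 ^ 4 ^ l := hk.trans hl
    have hn : 0 < s.n := by rw [hnl]; positivity
    have hn' : (0 : ℝ) < s.n := by exact_mod_cast hn
    obtain ⟨hv, hx⟩ := h.gridPts_spec hQ hMpos
    have hF' : Feasible (clip (s.n / s.M) s.M s.y₀ s.height F) s.gridPts := by
      intro q hq
      obtain ⟨b, hb, rfl⟩ := List.mem_map.1 hq
      exact Reach.clip (by positivity) (hreach b hb) (h.le_M (h.suffix.subset hb)) h.y₀_nonneg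
        (h.y₀_le b hb) (hy b hb)
    have hlen' : s.gridPts.length ≤ s.n := by
      rw [Phase.gridPts, List.length_map]
      exact h.suffix.length_le.trans hlen
    have key := cost_run_serveGrid_guess_le τ l hv (hnl ▸ hx) (hnl ▸ hlen') hF'
    rw [← hnl, cost_clip (by positivity) h.M_nonneg h.y₀_le_height] at key
    calc s.M / s.n * cost (run (serveGrid τ s.n) s.gridPts)
        ≤ s.M / s.n * (800 * logRatio s.n * (s.n / s.M * (s.M + (costBelow F s.height -
            costBelow F s.y₀)) + s.n)) := mul_le_mul_of_nonneg_left key (by positivity)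
      _ = _ := by field_simp; ring

/-- The bound for the subsets before the current one grows geometrically, since a new subset doubles
the bound for the coordinates or goes to the next guess for the number of requests. -/
theorem mul_logRatio_le {Q : List Point} {s : Phase} {p : Point} (h : PhaseInv Q s)
    (hp : ¬ (p.1 ≤ s.M ∧ s.count + 1 ≤ s.n)) :
    s.M ≤ xGuess (max s.maxX p.1) ∧ logRatio s.n ≤ logRatio (countGuess (s.count + 1)) ∧
    s.M * logRatio s.n ≤
      3 / 4 * (xGuess (max s.maxX p.1) * logRatio (countGuess (s.count + 1))) := by
  obtain ⟨m, hm0, hm1, hm⟩ := h.M_eq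
  have hm2 : m ≤ max s.maxX p.1 := hm1.trans (le_max_left _ _)
  have hMM : s.M ≤ xGuess (max s.maxX p.1) := hm ▸ xGuess_mono hm0 hm2
  obtain ⟨⟨l', hl'⟩, hi⟩ := countGuess_spec (s.count + 1)
  have hg' := two_le_logRatio_guess l'
  have hg1 := one_le_logRatio s.n
  have hM0 := h.M_nonneg
  rcases eq_or_ne Q [] with rfl | hne
  · have hinit := h.init rfl
    have h1 : s.M = 0 := by rw [hinit]; rfl
    have h2 : s.n = 0 := by rw [hinit]; rfl
    have h3 : logRatio s.n ≤ logRatio (countGuess (s.count + 1)) := by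
      have : logRatio s.n = 2 := by
        rw [h2]
        have := logRatio_guess 0
        norm_num [logRatio] at this ⊢
        exact this
      rw [this, hl']
      exact hg'
    refine ⟨hMM, h3, ?_⟩
    rw [h1, zero_mul]
    rw [h1] at hMM
    rw [hl']
    positivity
  obtain ⟨-, k, hk, hkn⟩ := h.n_eq hne
  obtain ⟨⟨l, hl⟩, -⟩ := countGuess_spec k
  have hnl : s.n = 4 ^ 4 ^ l := hkn.trans hl
  have hnn : s.n ≤ countGuess (s.count + 1) := by
    rw [hkn]
    exact countGuess_mono (by rw [h.count]; omega)
  have hll : l ≤ l' := by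
    rw [hnl, hl'] at hnn
    exact guess_strictMono.le_iff_le.1 hnn
  have hgg : logRatio s.n ≤ logRatio (countGuess (s.count + 1)) := by
    rw [hnl, hl']
    exact logRatio_guess_mono hll
  refine ⟨hMM, hgg, ?_⟩
  by_cases hpM : p.1 ≤ s.M
  · have hcn : s.n < s.count + 1 := not_le.1 fun hc => hp ⟨hpM, hc⟩
    have hlt : l + 1 ≤ l' := by
      have := hcn.trans_le hi
      rw [hnl, hl'] at this
      exact guess_strictMono.lt_iff_lt.1 this
    have h1 := (logRatio_guess_succ l).1
    have h2 : logRatio (4 ^ 4 ^ (l + 1)) ≤ logRatio (4 ^ 4 ^ l') := logRatio_guess_mono hlt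
    rw [hl']
    rw [hnl] at hg1 ⊢
    calc s.M * logRatio (4 ^ 4 ^ l) ≤
        xGuess (max s.maxX p.1) * (3 / 4 * logRatio (4 ^ 4 ^ l')) :=
          mul_le_mul hMM (by linarith) (by linarith) (hM0.trans hMM)
      _ = _ := by ring
  · have h1 : 2 * s.M ≤ xGuess (max s.maxX p.1) := by
      have h2 : xGuess m < max s.maxX p.1 := by
        rw [← hm]
        exact (not_le.1 hpM).trans_le (le_max_right _ _)
      exact hm ▸ two_mul_xGuess_le hm0 h2
    have h3 : s.M * logRatio s.n ≤
        xGuess (max s.maxX p.1) / 2 * logRatio (countGuess (s.count + 1)) :=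
      mul_le_mul (by linarith) hgg (by linarith) (by linarith)
    have h4 : 0 ≤ xGuess (max s.maxX p.1) * logRatio (countGuess (s.count + 1)) :=
      mul_nonneg (hM0.trans hMM) (by linarith)
    linarith

/-- The subsets before the current one are paid for by the part of `F` below the origin of the current
subset, and by a multiple of the guess `M`. -/
theorem cost_run_onRSA_aux {Q : List Point} (hQ : ValidRequests Q) {F : List Seg}
    (hF : Feasible F Q) : cost (run (onRSA τ) Q) ≤ (phaseOf Q).curCost τ +
      800 * logRatio (phaseOf Q).n * (costBelow F (phaseOf Q).y₀ + 6 * (phaseOf Q).M) := by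
  induction Q using List.reverseRecOn with
  | nil =>
    have h1 := costBelow_nonneg F 0
    have h2 := one_le_logRatio 0
    have h3 : 0 ≤ 800 * logRatio 0 * costBelow F 0 := by positivity
    simpa [phaseOf, phaseInit, Phase.curCost, run, runFrom, cost] using h3
  | append_singleton Q p ih =>
    have h := phaseInv hQ.snoc.1
    have h' := phaseInv hQ
    have hstep := phaseOf_snoc Q p
    obtain ⟨hQ1, ⟨hp1, hp2⟩, hp3, hp4⟩ := hQ.snoc
    have hFQ : Feasible F Q := fun q hq => hF q (by simp [hq])
    have hhp : (phaseOf Q).height ≤ p.2 := h.height.trans_le hp3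
    obtain ⟨P, hP, hcases⟩ := phaseStep_pts (p := p) h
    have hon := onRSA_eq τ Q p
    have ih := ih hQ1 hFQ
    have hcur := h.curCost_le τ hQ1 hFQ
    rw [← hstep] at hP hcases
    rw [run_snoc, cost_append]
    set s := phaseOf Q with hs
    set s' := phaseOf (Q ++ [p]) with hs'
    have hheight : s'.height = p.2 := by rw [h'.height, lastY_snoc]
    have hgp : s'.gridPts = P.map (toGrid s'.M s'.n s'.y₀) ++ [toGrid s'.M s'.n s'.y₀ p] := by
      simp [Phase.gridPts, hP]
    rcases hcases with ⟨h1, h5, h2, h3, h4⟩ | ⟨h1, h2, h3, h4, h5⟩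
    · have key : cost (onRSA τ Q p) + s.curCost τ = s'.curCost τ := by
        unfold Phase.curCost
        rw [hon, hgp, h1, h2, h3, h4, hheight, hP, List.dropLast_concat, h1]
        split_ifs with hM
        · simp only [cost, List.map_cons, List.map_nil, List.sum_cons, List.sum_nil, Seg.length,
            add_zero]
          rw [abs_of_nonneg (by linarith)]
          ring
        · rw [cost_map_ofGrid h.M_nonneg, run_snoc, cost_append, mul_add, add_comm]
          rfl
      rw [h3, h4, h2]
      linarith
    · have key : cost (onRSA τ Q p) = s'.curCost τ := by
        unfold Phase.curCost
        rw [hon, hgp, hheight, hP, List.dropLast_concat, h1, h4]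
        split_ifs with hM
        · simp only [cost, List.map_cons, List.map_nil, List.sum_cons, List.sum_nil, Seg.length,
            add_zero]
          rw [abs_of_nonneg (by linarith)]
        · rw [cost_map_ofGrid h'.M_nonneg]
          simp [run, runFrom]
      obtain ⟨-, e1, e2⟩ := mul_logRatio_le h h5
      rw [← h2, ← h3] at e2
      rw [← h3] at e1
      have e3 : logRatio s.n * costBelow F s.height ≤ logRatio s'.n * costBelow F s.height :=
        mul_le_mul_of_nonneg_right e1 (costBelow_nonneg _ _)
      rw [h4]
      linarith

/-- The algorithm is competitive against every solution. -/
theorem cost_run_onRSA_le {Q : List Point} (hQ : ValidRequests Q) {F : List Seg}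
    (hF : Feasible F Q) :
    cost (run (onRSA τ) Q) ≤ 108800 * logRatio Q.length * cost F := by
  have hf := one_le_logRatio Q.length
  have hc := cost_nonneg F
  rcases eq_or_ne Q [] with rfl | hne
  · simp only [run, runFrom, cost, List.map_nil, List.sum_nil]
    positivity
  have h := phaseInv hQ
  have h1 := cost_run_onRSA_aux τ hQ hF
  have h2 := h.curCost_le τ hQ hF
  set s := phaseOf Q with hs
  have h3 : s.maxX ≤ cost F := by
    rcases h.maxX_mem with h4 | ⟨q, hq, h4⟩
    · rw [h4]
      exact hc
    · have := add_le_cost (hF q hq)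
      linarith [(hQ.1 q hq).2]
  have h4 : s.M ≤ 2 * cost F := by
    obtain ⟨m, hm0, hm1, hm⟩ := h.M_eq
    rw [hm]
    linarith [xGuess_le hm0]
  have h5 := costBelow_le F s.height
  obtain ⟨-, k, hk, hkn⟩ := h.n_eq hne
  have h6 : logRatio s.n ≤ 8 * logRatio Q.length := hkn ▸ logRatio_countGuess_le hk
  have h7 := one_le_logRatio s.n
  calc cost (run (onRSA τ) Q) ≤ 800 * logRatio s.n * (costBelow F s.height + 8 * s.M) := by
        linarith
    _ ≤ 800 * (8 * logRatio Q.length) * (17 * cost F) :=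
        mul_le_mul (by linarith) (by linarith)
          (add_nonneg (costBelow_nonneg _ _) (by linarith [h.M_nonneg])) (by positivity)
    _ = _ := by ring

end OnRSA

theorem le_mul_optCost {Q : List Point} {a K : ℝ} (hK : 0 < K) (hne : ∃ F, Feasible F Q)
    (h : ∀ F, Feasible F Q → a ≤ K * cost F) : a ≤ K * optCost Q := by
  rw [← div_le_iff₀' hK]
  obtain ⟨F₀, hF₀⟩ := hne
  refine le_csInf ⟨_, F₀, hF₀, rfl⟩ ?_
  rintro _ ⟨F, hF, rfl⟩
  rw [div_le_iff₀' hK]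
  exact h F hF

theorem cost_run_onRSA_le_optCost (τ : TieBreak) {Q : List Point} (hQ : ValidRequests Q) :
    cost (run (onRSA τ) Q) ≤ 108800 * logRatio Q.length * optCost Q :=
  le_mul_optCost (by linarith [one_le_logRatio Q.length])
    ⟨_, (solutionInv τ hQ).feasible⟩ fun _ hF => cost_run_onRSA_le τ hQ hF

/-! ### The lower bound -/

/-- The horizontal slab of height one above the height `y`. -/
def slab (y : ℝ) : Set Point := {z | y < z.2 ∧ z.2 ≤ y + 1}

/-- The box of height one above the height `y` between the coordinates `a` and `b`. -/
def box (a b y : ℝ) : Set Point := {z | (a < z.1 ∧ z.1 ≤ b) ∧ y < z.2 ∧ z.2 < y + 1}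

theorem measurableSet_slab (y : ℝ) : MeasurableSet (slab y) :=
  (measurableSet_lt measurable_const measurable_snd).inter
    (measurableSet_le measurable_snd measurable_const)

theorem measurableSet_box (a b y : ℝ) : MeasurableSet (box a b y) :=
  ((measurableSet_lt measurable_const measurable_fst).inter
    (measurableSet_le measurable_fst measurable_const)).inter
    ((measurableSet_lt measurable_const measurable_snd).inter
      (measurableSet_lt measurable_snd measurable_const))

/-- A path to a point at the height `y + 1` spends the length `w` in the slab above `y`, or it rises
from the height `y` to the height `y + 1` within the last `w` units of the `x`-coordinate. -/
theorem CurveTo.slab_or_box {F : List Seg} {q : Point} {γ : ℝ → Point} (h : CurveTo F q γ)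
    {y w : ℝ} (hy : 0 ≤ y) (hq : q.2 = y + 1) (hw : w ≤ q.1) :
    ENNReal.ofReal w ≤ lenMeasure F (slab y) ∨ 1 ≤ lenMeasure F (box (q.1 - w) q.1 y) := by
  set G := q.1 + q.2 with hG
  have hIcc : ∀ z ∈ Ioo (G - w) G, z ∈ Icc 0 G := fun z hz => ⟨by linarith [hz.1], hz.2.le⟩
  have hx : ∀ z ∈ Ioo (G - w) G, q.1 - w < (γ z).1 ∧ (γ z).1 ≤ q.1 ∧ (γ z).2 ≤ y + 1 := by
    intro z hz
    obtain ⟨h1, h2⟩ := h.le_end (hIcc z hz)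
    have h3 := h.sum_eq z (hIcc z hz)
    exact ⟨by linarith [hz.1], h1, hq ▸ h2⟩
  by_cases hlow : ∀ z ∈ Ioo (G - w) G, y < (γ z).2
  · left
    have h1 := h.ofReal_le (measurableSet_slab y) (a := G - w) (b := G) (by linarith) le_rfl
      (fun z hz => ⟨hlow z hz, (hx z hz).2.2⟩)
    rwa [sub_sub_cancel] at h1
  · right
    push Not at hlow
    obtain ⟨z₀, hz₀, hyz₀⟩ := hlow
    -- the last time at which the path is at the height `y`
    set S := {z | z ∈ Ioo (G - w) G ∧ (γ z).2 ≤ y} with hS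
    have hne : S.Nonempty := ⟨z₀, hz₀, hyz₀⟩
    have hbd : BddAbove S := ⟨G, fun z hz => hz.1.2.le⟩
    set z₁ := sSup S with hz₁
    have h01 : z₀ ≤ z₁ := le_csSup hbd ⟨hz₀, hyz₀⟩
    have hrise : ∀ z ∈ Icc 0 G, z₁ ≤ z → (γ z).2 ≤ y + (z - z₁) := by
      intro z hz hzz
      have h1 : ∀ s ∈ S, s ≤ y + z - (γ z).2 := by
        intro s hs
        have h2 := h.mono (hIcc s hs.1) hz ((le_csSup hbd hs).trans hzz)
        have h3 := h.sum_eq z hz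
        have h4 := h.sum_eq s (hIcc s hs.1)
        linarith [h2.1, hs.2]
      have := csSup_le hne h1
      linarith
    have h1G : z₁ + 1 ≤ G := by
      have h1 : z₁ ≤ G := csSup_le hne fun z hz => hz.1.2.le
      have h2 := hrise G ⟨by linarith [hz₀.1, hz₀.2], le_rfl⟩ h1
      rw [h.last, hq] at h2
      linarith
    have h1 := h.ofReal_le (measurableSet_box (q.1 - w) q.1 y) (a := z₁) (b := z₁ + 1)
      (by linarith [hz₀.1]) h1G ?_
    · simpa using h1
    · intro z hz
      have hzG : z ∈ Ioo (G - w) G := ⟨by linarith [hz₀.1, hz.1], by linarith [hz.2]⟩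
      obtain ⟨h2, h3, -⟩ := hx z hzG
      refine ⟨⟨h2, h3⟩, ?_, ?_⟩
      · by_contra hle
        have := le_csSup hbd (show z ∈ S from ⟨hzG, not_lt.1 hle⟩)
        linarith [hz.1]
      · have := hrise z (hIcc z hzG) hz.1.le
        linarith [hz.2]

theorem lenMeasure_le_append (F F' : List Seg) (B : Set Point) :
    lenMeasure F B ≤ lenMeasure (F ++ F') B := by
  rw [lenMeasure_append]
  exact le_self_add

theorem ValidRequests.concat {Q : List Point} {p : Point} (h : ValidRequests Q) (h1 : 0 ≤ p.1)
    (h2 : 0 ≤ p.2) (h3 : ∀ q ∈ Q, q.2 ≤ p.2) : ValidRequests (Q ++ [p]) := by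
  refine ⟨?_, ?_⟩
  · intro q hq
    rcases List.mem_append.1 hq with hq | hq
    · exact h.1 q hq
    · rw [List.mem_singleton.1 hq]
      exact ⟨h1, h2⟩
  · rw [List.map_append, List.pairwise_append]
    refine ⟨h.2, by simp, ?_⟩
    intro a ha b hb
    obtain ⟨q, hq, rfl⟩ := List.mem_map.1 ha
    rw [List.map_singleton, List.mem_singleton] at hb
    rw [hb]
    exact h3 q hq

/-- The requests of the adversary, up to the `i`-th step of the staircase: the points
`(n + k + 1, k + 1)` of the staircase and, where `x k ≠ 0`, requests at the same height,
`x k` to the left. -/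
structure Staircase (n : ℕ) (x : ℕ → ℕ) (i : ℕ) (H : List Point) : Prop where
  valid : ValidRequests H
  nodup : H.Nodup
  length_le : H.length ≤ 2 * i
  mem : ∀ q ∈ H, ∃ k < i, q.2 = k + 1 ∧
    (q.1 = n + k + 1 ∨ x k ≠ 0 ∧ q.1 = n + k + 1 - x k)

variable {A : Algorithm} {L : ℕ}

/-- Against every online algorithm, the adversary can force the length `L / 4 * (1 + x k)` in each slab:
either the algorithm has length at least one in each of the `L` boxes of widths `(L - 1) * L ^ l` to
the left of the step, or a request at the right end of a box with less length costs it the width of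
the box. -/
theorem exists_staircase (hA : IsOnline A) (hL : 2 ≤ L) (i : ℕ) :
    ∃ (x : ℕ → ℕ) (H : List Point), Staircase (L ^ L) x i H ∧ (∀ k, x k ≤ L ^ L) ∧
      ∀ k < i, ENNReal.ofReal ((L : ℝ) / 4 * (1 + x k)) ≤ lenMeasure (run A H) (slab k) := by
  induction i with
  | zero =>
    exact ⟨fun _ => 0, [], ⟨⟨by simp, by simp⟩, by simp, by simp, by simp⟩, by simp, by simp⟩
  | succ i ih =>
    obtain ⟨x, H, hH, hxn, hlen⟩ := ih
    have hL' : (2 : ℝ) ≤ L := by exact_mod_cast hL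
    have hheight : ∀ q ∈ H, q.2 ≤ i := by
      intro q hq
      obtain ⟨k, hk, h1, -⟩ := hH.mem q hq
      rw [h1]
      exact_mod_cast hk
    set X : ℝ := (L ^ L : ℕ) + i + 1 with hX
    set m : Point := (X, i + 1) with hm
    have hX0 : 0 ≤ X := by positivity
    have hval : ValidRequests (H ++ [m]) := hH.valid.concat hX0 (by positivity)
      fun q hq => (hheight q hq).trans (by simp [hm])
    have hmH : ∀ a : ℝ, ((a, (i : ℝ) + 1) : Point) ∉ H := by
      intro a ha
      have := hheight _ ha
      simp only at this
      linarith
    have hnodup : (H ++ [m]).Nodup := by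
      rw [List.nodup_append]
      refine ⟨hH.nodup, by simp, ?_⟩
      rintro a ha b hb rfl
      rw [List.mem_singleton] at hb
      rw [hb] at ha
      exact hmH X ha
    -- the requests before the new step keep their description
    have hold : ∀ v, ∀ q ∈ H, ∃ k < i + 1, q.2 = k + 1 ∧ (q.1 = (L ^ L : ℕ) + k + 1 ∨
        Function.update x i v k ≠ 0 ∧
          q.1 = (L ^ L : ℕ) + k + 1 - Function.update x i v k) := by
      intro v q hq
      obtain ⟨k, hk, h1⟩ := hH.mem q hq
      refine ⟨k, hk.trans (Nat.lt_succ_self i), ?_⟩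
      rwa [Function.update_of_ne hk.ne]
    have hupd : ∀ v, v ≤ L ^ L → ∀ k, Function.update x i v k ≤ L ^ L := by
      intro v hv k
      rcases eq_or_ne k i with rfl | hk
      · rwa [Function.update_self]
      · rw [Function.update_of_ne hk]
        exact hxn k
    have hmono : ∀ (v : ℕ) (G : List Point), ∀ k < i,
        ENNReal.ofReal ((L : ℝ) / 4 * (1 + Function.update x i v k)) ≤
          lenMeasure (run A (H ++ G)) (slab k) := by
      intro v G k hk
      rw [Function.update_of_ne hk.ne, run_append]
      exact (hlen k hk).trans (lenMeasure_le_append _ _ _)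
    by_cases hbox : ∃ l < L, lenMeasure (run A (H ++ [m]))
        (box (X - (L ^ (l + 1) : ℕ)) (X - (L ^ l : ℕ)) i) < 1
    · obtain ⟨l, hl, hlt⟩ := hbox
      have hlL : L ^ l ≤ L ^ L := Nat.pow_le_pow_right (by omega) hl.le
      have hlL' : ((L ^ (l + 1) : ℕ) : ℝ) ≤ (L ^ L : ℕ) := by
        exact_mod_cast Nat.pow_le_pow_right (by omega) hl
      have hpos : 0 < L ^ l := by positivity
      have hpos' : (1 : ℝ) ≤ (L ^ l : ℕ) := by exact_mod_cast hpos
      have hsucc : ((L ^ (l + 1) : ℕ) : ℝ) = L * (L ^ l : ℕ) := by push_cast; ring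
      set q : Point := (X - (L ^ l : ℕ), i + 1) with hq
      have hval' : ValidRequests (H ++ [m] ++ [q]) := by
        refine hval.concat ?_ (by positivity) ?_
        · have : ((L ^ l : ℕ) : ℝ) ≤ (L ^ L : ℕ) := by exact_mod_cast hlL
          simp only [hq, hX]
          linarith [show (0 : ℝ) ≤ i from Nat.cast_nonneg i]
        · intro a ha
          rcases List.mem_append.1 ha with ha | ha
          · exact (hheight a ha).trans (by simp [hq])
          · rw [List.mem_singleton.1 ha]
      obtain ⟨g1, g2⟩ := hA _ _ hval'
      refine ⟨Function.update x i (L ^ l), H ++ [m] ++ [q], ⟨hval', ?_, ?_, ?_⟩,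
        hupd _ hlL, ?_⟩
      · rw [List.nodup_append]
        refine ⟨hnodup, by simp, ?_⟩
        rintro a ha b hb rfl
        rw [List.mem_singleton] at hb
        rw [hb] at ha
        rcases List.mem_append.1 ha with ha | ha
        · exact hmH _ ha
        · have := congrArg Prod.fst (List.mem_singleton.1 ha)
          simp only [hq, hm] at this
          linarith
      · have := hH.length_le
        simp only [List.length_append, List.length_singleton]
        omega
      · intro a ha
        rcases List.mem_append.1 ha with ha | ha
        · rcases List.mem_append.1 ha with ha | ha
          · exact hold _ a ha
          · rw [List.mem_singleton.1 ha]
            exact ⟨i, Nat.lt_succ_self i, rfl, Or.inl rfl⟩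
        · rw [List.mem_singleton.1 ha]
          refine ⟨i, Nat.lt_succ_self i, rfl, Or.inr ?_⟩
          rw [Function.update_self]
          exact ⟨hpos.ne', rfl⟩
      · intro k hk
        rcases Nat.lt_succ_iff_lt_or_eq.1 hk with hk | rfl
        · rw [List.append_assoc]
          exact hmono _ _ k hk
        · rw [Function.update_self]
          obtain ⟨γ, hγ⟩ := exists_curveTo (g2 q (by simp))
          rcases hγ.slab_or_box (y := k) (w := (L - 1) * (L ^ l : ℕ)) (Nat.cast_nonneg k) rfl
            (by simp only [hq, hX]; linarith [show (0 : ℝ) ≤ k from Nat.cast_nonneg k]) with h1 | h1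
          · refine (ENNReal.ofReal_le_ofReal ?_).trans h1
            have h2 : (L : ℝ) / 2 * (L ^ l : ℕ) ≤ (L - 1) * (L ^ l : ℕ) :=
              mul_le_mul_of_nonneg_right (by linarith) (by linarith)
            have h3 : (L : ℝ) / 4 * (1 + (L ^ l : ℕ)) ≤ L / 4 * (2 * (L ^ l : ℕ)) :=
              mul_le_mul_of_nonneg_left (by linarith) (by linarith)
            linarith
          · -- the new segments lie above the box
            exfalso
            have h2 : q.1 - (L - 1) * (L ^ l : ℕ) = X - (L ^ (l + 1) : ℕ) := by
              simp only [hq, hsucc]; ring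
            have h3 : lenMeasure (A (H ++ [m]) q)
                (box (X - (L ^ (l + 1) : ℕ)) (X - (L ^ l : ℕ)) k) = 0 := by
              refine lenMeasure_eq_zero (measurableSet_box _ _ _) fun s hs z hz hzb => ?_
              have h4 := g1 s hs z hz
              rw [lastY_snoc] at h4
              exact absurd hzb.2.2 (not_lt.2 h4)
            rw [h2, run_snoc, lenMeasure_append] at h1
            simp only [hq] at h1 h3
            rw [h3, add_zero] at h1
            exact absurd hlt (not_lt.2 h1)
    · push Not at hbox
      refine ⟨Function.update x i 0, H ++ [m], ⟨hval, hnodup, ?_, ?_⟩, hupd _ (Nat.zero_le _), ?_⟩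
      · have := hH.length_le
        simp only [List.length_append, List.length_singleton]
        omega
      · intro a ha
        rcases List.mem_append.1 ha with ha | ha
        · exact hold _ a ha
        · rw [List.mem_singleton.1 ha]
          exact ⟨i, Nat.lt_succ_self i, rfl, Or.inl rfl⟩
      · intro k hk
        rcases Nat.lt_succ_iff_lt_or_eq.1 hk with hk | rfl
        · exact hmono _ _ k hk
        · rw [Function.update_self]
          set Z : ℕ → Set Point := fun l => box (X - (L ^ (l + 1) : ℕ)) (X - (L ^ l : ℕ)) k with hZ
          have hd : ((Finset.range L : Finset ℕ) : Set ℕ).PairwiseDisjoint Z := by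
            have hlt : ∀ l l', l < l' → Disjoint (Z l) (Z l') := by
              intro l l' hll
              rw [Set.disjoint_left]
              intro z h1 h2
              have h3 : ((L ^ (l + 1) : ℕ) : ℝ) ≤ (L ^ l' : ℕ) := by
                exact_mod_cast Nat.pow_le_pow_right (by omega) hll
              linarith [h1.1.1, h2.1.2]
            intro l _ l' _ hne
            rcases lt_or_gt_of_ne hne with h1 | h1
            · exact hlt _ _ h1
            · exact (hlt _ _ h1).symm
          calc ENNReal.ofReal ((L : ℝ) / 4 * (1 + (0 : ℕ))) ≤ ENNReal.ofReal L :=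
                ENNReal.ofReal_le_ofReal (by push_cast; linarith)
            _ = ∑ l ∈ Finset.range L, 1 := by simp
            _ ≤ ∑ l ∈ Finset.range L, lenMeasure (run A (H ++ [m])) (Z l) :=
                Finset.sum_le_sum fun l hl => hbox l (Finset.mem_range.1 hl)
            _ = lenMeasure (run A (H ++ [m])) (⋃ l ∈ Finset.range L, Z l) :=
                (measure_biUnion_finset hd fun l _ => measurableSet_box _ _ _).symm
            _ ≤ _ := measure_mono (iUnion₂_subset fun l _ z (hz : z ∈ Z l) =>
                show z ∈ slab k from ⟨hz.2.1, hz.2.2.le⟩)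

/-- A solution for the requests of the adversary: the staircase, vertical segments below the other
requests that start on the staircase or on the `x`-axis, and a vertical segment at the end. -/
noncomputable def stairSol (n : ℕ) (x : ℕ → ℕ) : List Seg :=
  .horiz 0 0 n :: .vert (n + n) n (n + 1) :: (List.range n).flatMap fun i : ℕ =>
    [.horiz (i : ℕ) (n + (i : ℕ)) (n + (i : ℕ) + 1), .vert (n + (i : ℕ) + 1) (i : ℕ) ((i : ℕ) + 1),
      .vert (n + (i : ℕ) + 1 - x i) (max 0 ((i : ℕ) + 1 - x i)) ((i : ℕ) + 1)]

theorem cost_stairSol_le (n : ℕ) (x : ℕ → ℕ) :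
    cost (stairSol n x) ≤ 3 * n + 1 + ∑ i ∈ Finset.range n, (x i : ℝ) := by
  have h : ∀ i : ℕ, cost [Seg.horiz (i : ℕ) (n + (i : ℕ)) (n + (i : ℕ) + 1),
      Seg.vert (n + (i : ℕ) + 1) (i : ℕ) ((i : ℕ) + 1),
      Seg.vert (n + (i : ℕ) + 1 - x i) (max 0 ((i : ℕ) + 1 - x i)) ((i : ℕ) + 1)] ≤ 2 + x i := by
    intro i
    have hx : (0 : ℝ) ≤ x i := Nat.cast_nonneg _
    have hi : (0 : ℝ) ≤ i := Nat.cast_nonneg _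
    simp only [cost, List.map_cons, List.map_nil, List.sum_cons, List.sum_nil, Seg.length, add_zero]
    rw [add_sub_cancel_left, add_sub_cancel_left, abs_one,
      abs_of_nonneg (sub_nonneg.2 (max_le (by linarith) (by linarith)))]
    linarith [le_max_right (0 : ℝ) (i + 1 - x i)]
  have hsum : ((List.range n).map fun i : ℕ => (2 + x i : ℝ)).sum =
      2 * n + ∑ i ∈ Finset.range n, (x i : ℝ) := by
    have : ((List.range n).map fun i : ℕ => (2 + x i : ℝ)).sum =
        ∑ i ∈ Finset.range n, (2 + x i : ℝ) := rfl
    rw [this, Finset.sum_add_distrib]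
    simp
    ring
  rw [stairSol, cost_cons, cost_cons, cost_flatMap]
  have h1 := List.sum_le_sum (l := List.range n) fun i _ => h i
  rw [hsum] at h1
  simp only [Seg.length]
  rw [sub_zero, add_sub_cancel_left, abs_one, abs_of_nonneg (Nat.cast_nonneg n)]
  linarith

theorem reach_stairSol {n : ℕ} (x : ℕ → ℕ) {k : ℕ} (hk : k ≤ n) :
    Reach (stairSol n x) (n + k, k) := by
  induction k with
  | zero =>
    have h : Reach (stairSol n x) ((n : ℝ), 0) :=
      Reach.horiz (c := 0) Relation.ReflTransGen.refl List.mem_cons_self le_rfl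
        (Nat.cast_nonneg n) le_rfl
    simpa using h
  | succ k ih =>
    have hmem : ∀ s ∈ [Seg.horiz (k : ℕ) (n + (k : ℕ)) (n + (k : ℕ) + 1),
        Seg.vert (n + (k : ℕ) + 1) (k : ℕ) ((k : ℕ) + 1),
        Seg.vert (n + (k : ℕ) + 1 - x k) (max 0 ((k : ℕ) + 1 - x k)) ((k : ℕ) + 1)],
        s ∈ stairSol n x := fun s hs => List.mem_cons_of_mem _ (List.mem_cons_of_mem _
      (List.mem_flatMap.2 ⟨k, List.mem_range.2 hk, hs⟩))
    have h1 := Reach.horiz (ih (by omega)) (hmem _ (by simp)) le_rfl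
      (show (n : ℝ) + k ≤ n + k + 1 by linarith) le_rfl
    have h2 := Reach.vert h1 (hmem (.vert (n + k + 1) k (k + 1)) (by simp)) le_rfl
      (show (k : ℝ) ≤ k + 1 by linarith) le_rfl
    push_cast
    rwa [← add_assoc]

theorem Staircase.feasible {n : ℕ} {x : ℕ → ℕ} {H : List Point} (h : Staircase n x n H)
    (hx : ∀ k, x k ≤ n) : Feasible (stairSol n x) H := by
  intro q hq
  obtain ⟨k, hk, h2, h1⟩ := h.mem q hq
  obtain ⟨a, b⟩ := q
  simp only at h1 h2
  subst h2
  rcases h1 with rfl | ⟨-, rfl⟩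
  · have := reach_stairSol x (show k + 1 ≤ n from hk)
    push_cast at this
    rwa [← add_assoc] at this
  · have hmem : Seg.vert (n + (k : ℕ) + 1 - x k) (max 0 ((k : ℕ) + 1 - x k)) ((k : ℕ) + 1) ∈
        stairSol n x := List.mem_cons_of_mem _ (List.mem_cons_of_mem _
      (List.mem_flatMap.2 ⟨k, List.mem_range.2 hk, by simp⟩))
    have hk0 : (0 : ℝ) ≤ k := Nat.cast_nonneg k
    have hx0 : (0 : ℝ) ≤ x k := Nat.cast_nonneg _
    have hxn : (x k : ℝ) ≤ n := by exact_mod_cast hx k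
    have hbase : Reach (stairSol n x) (n + (k : ℕ) + 1 - x k, max 0 ((k : ℕ) + 1 - x k)) := by
      rcases le_total (x k) (k + 1) with hle | hle
      · have h3 := reach_stairSol x (show k + 1 - x k ≤ n by omega)
        have hle' : (x k : ℝ) ≤ k + 1 := by exact_mod_cast hle
        rw [Nat.cast_sub hle] at h3
        push_cast at h3
        rw [max_eq_right (by linarith)]
        have e : (n : ℝ) + k + 1 - x k = n + (k + 1 - x k) := by ring
        rwa [e]
      · have hle' : (k : ℝ) + 1 ≤ x k := by exact_mod_cast hle
        rw [max_eq_left (by linarith)]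
        exact Reach.horiz (c := 0) Relation.ReflTransGen.refl List.mem_cons_self le_rfl
          (by linarith) (by linarith)
    exact Reach.vert hbase hmem le_rfl (max_le (by linarith) (by linarith)) le_rfl

theorem optCost_le {Q : List Point} {F : List Seg} (hF : Feasible F Q) : optCost Q ≤ cost F := by
  refine csInf_le ⟨0, ?_⟩ ⟨F, hF, rfl⟩
  rintro _ ⟨F', -, rfl⟩
  exact cost_nonneg F'

theorem add_le_optCost {Q : List Point} {q : Point} (hq : q ∈ Q) (hne : ∃ F, Feasible F Q) :
    q.1 + q.2 ≤ optCost Q := by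
  rw [← one_mul (optCost Q)]
  exact le_mul_optCost one_pos hne fun F hF => by simpa using add_le_cost (hF q hq)

/-- The optimum pays at most `4 * (1 + x k)` for each step of the staircase, and the algorithm at least
`L / 4 * (1 + x k)`. -/
theorem exists_requests_of_le (hA : IsOnline A) (hL : 2 ≤ L) {N : ℕ} (hN : 2 * L ^ L ≤ N) :
    ∃ Q : List Point, ValidRequests Q ∧ Q.Nodup ∧ Q.length = N ∧ 0 < optCost Q ∧
      (L : ℝ) / 16 * optCost Q ≤ cost (run A Q) := by
  obtain ⟨x, H, hH, hx, hlen⟩ := exists_staircase hA hL (L ^ L)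
  set n := L ^ L with hn
  have hn1 : 1 ≤ n := Nat.one_le_pow _ _ (by omega)
  have hn1' : (1 : ℝ) ≤ n := by exact_mod_cast hn1
  have hHN := hH.length_le.trans hN
  have hN0 : (0 : ℝ) < N := by exact_mod_cast (by omega : 0 < N)
  -- further requests above the last step fill up the sequence
  set f : ℕ → Point := fun j => ((n : ℝ) + n, n + (j + 1) / N) with hf
  set P := (List.range (N - H.length)).map f with hP
  have hfn : ∀ j, (n : ℝ) < (f j).2 := fun j => by
    have : (0 : ℝ) < (j + 1) / N := by positivity
    simp only [hf]
    linarith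
  have hHn : ∀ q ∈ H, q.2 ≤ n := by
    intro q hq
    obtain ⟨k, hk, h1, -⟩ := hH.mem q hq
    rw [h1]
    exact_mod_cast hk
  have hfmono : ∀ i j : ℕ, i < j → (f i).2 < (f j).2 := by
    intro i j hij
    have : (i : ℝ) < j := by exact_mod_cast hij
    simp only [hf]
    gcongr
  have hval : ValidRequests (H ++ P) := by
    refine ⟨?_, ?_⟩
    · intro q hq
      rcases List.mem_append.1 hq with hq | hq
      · exact hH.valid.1 q hq
      · obtain ⟨j, -, rfl⟩ := List.mem_map.1 hq
        exact ⟨by positivity, by linarith [hfn j]⟩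
    · rw [List.map_append, List.pairwise_append]
      refine ⟨hH.valid.2, ?_, ?_⟩
      · rw [hP, List.map_map, List.pairwise_map]
        exact List.pairwise_lt_range.imp fun h => (hfmono _ _ h).le
      · intro a ha b hb
        obtain ⟨q, hq, rfl⟩ := List.mem_map.1 ha
        obtain ⟨r, hr, rfl⟩ := List.mem_map.1 hb
        obtain ⟨j, -, rfl⟩ := List.mem_map.1 hr
        exact (hHn q hq).trans (hfn j).le
  have hfeas : Feasible (stairSol n x) (H ++ P) := by
    intro q hq
    rcases List.mem_append.1 hq with hq | hq
    · exact hH.feasible hx q hq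
    · obtain ⟨j, hj, rfl⟩ := List.mem_map.1 hq
      refine Reach.vert (reach_stairSol x le_rfl) (a := n) (b := n + 1) ?_ le_rfl
        (hfn j).le ?_
      · exact List.mem_cons_of_mem _ List.mem_cons_self
      · have : ((j : ℝ) + 1) / N ≤ 1 := by
          rw [div_le_one hN0]
          have := List.mem_range.1 hj
          exact_mod_cast (by omega : j + 1 ≤ N)
        linarith
  refine ⟨H ++ P, hval, ?_, ?_, ?_, ?_⟩
  · rw [List.nodup_append]
    refine ⟨hH.nodup, ?_, ?_⟩
    · refine List.nodup_range.map fun i j hij => ?_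
      rcases lt_trichotomy i j with h | h | h
      · exact absurd (congrArg Prod.snd hij) (hfmono _ _ h).ne
      · exact h
      · exact absurd (congrArg Prod.snd hij) (hfmono _ _ h).ne'
    · rintro a ha b hb rfl
      obtain ⟨j, -, rfl⟩ := List.mem_map.1 hb
      exact absurd (hHn _ ha) (not_le.2 (hfn j))
  · rw [List.length_append, hP, List.length_map, List.length_range]
    omega
  · have hpos : 0 < (H ++ P).length := by
      rw [List.length_append, hP, List.length_map, List.length_range]
      omega
    obtain ⟨q, hq⟩ := List.exists_mem_of_length_pos hpos
    refine lt_of_lt_of_le ?_ (add_le_optCost hq ⟨_, hfeas⟩)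
    have h1 := (hval.1 q hq).1
    rcases List.mem_append.1 hq with hq | hq
    · obtain ⟨k, -, h2, -⟩ := hH.mem q hq
      rw [h2]
      positivity
    · obtain ⟨j, -, rfl⟩ := List.mem_map.1 hq
      linarith [hfn j]
  · have h1 := (optCost_le hfeas).trans (cost_stairSol_le n x)
    have h2 : ∑ k ∈ Finset.range n, ((L : ℝ) / 4 * (1 + x k)) ≤ cost (run A H) := by
      refine sum_le_cost _ (fun k : ℕ => slab k) _ (fun k _ => measurableSet_slab k) ?_
        fun k hk => hlen k (Finset.mem_range.1 hk)
      have hlt : ∀ k l : ℕ, k < l → Disjoint (slab k) (slab l) := by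
        intro k l hkl
        rw [Set.disjoint_left]
        intro z h3 h4
        have h5 : (k : ℝ) + 1 ≤ l := by exact_mod_cast hkl
        linarith [h3.2, h4.1]
      intro k _ l _ hne
      rcases lt_or_gt_of_ne hne with h3 | h3
      · exact hlt _ _ h3
      · exact (hlt _ _ h3).symm
    rw [← Finset.mul_sum, Finset.sum_add_distrib] at h2
    simp only [Finset.sum_const, Finset.card_range, nsmul_eq_mul, mul_one] at h2
    rw [run_append, cost_append]
    have h3 := cost_nonneg (runFrom A H P)
    have h4 : (0 : ℝ) ≤ ∑ i ∈ Finset.range n, (x i : ℝ) :=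
      Finset.sum_nonneg fun i _ => Nat.cast_nonneg _
    calc (L : ℝ) / 16 * optCost (H ++ P) ≤
          L / 16 * (4 * (n + ∑ i ∈ Finset.range n, (x i : ℝ))) :=
          mul_le_mul_of_nonneg_left (by linarith) (by positivity)
      _ ≤ _ := by linarith

theorem logRatio_le_of_lt (hL : 2 ≤ L) {N : ℕ} (h8 : 8 ≤ N) (hN : N < 2 * (L + 1) ^ (L + 1)) :
    logRatio N ≤ 4 * L := by
  obtain ⟨y, hy, he, hye⟩ := logRatio_eq N
  rw [max_eq_left (by omega)] at hye
  have hL' : (2 : ℝ) ≤ L := by exact_mod_cast hL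
  have hN0 : (0 : ℝ) < N := by exact_mod_cast (by omega : 0 < N)
  set b := Real.logb 2 ((L : ℝ) + 1) with hb
  have hb1 : 1 ≤ b := by
    rw [hb, Real.le_logb_iff_rpow_le (by norm_num) (by linarith), Real.rpow_one]
    linarith
  have hyb : y ≤ 1 + (L + 1) * b := by
    have h1 : (N : ℝ) ≤ 2 * ((L : ℝ) + 1) ^ (L + 1) := by exact_mod_cast hN.le
    rw [hye]
    refine (Real.logb_le_logb_of_le (by norm_num) hN0 h1).trans (le_of_eq ?_)
    rw [Real.logb_mul (by norm_num) (by positivity), Real.logb_pow,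
      Real.logb_self_eq_one (by norm_num)]
    push_cast
    rfl
  have hpos : (L : ℝ) + 1 ≤ (L + 1) * b := le_mul_of_one_le_right (by linarith) hb1
  have h1 := div_logb_le hy hyb
  have h2 : b ≤ Real.logb 2 (1 + (L + 1) * b) :=
    Real.logb_le_logb_of_le (by norm_num) (by linarith) (by linarith)
  have h3 : (1 + (L + 1) * b) / Real.logb 2 (1 + (L + 1) * b) ≤ (L : ℝ) + 2 := by
    rw [div_le_iff₀ (by linarith)]
    calc 1 + (L + 1) * b ≤ ((L : ℝ) + 2) * b := by linarith
      _ ≤ _ := mul_le_mul_of_nonneg_left h2 (by linarith)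
  rw [he]
  linarith

theorem logRatio_le_three {N : ℕ} (hN : N < 8) : logRatio N ≤ 3 := by
  obtain ⟨y, hy, he, hye⟩ := logRatio_eq N
  have h1 : y ≤ 3 := by
    have h2 : ((max N 4 : ℕ) : ℝ) ≤ 2 ^ 3 := by
      have : max N 4 ≤ 2 ^ 3 := max_le (by omega) (by norm_num)
      exact_mod_cast this
    rw [hye]
    refine (Real.logb_le_logb_of_le (by norm_num) (by positivity) h2).trans (le_of_eq ?_)
    rw [Real.logb_pow, Real.logb_self_eq_one (by norm_num)]
    norm_num
  have h2 : 1 ≤ Real.logb 2 y := by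
    rw [Real.le_logb_iff_rpow_le (by norm_num) (by linarith), Real.rpow_one]
    exact hy
  rw [he, div_le_iff₀ (by linarith)]
  linarith

theorem exists_requests (hA : IsOnline A) {N : ℕ} (hN : 1 ≤ N) :
    ∃ Q : List Point, ValidRequests Q ∧ Q.Nodup ∧ Q.length = N ∧ 0 < optCost Q ∧
      1 / 64 * logRatio N * optCost Q ≤ cost (run A Q) := by
  rcases lt_or_ge N 8 with h8 | h8
  · -- `logRatio` is bounded here, and any feasible solution costs at least the optimum
    set f : ℕ → Point := fun j => (0, (j : ℝ) + 1) with hf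
    obtain ⟨k, rfl⟩ : ∃ k, N = k + 1 := ⟨N - 1, by omega⟩
    have hval : ValidRequests ((List.range (k + 1)).map f) := by
      refine ⟨?_, ?_⟩
      · intro q hq
        obtain ⟨j, -, rfl⟩ := List.mem_map.1 hq
        exact ⟨le_rfl, by positivity⟩
      · rw [List.map_map, List.pairwise_map]
        refine List.pairwise_lt_range.imp fun {i j} h => ?_
        have : (i : ℝ) < j := by exact_mod_cast h
        simp only [Function.comp_apply, hf]
        linarith
    have hfeas : Feasible (run A ((List.range (k + 1)).map f)) ((List.range (k + 1)).map f) := by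
      rw [List.range_succ, List.map_append, List.map_singleton] at hval ⊢
      exact (hA _ _ hval).2
    have hpos : 0 < optCost ((List.range (k + 1)).map f) := by
      refine lt_of_lt_of_le ?_ (add_le_optCost (q := f 0)
        (List.mem_map_of_mem (List.mem_range.2 (Nat.succ_pos k))) ⟨_, hfeas⟩)
      simp [hf]
    refine ⟨_, hval, List.nodup_range.map fun i j hij => ?_, by simp, hpos, ?_⟩
    · have := congrArg Prod.snd hij
      simpa [hf] using this
    · refine le_trans ?_ (optCost_le hfeas)
      exact mul_le_of_le_one_left hpos.le (by linarith [logRatio_le_three h8])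
  · have hex : ∃ L, N < 2 * (L + 1) ^ (L + 1) :=
      ⟨N, by
        have := Nat.le_self_pow (n := N + 1) (by omega) (N + 1)
        omega⟩
    classical
    set L := Nat.find hex with hLdef
    have hspec : N < 2 * (L + 1) ^ (L + 1) := Nat.find_spec hex
    have hL : 2 ≤ L := by
      by_contra hlt
      have : L = 0 ∨ L = 1 := by omega
      rcases this with h | h <;> rw [h] at hspec <;> norm_num at hspec <;> omega
    have hLN : 2 * L ^ L ≤ N := by
      have := Nat.find_min hex (m := L - 1) (by omega)
      rw [Nat.sub_add_cancel (by omega)] at this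
      omega
    obtain ⟨Q, h1, h2, h3, h4, h5⟩ := exists_requests_of_le hA hL hLN
    refine ⟨Q, h1, h2, h3, h4, le_trans ?_ h5⟩
    exact mul_le_mul_of_nonneg_right (by linarith [logRatio_le_of_lt hL h8 hspec]) h4.le

end RSA

theorem mainTheorem1 :
    -- for all choices that it leaves open, the algorithm is a correct online algorithm
    (∀ τ : RSA.TieBreak, RSA.IsOnline (RSA.onRSA τ)) ∧
    -- it is `O(log N / log log N)`-competitive
    (∃ K : ℝ, 0 < K ∧ ∀ (τ : RSA.TieBreak) (Q : List RSA.Point), RSA.ValidRequests Q →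
      RSA.cost (RSA.run (RSA.onRSA τ) Q) ≤ K * RSA.logRatio Q.length * RSA.optCost Q) ∧
    -- it is optimal: no online algorithm has a competitive ratio of a smaller order
    (∃ c : ℝ, 0 < c ∧ ∀ A : RSA.Algorithm, RSA.IsOnline A → ∀ N : ℕ, 1 ≤ N →
      ∃ Q : List RSA.Point, RSA.ValidRequests Q ∧ Q.Nodup ∧ Q.length = N ∧ 0 < RSA.optCost Q ∧
        c * RSA.logRatio N * RSA.optCost Q ≤ RSA.cost (RSA.run A Q)) := by
  refine ⟨RSA.isOnline_onRSA, ⟨108800, by norm_num,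
    fun τ Q hQ => RSA.cost_run_onRSA_le_optCost τ hQ⟩,
    ⟨1 / 64, by norm_num, fun A hA N hN => RSA.exists_requests hA hN⟩⟩
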